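/- Let $H_1=\mathbb R^3$ be the Heisenberg group with group law $(x_1,y_1,z_1)\circ(x_2,y_2,z_2)=(x_1+x_2,\,y_1+y_2,\,z_1+z_2+y_1x_2-x_1y_2)$, left-invariant orthonormal parallel frame $\mathring e_1=\partial_x+y\,\partial_z$, $\mathring e_2=\partial_y-x\,\partial_z$, $T=\partial_z$, connection $\nabla$ making this frame parallel, contact planes $\xi=\ker\Theta=\operatorname{span}(\mathring e_1,\mathring e_2)$ with $\Theta=dz+x\,dy-y\,dx$, and $J\mathring e_1=\mathring e_2$, $J\mathring e_2=-\mathring e_1$. Let $\Sigma\subset H_1$ be an embedded surface of class $C^2$ whose singular set is $S=\{p\in\Sigma: T_p\Sigma=\xi_p\}$, and suppose that $\Sigma$ is $C^\infty$ on its regular part $\Sigma\setminus S$. Suppose that on $\Sigma\setminus S$ there is a smooth unit field $e_1$ spanning $T\Sigma\cap\xi$ such that, with $e_2=Je_1$, $\nabla_{e_1}e_2=-c\,e_1$ for a constant $c\neq0$ (i.e. $\Sigma$ has constant $p$-mean curvature $H=c\ne 0$). Let $\alpha$ be the function on $\Sigma\setminus S$ for which $\alpha e_2+T$ is tangent to $\Sigma$.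 (a) For every $p\in S$, either $p$ is an isolated point of $S$, or the connected component of $S$ containing $p$ is a smooth curve, in the sense that every point $q$ of this component has an open neighbourhood $W$ in $H_1$ such that $S\cap W$ is the image of a $C^\infty$ embedding $\mathbb R\to H_1$. (b) If $p$ is an isolated point of $S$, then there is an open neighbourhood $W$ of $p$ in $H_1$ with the following two properties. (i) $(\Sigma\cap W)\setminus\{p\}$ is of special type I with constant $\zeta_1$: there is a constant $k$ such that around each of its points there are local coordinates $(s,\theta)$ of $\Sigma$ with $e_1=\partial_s$, $1-\cos(cs+k)\neq 0$, $$\alpha=\frac c2\,\frac{\sin(cs+k)}{1-\cos(cs+k)},\qquad \frac{\alpha e_2+T}{\sqrt{1+\alpha^2}}=-\frac{c/2}{\sqrt{1+\alpha^2}}\,\partial_s+\frac{c^2/2}{\bigl(1-\cos(cs+k)\bigr)\sqrt{1+\alpha^2}}\,\partial_\theta .$$ (ii) $\Sigma\cap W$ is a piece of a Pansu sphere containing a pole: with $\lambda=|c|/2$, there are $g\in H_1$ and a pole $P\in\{(0,0,\tfrac{\pi}{4\lambda^2}),(0,0,-\tfrac{\pi}{4\lambda^2})\}$ such that $g\circ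 P=p$ and $\Sigma\cap W=(g\circ\mathcal P_\lambda)\cap W$, where $\mathcal P_\lambda$ is the Pansu sphere, i.e. the set of all points $$\bigl(x(s)\cos\theta-y(s)\sin\theta,\ x(s)\sin\theta+y(s)\cos\theta,\ t(s)\bigr),\qquad 0\le s\le \tfrac{\pi}{\lambda},\ \theta\in\mathbb R,$$ with $x(s)=\frac{1}{2\lambda}\sin(2\lambda s)$, $y(s)=\frac1{2\lambda}-\frac{1}{2\lambda}\cos(2\lambda s)$, $t(s)=\frac1{4\lambda^2}\sin(2\lambda s)-\frac{s}{2\lambda}+\frac{\pi}{4\lambda^2}$. -/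

import Mathlib

open Set Filter Topology
open scoped ContDiff

/-- The underlying space `ℝ³` of the Heisenberg group `H₁`, with points `(x, y, z)`. -/
abbrev Heis : Type := ℝ × ℝ × ℝ

namespace Heis

/-! ### The Heisenberg group and its pseudo-hermitian structure

A tangent vector at any point is written in the coordinate frame `∂x, ∂y, ∂z`, hence is again an
element of `ℝ³`. -/

/-- The group law of `H₁`. -/
def op (p q : Heis) : Heis :=
  (p.1 + q.1, p.2.1 + q.2.1, p.2.2 + q.2.2 + p.2.1 * q.1 - p.1 * q.2.1)

/-- The left invariant field `∂x + y ∂z`. -/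
def E₁ (p : Heis) : Heis := (1, 0, p.2.1)

/-- The left invariant field `∂y - x ∂z`. -/
def E₂ (p : Heis) : Heis := (0, 1, -p.1)

/-- The left invariant field `∂z`. -/
def T : Heis := (0, 0, 1)

/-- The contact form `Θ = dz + x dy - y dx` at `p`, evaluated on `v`. -/
def contactForm (p v : Heis) : ℝ := v.2.2 + p.1 * v.2.1 - p.2.1 * v.1

/-- The contact plane `ξ_p = ker Θ_p`. -/
def contactPlane (p : Heis) : Set Heis := {v | contactForm p v = 0}

/-- The components of a tangent vector at `p` in the left invariant frame `E₁, E₂, T`. -/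
def frameCoord (p v : Heis) : ℝ × ℝ × ℝ := (v.1, v.2.1, contactForm p v)

theorem eq_frameCoord (p v : Heis) :
    v = (frameCoord p v).1 • E₁ p + (frameCoord p v).2.1 • E₂ p + (frameCoord p v).2.2 • T := by
  ext <;> simp [frameCoord, E₁, E₂, T, contactForm]
  ring

/-- The adapted metric `g_Θ`, for which `E₁, E₂, T` is an orthonormal frame. -/
def metric (p v w : Heis) : ℝ :=
  v.1 * w.1 + v.2.1 * w.2.1 + contactForm p v * contactForm p w

/-- The CR structure: `J (a E₁ + b E₂) = a E₂ - b E₁` for a vector `a E₁ + b E₂` of `ξ_p`. -/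
def J (p v : Heis) : Heis := v.1 • E₂ p - v.2.1 • E₁ p

/-! ### Surfaces, singular and regular points -/

/-- Near `p`, the set `S` is a regular level set of a function of class `C^n`. -/
def IsSurfaceAt (n : WithTop ℕ∞) (S : Set Heis) (p : Heis) : Prop :=
  ∃ (W : Set Heis) (f : Heis → ℝ), IsOpen W ∧ p ∈ W ∧ ContDiffOn ℝ n f W ∧
    fderiv ℝ f p ≠ 0 ∧ S ∩ W = {q ∈ W | f q = 0}

/-- The tangent plane `T_p S`: the velocities at `p` of the curves in `S`. -/
def tangentPlane (S : Set Heis) (p : Heis) : Set Heis :=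
  {v | ∃ γ : ℝ → Heis, γ 0 = p ∧ HasDerivAt γ v 0 ∧ ∀ᶠ t in 𝓝 0, γ t ∈ S}

/-- The singular set: the tangent plane coincides with the contact plane. -/
def singularSet (S : Set Heis) : Set Heis := {p ∈ S | tangentPlane S p = contactPlane p}

/-- The regular part. -/
def regularPart (S : Set Heis) : Set Heis := S \ singularSet S

/-- A surface of class `C²`, of class `C^∞` on its regular part. -/
structure IsSurface (S : Set Heis) : Prop where
  c2 : ∀ p ∈ S, IsSurfaceAt 2 S p
  smooth : ∀ p ∈ regularPart S, IsSurfaceAt ∞ S p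

/-! ### Characteristic field, `p`-mean curvature, `α`-function -/

/-- `e₁` is a smooth unit field on the regular part which spans `TS ∩ ξ`. Its values off the
regular part are irrelevant. -/
structure IsCharacteristicField (S : Set Heis) (e₁ : Heis → Heis) : Prop where
  smooth : ContDiffOn ℝ ∞ e₁ (regularPart S)
  tangent : ∀ p ∈ regularPart S, e₁ p ∈ tangentPlane S p
  horizontal : ∀ p ∈ regularPart S, e₁ p ∈ contactPlane p
  unit : ∀ p ∈ regularPart S, metric p (e₁ p) (e₁ p) = 1

/-- For a field `V` on `R` and a vector `v` tangent to `R` at `p`: `∇_v V = w` at `p`, where `∇` is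
the connection for which `E₁, E₂, T` are parallel. That is, along each curve in `R` with velocity
`v` at `p`, the frame components of `V` have the frame components of `w` as derivatives. -/
def HasCovDerivAt (R : Set Heis) (V : Heis → Heis) (p v w : Heis) : Prop :=
  ∀ γ : ℝ → Heis, γ 0 = p → HasDerivAt γ v 0 → (∀ᶠ t in 𝓝 0, γ t ∈ R) →
    HasDerivAt (fun t => frameCoord (γ t) (V (γ t))) (frameCoord p w) 0

/-- The `p`-mean curvature with respect to `e₁` is the constant `c` on the whole regular part:
`∇_{e₁} e₂ = - c e₁` with `e₂ = J e₁`. -/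
def HasConstPMeanCurvature (S : Set Heis) (e₁ : Heis → Heis) (c : ℝ) : Prop :=
  ∀ p ∈ regularPart S,
    HasCovDerivAt (regularPart S) (fun q => J q (e₁ q)) p (e₁ p) (-c • e₁ p)

/-- `α` is the `α`-function on the regular part: `α e₂ + T` is tangent to `S`. -/
def IsAlphaFunction (S : Set Heis) (e₁ : Heis → Heis) (α : Heis → ℝ) : Prop :=
  ∀ p ∈ regularPart S, α p • J p (e₁ p) + T ∈ tangentPlane S p

/-! ### Normal coordinates and special type I -/

/-- `Y : U → S` is (the inverse of) a compatible coordinate system `(s, θ)` on an open piece of the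
regular part, `e₁ = ∂/∂s`. -/
structure IsCompatibleChart (S : Set Heis) (e₁ : Heis → Heis) (U : Set (ℝ × ℝ))
    (Y : ℝ × ℝ → Heis) : Prop where
  isOpen : IsOpen U
  smooth : ContDiffOn ℝ ∞ Y U
  injOn : InjOn Y U
  immersion : ∀ u ∈ U, Function.Injective (fderiv ℝ Y u)
  mapsTo : MapsTo Y U (regularPart S)
  deriv_s : ∀ u ∈ U, fderiv ℝ Y u (1, 0) = e₁ (Y u)

/-- `Y` is a normal coordinate system `(s, θ)` in which
`α = (c/2) sin (c s + ζ₁ θ) / (ζ₂ θ - cos (c s + ζ₁ θ))`: the unit field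
`ê₂ = (α e₂ + T) / √(1 + α²)` equals `a ∂/∂s + b ∂/∂θ` with
`a = -(c/2) / √(1 + α²)` and `b = (c²/2) / (|ζ₂ θ - cos (c s + ζ₁ θ)| √(1 + α²))`. -/
structure IsNormalChart (S : Set Heis) (e₁ : Heis → Heis) (α : Heis → ℝ) (c : ℝ)
    (U : Set (ℝ × ℝ)) (Y : ℝ × ℝ → Heis) (ζ₁ ζ₂ : ℝ → ℝ) : Prop
    extends IsCompatibleChart S e₁ U Y where
  denom_ne_zero : ∀ u ∈ U, ζ₂ u.2 - Real.cos (c * u.1 + ζ₁ u.2) ≠ 0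
  alpha_eq : ∀ u ∈ U, α (Y u) =
    c / 2 * (Real.sin (c * u.1 + ζ₁ u.2) / (ζ₂ u.2 - Real.cos (c * u.1 + ζ₁ u.2)))
  frame_eq : ∀ u ∈ U,
    (1 / Real.sqrt (1 + α (Y u) ^ 2)) • (α (Y u) • J (Y u) (e₁ (Y u)) + T) =
      (-(c / 2) / Real.sqrt (1 + α (Y u) ^ 2)) • fderiv ℝ Y u (1, 0) +
      (c ^ 2 / 2 / (|ζ₂ u.2 - Real.cos (c * u.1 + ζ₁ u.2)| * Real.sqrt (1 + α (Y u) ^ 2))) •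
        fderiv ℝ Y u (0, 1)

/-- On the piece `R` of the regular part, the surface is of special type I (`ζ₂ = 1`) with `ζ₁`
equal to the constant `k`. -/
def IsSpecialTypeIConst (S : Set Heis) (e₁ : Heis → Heis) (α : Heis → ℝ) (c : ℝ) (R : Set Heis)
    (k : ℝ) : Prop :=
  ∀ q ∈ R, ∃ (U : Set (ℝ × ℝ)) (Y : ℝ × ℝ → Heis),
    q ∈ Y '' U ∧ IsNormalChart S e₁ α c U Y (fun _ => k) (fun _ => 1)

/-! ### The Pansu sphere -/

/-- The generating curve `(x(s), y(s), t(s))` of the Pansu sphere rotated by the angle `θ` about the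
`z`-axis. -/
noncomputable def pansuParam (lam s θ : ℝ) : Heis :=
  let x := 1 / (2 * lam) * Real.sin (2 * lam * s)
  let y := -(1 / (2 * lam)) * Real.cos (2 * lam * s) + 1 / (2 * lam)
  (x * Real.cos θ - y * Real.sin θ, x * Real.sin θ + y * Real.cos θ,
    1 / (4 * lam ^ 2) * Real.sin (2 * lam * s) - 1 / (2 * lam) * s + Real.pi / (4 * lam ^ 2))

/-- The Pansu sphere of `p`-mean curvature `2 lam`, for `lam > 0`. -/
def pansuSphere (lam : ℝ) : Set Heis :=
  {p | ∃ s ∈ Icc 0 (Real.pi / lam), ∃ θ : ℝ, p = pansuParam lam s θ}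

/-- The north pole and the south pole of the Pansu sphere. -/
def pansuPoles (lam : ℝ) : Set Heis :=
  {(0, 0, Real.pi / (4 * lam ^ 2)), (0, 0, -(Real.pi / (4 * lam ^ 2)))}

/-! ### Isolated points and smooth curves -/

/-- `p` is an isolated point of `A`. -/
def IsIsolatedIn (A : Set Heis) (p : Heis) : Prop :=
  ∃ W : Set Heis, IsOpen W ∧ A ∩ W = {p}

/-- Near `q`, the set `A` is a smooth embedded curve through `q`. -/
def IsSmoothCurveNear (A : Set Heis) (q : Heis) : Prop :=
  q ∈ A ∧ ∃ (W : Set Heis) (γ : ℝ → Heis), IsOpen W ∧ q ∈ W ∧ ContDiff ℝ ∞ γ ∧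
    (∀ t, deriv γ t ≠ 0) ∧ IsEmbedding γ ∧ range γ = A ∩ W

end Heis

/-!
Near a singular point the surface is a graph `z = u (X)` over an open subset of the plane `ℂ`, and
its singular points are the zeros of the `C¹` vector field `F = charField u`, for which the contact
form restricted to the surface is `-cross F`. The projection `e` of `e₁` is a unit field parallel to
`F`, and constant `p`-mean curvature `c` says that `e` turns at the rate `c` along itself: its
integral curves, the leaves, are circular arcs of curvature `c`, and the height `u` along such an
arc is explicit (`IsCharGraph.field_eq_rot`, `IsCharGraph.height_eq`).

Since `F = g e`, the curvature equation reads `cross F (DF F) = c g ^ 3`. The resulting bound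
`|cross F (DF F)| ≤ |c| ‖F‖ ^ 3` also holds at singular points. Blowing it up at a singular point
`X₀`, and using that the trace of `DF` is `-2`, one finds that `DF X₀` is either `-1` or of rank one
with the single nonzero eigenvalue `-2`, along a unit vector `v` which spans its range
(`IsCharGraph.linearization_dichotomy`).

If `DF X₀ = -1`, then `X₀` is an isolated zero of `F`. A ray out of `X₀` along an eigenvector of
`DF X₀` is asymptotically a leaf, so a limit of circular arcs shows that the arcs out of `X₀` in
such a direction are leaves (`IsCharGraph.field_eq_rot_of_singular`). As every direction is an
eigenvector, the surface near `X₀` is the union of all arcs out of `X₀`; they have a common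
orientation since a punctured disc is connected (`IsCharGraph.exists_radial_leaves`). These arcs are
those from a pole of a Pansu sphere (`op_image_pansuSphere`), and arc length and direction are the
normal coordinates of special type I (`isNormalChart_leafPt`).

If `DF X₀` has rank one, the difficulty is that `F` is only `C¹`, so the implicit function theorem
applied to `F` gives no smooth curve of zeros. First, near `X₀` the zeros of `F` are the zeros of
`dot v F` (`IsCharGraph.exists_ball_charField_eq_zero`). Next, one starts at a regular point `m` of
the leaf through `X₀`, where everything is smooth, and follows the leaves which leave a transversal
of this leaf (`fan`). The contact form of the variation of this family is given by a smooth explicit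
function `fanContact` even where the leaves reach singular points, and near `X₀` it vanishes exactly
at these points. Its zero set is a smooth curve because its derivative along the leaves is twice the
Jacobian determinant of the family. Hence the singular set is a smooth curve
(`IsCharGraph.exists_smooth_singular_curve`). Finally, an isolated point is a connected component by
itself, so the two cases do not mix in a connected component.
-/

namespace Heis

/-! ### Planar vector algebra and circular arcs -/

/-- The oriented area spanned by two vectors of the plane `ℂ`. -/
def cross (z w : ℂ) : ℝ := z.re * w.im - z.im * w.re

/-- The Euclidean scalar product of the plane `ℂ`. -/
def dot (z w : ℂ) : ℝ := z.re * w.re + z.im * w.im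

theorem abs_cross_le (z w : ℂ) : |cross z w| ≤ ‖z‖ * ‖w‖ := by
  have h : cross z w = ((starRingEnd ℂ) z * w).im := by simp [cross]; ring
  rw [h]
  calc _ ≤ ‖(starRingEnd ℂ) z * w‖ := Complex.abs_im_le_norm _
    _ = _ := by simp

theorem dot_self (z : ℂ) : dot z z = ‖z‖ ^ 2 := by
  rw [← Complex.normSq_eq_norm_sq, Complex.normSq_apply, dot]

theorem cross_self (z : ℂ) : cross z z = 0 := by
  simp [cross]; ring

theorem cross_add_right (z w w' : ℂ) : cross z (w + w') = cross z w + cross z w' := by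
  simp [cross]; ring

theorem cross_add_left (z z' w : ℂ) : cross (z + z') w = cross z w + cross z' w := by
  simp [cross]; ring

theorem cross_smul_right (r : ℝ) (z w : ℂ) : cross z (r • w) = r * cross z w := by
  simp [cross]; ring

theorem cross_smul_left (r : ℝ) (z w : ℂ) : cross (r • z) w = r * cross z w := by
  simp [cross]; ring

theorem dot_smul_right (r : ℝ) (z w : ℂ) : dot z (r • w) = r * dot z w := by
  simp [dot]; ring

/-- The components of `w` in the orthonormal basis `v, I * v`. -/
theorem eq_dot_smul_add_cross_smul {v : ℂ} (hv : ‖v‖ = 1) (w : ℂ) :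
    w = dot v w • v + cross v w • (Complex.I * v) := by
  have h : v.re * v.re + v.im * v.im = 1 := by
    have := dot_self v
    rw [hv] at this
    simpa [dot] using this
  apply Complex.ext
  · simp [dot, cross]; linear_combination (-w.re) * h
  · simp [dot, cross]; linear_combination (-w.im) * h

/-- A vector without `I * v` component is a multiple of `v`. -/
theorem eq_dot_smul_of_cross_eq_zero {v : ℂ} (hv : ‖v‖ = 1) {w : ℂ} (h : cross v w = 0) :
    w = dot v w • v := by
  have := eq_dot_smul_add_cross_smul hv w
  rwa [h, zero_smul, add_zero] at this

theorem cross_mul_right_unit {v : ℂ} (hv : ‖v‖ = 1) (z w : ℂ) :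
    cross (v * z) (v * w) = cross z w := by
  have h : v.re * v.re + v.im * v.im = 1 := by
    have := dot_self v
    rw [hv] at this
    simpa [dot] using this
  simp only [cross, Complex.mul_re, Complex.mul_im]
  linear_combination (z.re * w.im - z.im * w.re) * h

theorem contDiff_cross {n : WithTop ℕ∞} : ContDiff ℝ n (fun p : ℂ × ℂ => cross p.1 p.2) := by
  unfold cross
  have hre : ContDiff ℝ n Complex.re := Complex.reCLM.contDiff
  have him : ContDiff ℝ n Complex.im := Complex.imCLM.contDiff
  exact ((hre.comp contDiff_fst).mul (him.comp contDiff_snd)).sub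
    ((him.comp contDiff_fst).mul (hre.comp contDiff_snd))

theorem contDiff_dot {n : WithTop ℕ∞} : ContDiff ℝ n (fun p : ℂ × ℂ => dot p.1 p.2) := by
  unfold dot
  have hre : ContDiff ℝ n Complex.re := Complex.reCLM.contDiff
  have him : ContDiff ℝ n Complex.im := Complex.imCLM.contDiff
  exact ((hre.comp contDiff_fst).mul (hre.comp contDiff_snd)).add
    ((him.comp contDiff_fst).mul (him.comp contDiff_snd))

theorem hasDerivAt_re {f : ℝ → ℂ} {f' : ℂ} {t : ℝ} (h : HasDerivAt f f' t) :
    HasDerivAt (fun s => (f s).re) f'.re t :=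
  Complex.reCLM.hasFDerivAt.comp_hasDerivAt t h

theorem hasDerivAt_im {f : ℝ → ℂ} {f' : ℂ} {t : ℝ} (h : HasDerivAt f f' t) :
    HasDerivAt (fun s => (f s).im) f'.im t :=
  Complex.imCLM.hasFDerivAt.comp_hasDerivAt t h

theorem hasDerivAt_cross {f g : ℝ → ℂ} {f' g' : ℂ} {t : ℝ} (hf : HasDerivAt f f' t)
    (hg : HasDerivAt g g' t) :
    HasDerivAt (fun s => cross (f s) (g s)) (cross f' (g t) + cross (f t) g') t := by
  have := ((hasDerivAt_re hf).mul (hasDerivAt_im hg)).sub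
    ((hasDerivAt_im hf).mul (hasDerivAt_re hg))
  refine this.congr_deriv ?_
  simp only [cross]; ring

theorem hasDerivAt_dot {f g : ℝ → ℂ} {f' g' : ℂ} {t : ℝ} (hf : HasDerivAt f f' t)
    (hg : HasDerivAt g g' t) :
    HasDerivAt (fun s => dot (f s) (g s)) (dot f' (g t) + dot (f t) g') t := by
  have := ((hasDerivAt_re hf).mul (hasDerivAt_re hg)).add
    ((hasDerivAt_im hf).mul (hasDerivAt_im hg))
  refine this.congr_deriv ?_
  simp only [dot]; ring

/-- The unit vector `exp (i c s)`: the velocity at time `s` of the unit speed circle of signed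
curvature `c` with initial velocity `1`. -/
noncomputable def rot (c s : ℝ) : ℂ := ⟨Real.cos (c * s), Real.sin (c * s)⟩

/-- The unit speed circle of signed curvature `c` which starts at `0` with velocity `1`. -/
noncomputable def arc (c s : ℝ) : ℂ := ⟨Real.sin (c * s) / c, (1 - Real.cos (c * s)) / c⟩

theorem norm_rot (c s : ℝ) : ‖rot c s‖ = 1 := by
  have h : ‖rot c s‖ ^ 2 = 1 := by
    rw [← dot_self]
    simp only [dot, rot]
    nlinarith [Real.sin_sq_add_cos_sq (c * s)]
  have h0 := norm_nonneg (rot c s)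
  nlinarith

theorem contDiff_rot {n : WithTop ℕ∞} (c : ℝ) : ContDiff ℝ n (rot c) := by
  have : rot c = fun s => Complex.equivRealProdCLM.symm (Real.cos (c * s), Real.sin (c * s)) := by
    rfl
  rw [this]
  exact Complex.equivRealProdCLM.symm.contDiff.comp (by fun_prop)

theorem contDiff_arc {n : WithTop ℕ∞} (c : ℝ) : ContDiff ℝ n (arc c) := by
  have : arc c = fun s => Complex.equivRealProdCLM.symm
      (Real.sin (c * s) / c, (1 - Real.cos (c * s)) / c) := by
    rfl
  rw [this]
  exact Complex.equivRealProdCLM.symm.contDiff.comp (by fun_prop)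

theorem hasDerivAt_complex {f g : ℝ → ℝ} {f' g' t : ℝ} (hf : HasDerivAt f f' t)
    (hg : HasDerivAt g g' t) :
    HasDerivAt (fun s => (⟨f s, g s⟩ : ℂ)) ⟨f', g'⟩ t := by
  have h := hf.prodMk hg
  have := Complex.equivRealProdCLM.symm.hasFDerivAt.comp_hasDerivAt t h
  exact this

theorem hasDerivAt_arc {c : ℝ} (hc : c ≠ 0) (s : ℝ) : HasDerivAt (arc c) (rot c s) s := by
  have h1 : HasDerivAt (fun s : ℝ => c * s) c s := by
    simpa using (hasDerivAt_id s).const_mul c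
  have h2 := (h1.sin).div_const c
  have h3 := ((h1.cos).const_sub 1).div_const c
  refine (hasDerivAt_complex h2 h3).congr_deriv ?_
  apply Complex.ext <;> simp [rot] <;> field_simp

theorem hasDerivAt_rot (c s : ℝ) : HasDerivAt (rot c) (c * Complex.I * rot c s) s := by
  have h1 : HasDerivAt (fun s : ℝ => c * s) c s := by
    simpa using (hasDerivAt_id s).const_mul c
  refine (hasDerivAt_complex h1.cos h1.sin).congr_deriv ?_
  apply Complex.ext <;> simp [rot] <;> ring

theorem rot_zero (c : ℝ) : rot c 0 = 1 := by
  apply Complex.ext <;> simp [rot]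

theorem arc_zero (c : ℝ) : arc c 0 = 0 := by
  apply Complex.ext <;> simp [arc]

/-- Running back along a circle. -/
theorem arc_add_rot_mul_arc_neg (c s : ℝ) : arc c s + rot c s * arc c (-s) = 0 := by
  have h := Real.sin_sq_add_cos_sq (c * s)
  apply Complex.ext
  · simp [arc, rot]; ring
  · simp [arc, rot]
    have h' : Real.sin (c * s) * Real.sin (c * s) = 1 - Real.cos (c * s) * Real.cos (c * s) := by
      nlinarith
    linear_combination (-1 / c) * h'

theorem rot_mul_rot_neg (c s : ℝ) : rot c s * rot c (-s) = 1 := by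
  have h := Real.sin_sq_add_cos_sq (c * s)
  apply Complex.ext
  · simp [rot]; nlinarith
  · simp [rot]; ring

theorem dot_rot_arc (c s : ℝ) : dot (rot c s) (arc c s) = Real.sin (c * s) / c := by
  simp [dot, rot, arc]; ring

theorem cross_arc_rot {c : ℝ} (s : ℝ) :
    cross (arc c s) (rot c s) = (1 - Real.cos (c * s)) / c := by
  have h : Real.sin (c * s) * Real.sin (c * s) = 1 - Real.cos (c * s) * Real.cos (c * s) := by
    nlinarith [Real.sin_sq_add_cos_sq (c * s)]
  simp [cross, rot, arc]
  linear_combination (1 / c) * h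

theorem dot_arc_self (c s : ℝ) : dot (arc c s) (arc c s) = 2 * (1 - Real.cos (c * s)) / c ^ 2 := by
  have h : Real.sin (c * s) * Real.sin (c * s) = 1 - Real.cos (c * s) * Real.cos (c * s) := by
    nlinarith [Real.sin_sq_add_cos_sq (c * s)]
  simp [dot, arc]
  linear_combination (1 / c ^ 2) * h

theorem norm_rot_sub_one_le (c s : ℝ) : ‖rot c s - 1‖ ≤ |c| * |s| := by
  have h : ‖rot c s - 1‖ ^ 2 ≤ (|c| * |s|) ^ 2 := by
    rw [← dot_self, ← abs_mul, sq_abs]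
    have h1 := Real.one_sub_sq_div_two_le_cos (x := c * s)
    have h2 := Real.sin_sq_add_cos_sq (c * s)
    simp only [dot, rot, Complex.sub_re, Complex.sub_im, Complex.one_re, Complex.one_im]
    nlinarith
  exact abs_le_of_sq_le_sq' h (by positivity) |>.2

theorem norm_arc_sub_le {c : ℝ} (hc : c ≠ 0) (s : ℝ) : ‖arc c s - s‖ ≤ |c| * |s| * |s| := by
  have key : ∀ r ∈ uIcc 0 s, HasDerivWithinAt (fun r : ℝ => arc c r - (r : ℂ)) (rot c r - 1)
      (uIcc 0 s) r := fun r _ =>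
    ((hasDerivAt_arc hc r).sub (Complex.ofRealCLM.hasDerivAt)).hasDerivWithinAt
  have bd : ∀ r ∈ uIcc 0 s, ‖rot c r - 1‖ ≤ |c| * |s| := by
    intro r hr
    refine (norm_rot_sub_one_le c r).trans ?_
    have : |r| ≤ |s| := by
      have := abs_sub_left_of_mem_uIcc hr
      simpa using this
    gcongr
  have := (convex_uIcc 0 s).norm_image_sub_le_of_norm_hasDerivWithin_le key bd
    left_mem_uIcc right_mem_uIcc
  simpa [arc_zero] using this

/-! ### The characteristic direction of a graph -/

/-- For the graph `z = u (x, y)`, over the point `X = x + i y`: the vector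
`F = (-(u_y + x), u_x - y)`. It spans the projection to the plane of the intersection of the tangent
plane with the contact plane, and it vanishes exactly at the singular points. -/
noncomputable def charField (u : ℂ → ℝ) (X : ℂ) : ℂ :=
  Complex.I * ⟨fderiv ℝ u X 1, fderiv ℝ u X Complex.I⟩ - X

/-- The slope of the graph, expressed through `charField`. -/
theorem fderiv_eq_cross (u : ℂ → ℝ) (X h : ℂ) :
    fderiv ℝ u X h = -cross X h - cross (charField u X) h := by
  have hh : h = h.re • (1 : ℂ) + h.im • Complex.I := by
    apply Complex.ext <;> simp
  conv_lhs => rw [hh]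
  rw [map_add, map_smul, map_smul]
  simp [cross, charField]
  ring

theorem contDiffAt_charField {n m : WithTop ℕ∞} {u : ℂ → ℝ} {X : ℂ} (hu : ContDiffAt ℝ n u X)
    (hmn : m + 1 ≤ n) : ContDiffAt ℝ m (charField u) X := by
  have h : ContDiffAt ℝ m (fderiv ℝ u) X := hu.fderiv_right hmn
  have h1 : ContDiffAt ℝ m (fun Y => fderiv ℝ u Y 1) X := h.clm_apply contDiffAt_const
  have h2 : ContDiffAt ℝ m (fun Y => fderiv ℝ u Y Complex.I) X := h.clm_apply contDiffAt_const
  have h3 : ContDiffAt ℝ m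
      (fun Y => Complex.equivRealProdCLM.symm (fderiv ℝ u Y 1, fderiv ℝ u Y Complex.I)) X :=
    Complex.equivRealProdCLM.symm.contDiff.contDiffAt.comp X (h1.prodMk h2)
  exact (contDiffAt_const.mul h3).sub contDiffAt_id

/-- The symmetry of the second derivative of `u` says that the derivative of `charField` has
trace `-2`. -/
theorem trace_fderiv_charField {u : ℂ → ℝ} {X : ℂ} (hu : ContDiffAt ℝ 2 u X) :
    (fderiv ℝ (charField u) X 1).re + (fderiv ℝ (charField u) X Complex.I).im = -2 := by
  have h : DifferentiableAt ℝ (fderiv ℝ u) X :=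
    (hu.fderiv_right (m := 1) (by norm_num)).differentiableAt (by norm_num)
  have h1 : HasFDerivAt (fun Y => fderiv ℝ u Y 1)
      ((fderiv ℝ (fderiv ℝ u) X).flip 1) X := by
    have := h.hasFDerivAt.clm_apply (hasFDerivAt_const (1 : ℂ) X)
    simpa using this
  have h2 : HasFDerivAt (fun Y => fderiv ℝ u Y Complex.I)
      ((fderiv ℝ (fderiv ℝ u) X).flip Complex.I) X := by
    have := h.hasFDerivAt.clm_apply (hasFDerivAt_const (Complex.I : ℂ) X)
    simpa using this
  have h3 := Complex.equivRealProdCLM.symm.hasFDerivAt.comp X (h1.prodMk h2)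
  have h4 := (h3.const_mul Complex.I).sub (hasFDerivAt_id X)
  have h5 : fderiv ℝ (charField u) X = _ := h4.fderiv
  have hs := hu.isSymmSndFDerivAt (by simp) 1 Complex.I
  rw [h5]
  have e1 : ∀ p : ℝ × ℝ, (Complex.equivRealProdCLM.symm p).re = p.1 := fun p => rfl
  have e2 : ∀ p : ℝ × ℝ, (Complex.equivRealProdCLM.symm p).im = p.2 := fun p => rfl
  simp [e1, e2]
  linarith

/-- A `C²` graph over the open plane set `Ω`, together with the horizontal part `e` of the
characteristic field, whose integral curves turn with the constant curvature `c`. -/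
structure IsCharGraph (c : ℝ) (Ω : Set ℂ) (u : ℂ → ℝ) (e : ℂ → ℂ) : Prop where
  isOpen : IsOpen Ω
  c2 : ∀ X ∈ Ω, ContDiffAt ℝ 2 u X
  smooth : ∀ X ∈ Ω, charField u X ≠ 0 → ContDiffAt ℝ ∞ u X
  field_smooth : ∀ X ∈ Ω, charField u X ≠ 0 → ContDiffAt ℝ ∞ e X
  norm_field : ∀ X ∈ Ω, charField u X ≠ 0 → ‖e X‖ = 1
  parallel : ∀ X ∈ Ω, charField u X ≠ 0 → cross (charField u X) (e X) = 0
  curvature : ∀ X ∈ Ω, charField u X ≠ 0 → fderiv ℝ e X (e X) = c * Complex.I * e X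

namespace IsCharGraph

variable {c : ℝ} {Ω : Set ℂ} {u : ℂ → ℝ} {e : ℂ → ℂ}

theorem contDiffAt_field (h : IsCharGraph c Ω u e) {X : ℂ} (hX : X ∈ Ω) :
    ContDiffAt ℝ 1 (charField u) X :=
  contDiffAt_charField (h.c2 X hX) (by norm_num)

theorem hasFDerivAt_charField (h : IsCharGraph c Ω u e) {X : ℂ} (hX : X ∈ Ω) :
    HasFDerivAt (charField u) (fderiv ℝ (charField u) X) X :=
  ((h.contDiffAt_field hX).differentiableAt (by norm_num)).hasFDerivAt

theorem continuousAt_charField (h : IsCharGraph c Ω u e) {X : ℂ} (hX : X ∈ Ω) :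
    ContinuousAt (charField u) X :=
  (h.contDiffAt_field hX).continuousAt

theorem continuousAt_fderiv_charField (h : IsCharGraph c Ω u e) {X : ℂ} (hX : X ∈ Ω) :
    ContinuousAt (fderiv ℝ (charField u)) X :=
  ((h.contDiffAt_field hX).fderiv_right (m := 0) (by norm_num)).continuousAt

theorem eventually_regular (h : IsCharGraph c Ω u e) {X : ℂ} (hX : X ∈ Ω)
    (hF : charField u X ≠ 0) : ∀ᶠ Y in 𝓝 X, Y ∈ Ω ∧ charField u Y ≠ 0 :=
  (h.isOpen.eventually_mem hX).and ((h.continuousAt_charField hX).eventually_ne hF)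

theorem charField_eq (h : IsCharGraph c Ω u e) {X : ℂ} (hX : X ∈ Ω)
    (hF : charField u X ≠ 0) : charField u X = dot (e X) (charField u X) • e X := by
  refine eq_dot_smul_of_cross_eq_zero (h.norm_field X hX hF) ?_
  have := h.parallel X hX hF
  simp only [cross] at this ⊢
  linarith

/-- The component of the derivative of `charField` normal to the characteristic direction only
involves the derivative of that direction. -/
theorem cross_fderiv_charField (h : IsCharGraph c Ω u e) {X : ℂ} (hX : X ∈ Ω)
    (hF : charField u X ≠ 0) (w : ℂ) :
    cross (e X) (fderiv ℝ (charField u) X w) =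
      dot (e X) (charField u X) * cross (e X) (fderiv ℝ e X w) := by
  have he := h.field_smooth X hX hF
  have hed : HasFDerivAt e (fderiv ℝ e X) X := (he.differentiableAt (by norm_num)).hasFDerivAt
  have hg : DifferentiableAt ℝ (fun Y => dot (e Y) (charField u Y)) X :=
    (ContDiffAt.comp (n := 1) X (contDiff_dot (n := 1)).contDiffAt
      ((he.of_le (by norm_num)).prodMk (h.contDiffAt_field hX))).differentiableAt (by norm_num)
  have h1 := hg.hasFDerivAt.smul hed
  have h2 : charField u =ᶠ[𝓝 X] fun Y => dot (e Y) (charField u Y) • e Y := by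
    filter_upwards [h.eventually_regular hX hF] with Y hY
    exact h.charField_eq hY.1 hY.2
  have h3 := (h1.congr_of_eventuallyEq h2).fderiv
  rw [h3]
  simp only [_root_.add_apply, _root_.smul_apply,
    ContinuousLinearMap.smulRight_apply, cross_add_right, cross_smul_right, cross_self]
  ring

/-- The curvature equation, multiplied by a power of the norm of `charField` so that it also holds
at singular points. -/
theorem abs_cross_charField_le (h : IsCharGraph c Ω u e) {X : ℂ} (hX : X ∈ Ω) :
    |cross (charField u X) (fderiv ℝ (charField u) X (charField u X))| ≤
      |c| * ‖charField u X‖ ^ 3 := by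
  by_cases hF : charField u X = 0
  · simp [hF, cross]
  have h1 := h.cross_fderiv_charField hX hF (e X)
  have h2 := h.charField_eq hX hF
  have h3 := h.norm_field X hX hF
  rw [h.curvature X hX hF] at h1
  have h4 : cross (e X) (c * Complex.I * e X) = c := by
    have := dot_self (e X)
    rw [h3] at this
    simp only [dot] at this
    simp [cross]
    linear_combination c * this
  rw [h4] at h1
  set g := dot (e X) (charField u X)
  have h5 : |g| = ‖charField u X‖ := by
    rw [h2, norm_smul, h3, mul_one, Real.norm_eq_abs]
  rw [← h5]
  have h6 : cross (charField u X) (fderiv ℝ (charField u) X (charField u X)) = c * g ^ 3 := by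
    conv_lhs => rw [h2]
    rw [map_smul, cross_smul_left, cross_smul_right, h1]
    ring
  rw [h6, abs_mul, abs_pow]

end IsCharGraph

/-! ### The linearization at a singular point -/

namespace IsCharGraph

variable {c : ℝ} {Ω : Set ℂ} {u : ℂ → ℝ} {e : ℂ → ℂ}

/-- Blowing up the curvature equation at a singular point: the integral curves of the linearized
direction field are straight lines. -/
theorem cross_linearization (h : IsCharGraph c Ω u e) {X₀ : ℂ} (hX : X₀ ∈ Ω)
    (hF : charField u X₀ = 0) (w : ℂ) :
    cross (fderiv ℝ (charField u) X₀ w)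
      (fderiv ℝ (charField u) X₀ (fderiv ℝ (charField u) X₀ w)) = 0 := by
  set M := fderiv ℝ (charField u) X₀ with hM
  have hd : HasDerivAt (fun t : ℝ => charField u (X₀ + t • w)) (M w) 0 := by
    have h1 : HasDerivAt (fun t : ℝ => X₀ + t • w) w 0 := by
      simpa using ((hasDerivAt_id (0 : ℝ)).smul_const w).const_add X₀
    have h2 : HasFDerivAt (charField u) M (X₀ + (0 : ℝ) • w) := by
      simpa using h.hasFDerivAt_charField hX
    exact h2.comp_hasDerivAt 0 h1
  have hslope : Tendsto (fun t : ℝ => t⁻¹ • charField u (X₀ + t • w)) (𝓝[≠] 0) (𝓝 (M w)) := by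
    have := hd.tendsto_slope_zero
    simpa [hF] using this
  have hline : Tendsto (fun t : ℝ => X₀ + t • w) (𝓝[≠] 0) (𝓝 X₀) := by
    have : ContinuousAt (fun t : ℝ => X₀ + t • w) 0 := by fun_prop
    have := this.tendsto.mono_left (nhdsWithin_le_nhds (s := {0}ᶜ))
    simpa using this
  have hD : Tendsto (fun t : ℝ => fderiv ℝ (charField u) (X₀ + t • w)) (𝓝[≠] 0) (𝓝 M) :=
    (h.continuousAt_fderiv_charField hX).tendsto.comp hline
  have hF0 : Tendsto (fun t : ℝ => charField u (X₀ + t • w)) (𝓝[≠] 0) (𝓝 0) := by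
    have := (h.continuousAt_charField hX).tendsto.comp hline
    rwa [hF] at this
  have hcr : Tendsto (fun t : ℝ => cross (t⁻¹ • charField u (X₀ + t • w))
      (fderiv ℝ (charField u) (X₀ + t • w) (t⁻¹ • charField u (X₀ + t • w)))) (𝓝[≠] 0)
      (𝓝 (cross (M w) (M (M w)))) := by
    have hc : Continuous (fun p : ℂ × ℂ => cross p.1 p.2) := (contDiff_cross (n := 0)).continuous
    exact (hc.tendsto (M w, M (M w))).comp
      (hslope.prodMk_nhds ((isBoundedBilinearMap_apply.continuous.tendsto (M, M w)).comp
        (hD.prodMk_nhds hslope)))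
  have hb : Tendsto (fun t : ℝ => |c| * ‖charField u (X₀ + t • w)‖ *
      ‖t⁻¹ • charField u (X₀ + t • w)‖ ^ 2) (𝓝[≠] 0) (𝓝 (|c| * ‖(0 : ℂ)‖ * ‖M w‖ ^ 2)) :=
    ((hF0.norm).const_mul _).mul (hslope.norm.pow 2)
  simp only [norm_zero, mul_zero, zero_mul] at hb
  have hz : Tendsto (fun t : ℝ => cross (t⁻¹ • charField u (X₀ + t • w))
      (fderiv ℝ (charField u) (X₀ + t • w) (t⁻¹ • charField u (X₀ + t • w)))) (𝓝[≠] 0)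
      (𝓝 0) := by
    refine squeeze_zero_norm' ?_ hb
    filter_upwards [hline.eventually (h.isOpen.eventually_mem hX)] with t ht
    rw [map_smul, cross_smul_left, cross_smul_right, Real.norm_eq_abs, abs_mul, abs_mul, norm_smul,
      Real.norm_eq_abs]
    have := h.abs_cross_charField_le ht
    calc _ ≤ |t⁻¹| * (|t⁻¹| * (|c| * ‖charField u (X₀ + t • w)‖ ^ 3)) := by gcongr
      _ = _ := by ring
  exact tendsto_nhds_unique hcr hz

/-- The linearization of `charField` at a singular point is either `-1`, or of rank one with an
eigenvector of eigenvalue `-2` which spans its range: it has trace `-2`, and the blown up curvature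
equation excludes all other matrices of this trace. -/
theorem linearization_dichotomy (h : IsCharGraph c Ω u e) {X₀ : ℂ} (hX : X₀ ∈ Ω)
    (hF : charField u X₀ = 0) :
    (∀ w, fderiv ℝ (charField u) X₀ w = -w) ∨
    ∃ v : ℂ, ‖v‖ = 1 ∧ fderiv ℝ (charField u) X₀ v = (-2 : ℝ) • v ∧
      ∀ w, cross v (fderiv ℝ (charField u) X₀ w) = 0 := by
  have hcross := h.cross_linearization hX hF
  have htr := trace_fderiv_charField (h.c2 X₀ hX)
  set M := fderiv ℝ (charField u) X₀ with hM
  obtain ⟨p, hp⟩ : ∃ p, (M 1).re = p := ⟨_, rfl⟩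
  obtain ⟨q, hq⟩ : ∃ q, (M 1).im = q := ⟨_, rfl⟩
  obtain ⟨r, hr⟩ : ∃ r, (M Complex.I).re = r := ⟨_, rfl⟩
  obtain ⟨s, hs⟩ : ∃ s, (M Complex.I).im = s := ⟨_, rfl⟩
  have hMw : ∀ w, M w = ⟨w.re * p + w.im * r, w.re * q + w.im * s⟩ := by
    intro w
    have hw : w = w.re • (1 : ℂ) + w.im • Complex.I := by apply Complex.ext <;> simp
    conv_lhs => rw [hw]
    rw [map_add, map_smul, map_smul]
    apply Complex.ext <;> simp [hp, hq, hr, hs]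
  rw [hp, hs] at htr
  by_cases hdet : p * s - q * r = 0
  · right
    obtain ⟨w, hw⟩ : ∃ w, M w ≠ 0 := by
      by_contra! hall
      have h1 := hall 1
      have h2 := hall Complex.I
      rw [h1] at hp
      rw [h2] at hs
      simp at hp hs
      linarith
    have hn : ‖M w‖ ≠ 0 := norm_ne_zero_iff.2 hw
    refine ⟨(‖M w‖⁻¹ : ℝ) • M w, ?_, ?_, fun w' => ?_⟩
    · rw [norm_smul, norm_inv, norm_norm, inv_mul_cancel₀ hn]
    · rw [map_smul, smul_comm]
      congr 1
      rw [hMw (M w), hMw w]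
      have hs' : s = -2 - p := by linarith
      subst hs'
      apply Complex.ext
      · simp; linear_combination (-w.re) * hdet
      · simp; linear_combination (-w.im) * hdet
    · rw [cross_smul_left, hMw w, hMw w']
      simp only [cross]
      linear_combination ‖(⟨w.re * p + w.im * r, w.re * q + w.im * s⟩ : ℂ)‖⁻¹ *
        (w.re * w'.im - w.im * w'.re) * hdet
  · left
    have hsurj : ∀ y : ℂ, cross y (M y) = 0 := by
      intro y
      have : M ⟨(y.re * s - y.im * r) / (p * s - q * r), (y.im * p - y.re * q) / (p * s - q * r)⟩
          = y := by
        rw [hMw]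
        apply Complex.ext
        · simp only
          rw [div_mul_eq_mul_div, div_mul_eq_mul_div, ← add_div, div_eq_iff hdet]; ring
        · simp only
          rw [div_mul_eq_mul_div, div_mul_eq_mul_div, ← add_div, div_eq_iff hdet]; ring
      rw [← this]
      exact hcross _
    have h1 := hsurj 1
    have h2 := hsurj Complex.I
    have h3 := hsurj (1 + Complex.I)
    rw [hMw] at h1 h2 h3
    simp [cross] at h1 h2 h3
    have hps : p = -1 := by linarith
    have hss : s = -1 := by linarith
    intro w
    rw [hMw]
    apply Complex.ext
    · simp [h2, hps]
    · simp [h1, hss]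

/-- At a rank one singular point, the zero set of the component of `charField` along the range `v` of
the linearization consists of singular points. Otherwise let `X₁` be a regular point of it, at which
the characteristic direction is thus normal to `v`, and let `d` be the norm of `charField` at `X₁`:
then at the two points `X₁` and `X₁ + d v` the directions turn too fast for the curvature equation
to hold at both. -/
theorem exists_ball_charField_eq_zero (h : IsCharGraph c Ω u e) {X₀ : ℂ} (hX : X₀ ∈ Ω)
    (hF : charField u X₀ = 0) {v : ℂ} (hv : ‖v‖ = 1)
    (hv2 : fderiv ℝ (charField u) X₀ v = (-2 : ℝ) • v)
    (hrange : ∀ w, cross v (fderiv ℝ (charField u) X₀ w) = 0) :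
    ∃ ρ > 0, ∀ X ∈ Metric.ball X₀ ρ, dot v (charField u X) = 0 → charField u X = 0 := by
  set M := fderiv ℝ (charField u) X₀ with hM
  set η : ℝ := 1 / (100 * (1 + ‖M‖)) with hη
  have hMn : 0 ≤ ‖M‖ := norm_nonneg M
  have hη0 : 0 < η := by positivity
  have hηK : η * ‖M‖ ≤ 1 / 100 := by
    rw [hη, div_mul_eq_mul_div, div_le_div_iff₀ (by positivity) (by norm_num)]
    linarith
  have hη1 : η ≤ 1 / 100 := by
    rw [hη]
    apply one_div_le_one_div_of_le (by norm_num)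
    linarith
  obtain ⟨ρ₁, hρ₁, hball⟩ : ∃ ρ₁ > 0, ∀ X ∈ Metric.ball X₀ ρ₁,
      X ∈ Ω ∧ ‖fderiv ℝ (charField u) X - M‖ ≤ η := by
    have h1 := h.isOpen.eventually_mem hX
    have h2 : ∀ᶠ X in 𝓝 X₀, ‖fderiv ℝ (charField u) X - M‖ < η := by
      have := (h.continuousAt_fderiv_charField hX).eventually (Metric.ball_mem_nhds _ hη0)
      filter_upwards [this] with X hX
      simpa [dist_eq_norm] using hX
    obtain ⟨ρ₁, hρ₁, hb⟩ := Metric.eventually_nhds_iff_ball.1 (h1.and h2)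
    exact ⟨ρ₁, hρ₁, fun X hX => ⟨(hb X hX).1, (hb X hX).2.le⟩⟩
  obtain ⟨ρ₂, hρ₂, hball₂⟩ : ∃ ρ₂ > 0, ∀ X ∈ Metric.ball X₀ ρ₂,
      ‖charField u X‖ < min (ρ₁ / 2) (1 / (1000 * (1 + |c|))) := by
    have := (h.continuousAt_charField hX).norm
    have h0 : ‖charField u X₀‖ < min (ρ₁ / 2) (1 / (1000 * (1 + |c|))) := by
      rw [hF, norm_zero]; positivity
    exact Metric.eventually_nhds_iff_ball.1 (this.eventually_lt_const h0)
  refine ⟨min ρ₂ (ρ₁ / 2), by positivity, fun X hXb hdot => ?_⟩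
  by_contra hne
  have hXρ₂ : X ∈ Metric.ball X₀ ρ₂ := Metric.ball_subset_ball (min_le_left _ _) hXb
  have hXρ₁ : dist X X₀ < ρ₁ / 2 := lt_of_lt_of_le hXb (min_le_right _ _)
  have hXin : X ∈ Metric.ball X₀ ρ₁ := by rw [Metric.mem_ball]; linarith
  set F₁ := charField u X with hF₁
  set d := ‖F₁‖ with hd
  have hd0 : 0 < d := norm_pos_iff.2 hne
  have hdρ : d < ρ₁ / 2 := (hball₂ X hXρ₂).trans_le (min_le_left _ _)
  have hdc : |c| * d ≤ 1 / 1000 := by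
    have h1 : d < 1 / (1000 * (1 + |c|)) := (hball₂ X hXρ₂).trans_le (min_le_right _ _)
    rw [lt_div_iff₀ (by positivity)] at h1
    nlinarith [abs_nonneg c]
  have hYin : X + d • v ∈ Metric.ball X₀ ρ₁ := by
    rw [Metric.mem_ball, dist_eq_norm] at *
    calc ‖X + d • v - X₀‖ = ‖(X - X₀) + d • v‖ := by ring_nf
      _ ≤ ‖X - X₀‖ + ‖d • v‖ := norm_add_le _ _
      _ < _ := by rw [norm_smul, hv, mul_one, Real.norm_eq_abs, abs_of_pos hd0]; linarith
  set F₂ := charField u (X + d • v) with hF₂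
  -- first order expansion between the two points
  set E := F₂ - F₁ - M (d • v) with hE
  have hEn : ‖E‖ ≤ η * d := by
    have := (convex_ball X₀ ρ₁).norm_image_sub_le_of_norm_hasFDerivWithin_le' (f := charField u)
      (f' := fun Y => fderiv ℝ (charField u) Y) (φ := M) (C := η)
      (fun Y hY => (h.hasFDerivAt_charField (hball Y hY).1).hasFDerivWithinAt)
      (fun Y hY => (hball Y hY).2) hXin hYin
    rwa [add_sub_cancel_left, norm_smul, hv, mul_one, Real.norm_eq_abs, abs_of_pos hd0] at this
  have hF₂eq : F₂ = F₁ + (-2 * d) • v + E := by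
    have : M (d • v) = (-2 * d) • v := by rw [map_smul, hv2, smul_smul]; ring_nf
    rw [hE, this]; abel
  have hF₂n : ‖F₂‖ ≤ 4 * d := by
    rw [hF₂eq]
    calc _ ≤ ‖F₁‖ + ‖(-2 * d) • v‖ + ‖E‖ := norm_add₃_le
      _ ≤ d + 2 * d + η * d := by
        gcongr
        rw [norm_smul, hv, Real.norm_eq_abs, abs_mul, abs_of_pos hd0]; norm_num
      _ ≤ _ := by nlinarith
  -- the curvature equation, with the derivative replaced by `M`
  have hQ : ∀ Y ∈ Metric.ball X₀ ρ₁, |cross (charField u Y) (M (charField u Y))| ≤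
      |c| * ‖charField u Y‖ ^ 3 + η * ‖charField u Y‖ ^ 2 := by
    intro Y hY
    set G := charField u Y
    have h1 := h.abs_cross_charField_le (hball Y hY).1
    have h2 : cross G (M G) = cross G (fderiv ℝ (charField u) Y G) -
        cross G ((fderiv ℝ (charField u) Y - M) G) := by
      rw [_root_.sub_apply]
      simp [cross]; ring
    have h3 : |cross G ((fderiv ℝ (charField u) Y - M) G)| ≤ η * ‖G‖ ^ 2 := by
      calc _ ≤ ‖G‖ * ‖(fderiv ℝ (charField u) Y - M) G‖ := abs_cross_le _ _
        _ ≤ ‖G‖ * (η * ‖G‖) := by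
          gcongr
          exact ((fderiv ℝ (charField u) Y - M).le_opNorm G).trans
            (by gcongr; exact (hball Y hY).2)
        _ = _ := by ring
    rw [h2]
    exact (abs_sub _ _).trans (add_le_add h1 h3)
  -- all vectors in the range of `M` are multiples of `v`
  have hMv : ∀ w, M w = dot v (M w) • v := fun w => eq_dot_smul_of_cross_eq_zero hv (hrange w)
  set κ := cross v F₁ with hκ
  have hF₁eq : F₁ = κ • (Complex.I * v) := by
    have := eq_dot_smul_add_cross_smul hv F₁
    rwa [hdot, zero_smul, zero_add] at this
  have hκd : |κ| = d := by
    rw [hd, hF₁eq, norm_smul, norm_mul, hv]; simp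
  have hvv : v.re * v.re + v.im * v.im = 1 := by
    have := dot_self v
    rw [hv] at this
    simpa [dot] using this
  have hIv : cross (Complex.I * v) v = -1 := by
    simp [cross]; linarith
  set Lc := dot v (M (Complex.I * v)) with hL
  have hMF₁ : M F₁ = (κ * Lc) • v := by
    rw [hF₁eq, map_smul, hMv, smul_smul]
  have hLsmall : |Lc| ≤ 1 / 50 := by
    have h1 := hQ X hXin
    rw [← hF₁, hMF₁, ← hd] at h1
    have h2 : cross F₁ ((κ * Lc) • v) = -(κ ^ 2 * Lc) := by
      rw [hF₁eq, cross_smul_left, cross_smul_right, hIv]; ring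
    rw [h2, abs_neg, abs_mul, abs_pow, hκd] at h1
    have h3 : d ^ 2 * |Lc| ≤ d ^ 2 * (|c| * d + η) := by nlinarith
    have h4 := le_of_mul_le_mul_left h3 (by positivity)
    linarith
  have h2 := hQ _ hYin
  rw [← hF₂] at h2
  have hME : ‖M E‖ ≤ d / 100 := by
    calc _ ≤ ‖M‖ * ‖E‖ := M.le_opNorm _
      _ ≤ ‖M‖ * (η * d) := by gcongr
      _ = (η * ‖M‖) * d := by ring
      _ ≤ 1 / 100 * d := by gcongr
      _ = _ := by ring
  have hMF₂ : M F₂ = (κ * Lc + 4 * d) • v + M E := by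
    rw [hF₂eq, map_add, map_add, hMF₁, map_smul, hv2, smul_smul, add_smul]
    congr 3; ring
  have hcr : cross F₂ (M F₂) = (κ * Lc + 4 * d) * (-κ + cross E v) + cross F₂ (M E) := by
    rw [hMF₂, cross_add_right, cross_smul_right]
    congr 2
    rw [hF₂eq, cross_add_left, cross_add_left, cross_smul_left, cross_self, hF₁eq, cross_smul_left,
      hIv]
    ring
  have hb1 : |cross E v| ≤ d / 100 := by
    have := abs_cross_le E v
    rw [hv, mul_one] at this
    nlinarith
  have hb2 : |cross F₂ (M E)| ≤ 4 * d * (d / 100) :=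
    (abs_cross_le _ _).trans (by gcongr)
  have hb3 : |κ * Lc| ≤ d / 50 := by
    rw [abs_mul, hκd]; nlinarith
  have hb4 : 3 * d * (9 / 10 * d) ≤ |(κ * Lc + 4 * d) * (-κ + cross E v)| := by
    rw [abs_mul]
    have i1 : 3 * d ≤ |κ * Lc + 4 * d| := by
      have := (abs_le.1 hb3).1
      rw [abs_of_pos (by linarith)]; linarith
    have i2 : 9 / 10 * d ≤ |-κ + cross E v| := by
      have := abs_sub_abs_le_abs_sub (-κ) (-cross E v)
      rw [abs_neg, abs_neg, hκd, sub_neg_eq_add] at this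
      linarith
    gcongr
  have hb5 : |(κ * Lc + 4 * d) * (-κ + cross E v)| ≤ |cross F₂ (M F₂)| + |cross F₂ (M E)| := by
    have : (κ * Lc + 4 * d) * (-κ + cross E v) = cross F₂ (M F₂) - cross F₂ (M E) := by
      rw [hcr]; ring
    rw [this]
    exact abs_sub _ _
  have hb6 : |c| * ‖F₂‖ ^ 3 + η * ‖F₂‖ ^ 2 ≤ |c| * (4 * d) ^ 3 + 1 / 100 * (4 * d) ^ 2 := by
    gcongr
  have hb7 : |c| * (4 * d) ^ 3 ≤ 64 / 1000 * d ^ 2 := by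
    have : |c| * (4 * d) ^ 3 = 64 * d ^ 2 * (|c| * d) := by ring
    rw [this]
    calc _ ≤ 64 * d ^ 2 * (1 / 1000) := by gcongr
      _ = _ := by ring
  have hd2 : 0 < d ^ 2 := by positivity
  linarith

end IsCharGraph

/-! ### Characteristic curves are circles -/

theorem hasDerivAt_add_mul_arc {c : ℝ} (hc : c ≠ 0) (X w : ℂ) (s : ℝ) :
    HasDerivAt (fun s => X + w * arc c s) (w * rot c s) s :=
  ((hasDerivAt_arc hc s).const_mul w).const_add X

namespace IsCharGraph

variable {c : ℝ} {Ω : Set ℂ} {u : ℂ → ℝ} {e : ℂ → ℂ}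

/-- A circle of curvature `c` which starts in the characteristic direction is a characteristic curve
as long as it meets regular points only: the difference of the two directions along the circle
satisfies a linear differential inequality. -/
theorem field_eq_rot (h : IsCharGraph c Ω u e) (hc : c ≠ 0) {X : ℂ} {σ : ℝ}
    (hreg : ∀ r ∈ Icc (0 : ℝ) 1, X + e X * arc c (σ * r) ∈ Ω ∧
      charField u (X + e X * arc c (σ * r)) ≠ 0) :
    e (X + e X * arc c σ) = e X * rot c σ := by
  set C : ℝ → ℂ := fun r => X + e X * arc c (σ * r) with hC
  set E : ℝ → ℂ := fun r => e X * rot c (σ * r) with hE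
  have hσ : ∀ r : ℝ, HasDerivAt (fun r : ℝ => σ * r) σ r := fun r => by
    simpa using (hasDerivAt_id r).const_mul σ
  have hCd : ∀ r, HasDerivAt C (σ • E r) r := fun r =>
    (hasDerivAt_add_mul_arc hc X (e X) (σ * r)).scomp r (hσ r)
  have hEd : ∀ r, HasDerivAt E (σ • (c * Complex.I * E r)) r := by
    intro r
    have := ((hasDerivAt_rot c (σ * r)).const_mul (e X)).scomp r (hσ r)
    refine this.congr_deriv ?_
    simp only [hE]; ring_nf
  have hsm : ∀ r ∈ Icc (0 : ℝ) 1, ContDiffAt ℝ ∞ e (C r) := fun r hr =>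
    h.field_smooth _ (hreg r hr).1 (hreg r hr).2
  have hed : ∀ r ∈ Icc (0 : ℝ) 1, HasDerivAt (fun r => e (C r)) (fderiv ℝ e (C r) (σ • E r)) r :=
    fun r hr => ((hsm r hr).differentiableAt (by norm_num)).hasFDerivAt.comp_hasDerivAt r (hCd r)
  obtain ⟨K, hK⟩ : ∃ K, ∀ r ∈ Icc (0 : ℝ) 1, ‖fderiv ℝ e (C r)‖ ≤ K := by
    refine isCompact_Icc.exists_bound_of_continuousOn fun r hr => ?_
    have h1 : ContinuousAt (fderiv ℝ e) (C r) :=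
      ((hsm r hr).fderiv_right (m := 0) (by norm_num)).continuousAt
    exact (h1.comp (hCd r).continuousAt).continuousWithinAt
  have hψ : ∀ r ∈ Icc (0 : ℝ) 1, HasDerivAt (fun r => e (C r) - E r)
      (σ • (c * Complex.I * (e (C r) - E r) - fderiv ℝ e (C r) (e (C r) - E r))) r := by
    intro r hr
    refine ((hed r hr).sub (hEd r)).congr_deriv ?_
    have h1 := h.curvature _ (hreg r hr).1 (hreg r hr).2
    rw [map_sub, h1, map_smul, ← smul_sub]
    congr 1; ring
  have hG := norm_le_gronwallBound_of_norm_deriv_right_le (f := fun r => e (C r) - E r)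
    (f' := fun r => σ • (c * Complex.I * (e (C r) - E r) - fderiv ℝ e (C r) (e (C r) - E r)))
    (δ := 0) (ε := 0) (K := |σ| * (|c| + K)) (a := 0) (b := 1)
    (fun r hr => (hψ r hr).continuousAt.continuousWithinAt)
    (fun r hr => (hψ r (Ico_subset_Icc_self hr)).hasDerivWithinAt)
    (by simp [hC, hE, arc_zero, rot_zero])
    (fun r hr => by
      have hr' := Ico_subset_Icc_self hr
      rw [norm_smul, Real.norm_eq_abs, add_zero, mul_assoc |σ|]
      refine mul_le_mul_of_nonneg_left ?_ (abs_nonneg σ)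
      refine (norm_sub_le _ _).trans ?_
      rw [add_mul]
      refine add_le_add ?_ ?_
      · rw [norm_mul, norm_mul]; simp
      · exact ((fderiv ℝ e (C r)).le_opNorm _).trans (by gcongr; exact hK r hr'))
    1 (by simp)
  rw [gronwallBound_ε0_δ0] at hG
  have := sub_eq_zero.1 (norm_le_zero_iff.1 hG)
  simpa [hC, hE] using this

/-- The graph over a characteristic circle is horizontal, which determines its height. -/
theorem height_eq (h : IsCharGraph c Ω u e) (hc : c ≠ 0) {X w : ℂ} (hw : ‖w‖ = 1) {σ : ℝ}
    (hpar : ∀ r ∈ Icc (0 : ℝ) 1, X + w * arc c (σ * r) ∈ Ω ∧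
      cross (charField u (X + w * arc c (σ * r))) (w * rot c (σ * r)) = 0) :
    u (X + w * arc c σ) =
      u X - cross X (w * arc c σ) - σ / c + Real.sin (c * σ) / c ^ 2 := by
  have hσ : ∀ r : ℝ, HasDerivAt (fun r : ℝ => σ * r) σ r := fun r => by
    simpa using (hasDerivAt_id r).const_mul σ
  have hd : ∀ r ∈ Icc (0 : ℝ) 1, HasDerivAt (fun r => u (X + w * arc c (σ * r)) -
      (u X - cross X (w * arc c (σ * r)) - σ * r / c + Real.sin (c * (σ * r)) / c ^ 2)) 0 r := by
    intro r hr
    have hu : HasFDerivAt u (fderiv ℝ u (X + w * arc c (σ * r))) (X + w * arc c (σ * r)) :=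
      ((h.c2 _ (hpar r hr).1).differentiableAt (by norm_num)).hasFDerivAt
    have h1 : HasDerivAt (fun s => u (X + w * arc c s) -
      (u X - cross X (w * arc c s) - s / c + Real.sin (c * s) / c ^ 2)) 0 (σ * r) := by
      have a1 := hu.comp_hasDerivAt (σ * r) (hasDerivAt_add_mul_arc hc X w (σ * r))
      have a2 := hasDerivAt_cross (hasDerivAt_const (σ * r) X)
        ((hasDerivAt_arc hc (σ * r)).const_mul w)
      have a3 := (hasDerivAt_id (σ * r)).div_const c
      have a4 : HasDerivAt (fun s : ℝ => c * s) c (σ * r) := by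
        simpa using (hasDerivAt_id (σ * r)).const_mul c
      have a5 := a4.sin.div_const (c ^ 2)
      refine (a1.sub (((a2.const_sub (u X)).sub a3).add a5)).congr_deriv ?_
      rw [fderiv_eq_cross, (hpar r hr).2, cross_add_left, cross_mul_right_unit hw, cross_arc_rot]
      have : cross 0 (w * arc c (σ * r)) = 0 := by simp [cross]
      rw [this]
      field_simp; ring
    exact (h1.scomp r (hσ r)).congr_deriv (by simp)
  have := constant_of_has_deriv_right_zero
    (fun r hr => (hd r hr).continuousAt.continuousWithinAt)
    (fun r hr => (hd r (Ico_subset_Icc_self hr)).hasDerivWithinAt) 1 (by simp)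
  simp [arc_zero] at this
  have h0 : cross X 0 = 0 := by simp [cross]
  rw [h0] at this
  linarith

end IsCharGraph

theorem norm_mul_arc_sub_le {c : ℝ} (hc : c ≠ 0) {ε : ℝ} (hε : ε = 1 ∨ ε = -1) {w ν : ℂ}
    (hw : ‖w‖ = 1) {r : ℝ} (hr : 0 ≤ r) :
    ‖w * arc c (ε * r) - r • ν‖ ≤ (|c| * r + ‖w - ε * ν‖) * r := by
  have hε2 : (ε : ℂ) * ε = 1 := by rcases hε with rfl | rfl <;> simp
  have hεa : |ε * r| = r := by rcases hε with rfl | rfl <;> simp [abs_of_nonneg hr]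
  have h1 : w * arc c (ε * r) - r • ν =
      w * (arc c (ε * r) - ((ε * r : ℝ) : ℂ)) + ((ε * r : ℝ) : ℂ) * (w - ε * ν) := by
    simp only [Complex.real_smul, Complex.ofReal_mul]
    linear_combination (r * ν) * hε2
  have h2 := norm_arc_sub_le hc (ε * r)
  rw [hεa] at h2
  rw [h1]
  refine (norm_add_le _ _).trans ?_
  rw [norm_mul, norm_mul, hw, one_mul, Complex.norm_real, Real.norm_eq_abs, hεa]
  nlinarith

namespace IsCharGraph

variable {c : ℝ} {Ω : Set ℂ} {u : ℂ → ℝ} {e : ℂ → ℂ}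

theorem tendsto_slope_charField (h : IsCharGraph c Ω u e) {X₀ : ℂ} (hX : X₀ ∈ Ω)
    (hF : charField u X₀ = 0) (w : ℂ) :
    Tendsto (fun t : ℝ => t⁻¹ • charField u (X₀ + t • w)) (𝓝[>] 0)
      (𝓝 (fderiv ℝ (charField u) X₀ w)) := by
  have h1 : HasDerivAt (fun t : ℝ => X₀ + t • w) w 0 := by
    simpa using ((hasDerivAt_id (0 : ℝ)).smul_const w).const_add X₀
  have h2 : HasFDerivAt (charField u) (fderiv ℝ (charField u) X₀) (X₀ + (0 : ℝ) • w) := by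
    simpa using h.hasFDerivAt_charField hX
  have := (h2.comp_hasDerivAt 0 h1).tendsto_slope_zero_right
  simpa [hF] using this

/-- The characteristic direction on a ray out of a singular point, along an eigenvector of the
linearization. -/
theorem tendsto_field_ray (h : IsCharGraph c Ω u e) {X₀ : ℂ} (hX : X₀ ∈ Ω)
    (hF : charField u X₀ = 0) {ν : ℂ} (hν : ‖ν‖ = 1) {μ : ℝ} (hμ : 0 < μ)
    (hM : fderiv ℝ (charField u) X₀ ν = (-μ) • ν) {ε : ℝ} (hε : ε = 1 ∨ ε = -1)
    (hsign : ∀ᶠ t : ℝ in 𝓝[>] 0, X₀ + t • ν ∈ Ω ∧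
      ε * dot (e (X₀ + t • ν)) (charField u (X₀ + t • ν)) < 0) :
    Tendsto (fun t : ℝ => e (X₀ + t • ν)) (𝓝[>] 0) (𝓝 (ε * ν)) := by
  have hsl := h.tendsto_slope_charField hX hF ν
  rw [hM] at hsl
  have hn : ‖(-μ) • ν‖ = μ := by
    rw [norm_smul, hν, Real.norm_eq_abs, abs_neg, abs_of_pos hμ, mul_one]
  have hlim : Tendsto (fun t : ℝ => (-ε) • (‖t⁻¹ • charField u (X₀ + t • ν)‖⁻¹ •
      t⁻¹ • charField u (X₀ + t • ν))) (𝓝[>] 0) (𝓝 ((-ε) • (μ⁻¹ • (-μ) • ν))) := by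
    have := (hsl.norm.inv₀ (by rw [hn]; exact hμ.ne')).smul hsl
    rw [hn] at this
    exact this.const_smul _
  have hval : (-ε) • (μ⁻¹ • (-μ) • ν) = ε * ν := by
    rw [smul_smul, smul_smul, Complex.real_smul]
    congr 2
    field_simp
  rw [hval] at hlim
  refine hlim.congr' ?_
  filter_upwards [hsign, self_mem_nhdsWithin] with t ht ht0
  have ht0 : 0 < t := ht0
  set F := charField u (X₀ + t • ν) with hFdef
  have hne : F ≠ 0 := by
    intro h0
    rw [h0] at ht
    simp [dot] at ht
  have h1 := h.charField_eq ht.1 hne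
  have h2 := h.norm_field _ ht.1 hne
  rw [← hFdef] at h1
  set g := dot (e (X₀ + t • ν)) F
  have hFn : ‖F‖ = -ε * g := by
    rw [h1, norm_smul, h2, mul_one, Real.norm_eq_abs]
    rcases hε with rfl | rfl
    · rw [abs_of_neg (by linarith [ht.2])]; ring
    · rw [abs_of_pos (by linarith [ht.2])]; ring
  have hg : g ≠ 0 := by
    rintro h0
    rw [h0] at ht
    simp at ht
  have hε0 : ε ≠ 0 := by rcases hε with rfl | rfl <;> norm_num
  rw [norm_smul, hFn, norm_inv, Real.norm_eq_abs, abs_of_pos ht0]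
  nth_rewrite 1 [h1]
  simp only [smul_smul]
  convert one_smul ℝ (e (X₀ + t • ν)) using 2
  field_simp

/-- The circles of curvature `c` which leave a singular point along an eigenvector `ν` of the
linearization are characteristic curves, provided that a cone about `ν` is free of singular points.
They are limits of the characteristic curves which start on the ray in direction `ν`. -/
theorem field_eq_rot_of_singular (h : IsCharGraph c Ω u e) (hc : c ≠ 0) {X₀ : ℂ} (hX : X₀ ∈ Ω)
    (hF : charField u X₀ = 0) {ν : ℂ} (hν : ‖ν‖ = 1) {μ : ℝ} (hμ : 0 < μ)
    (hM : fderiv ℝ (charField u) X₀ ν = (-μ) • ν) {ε : ℝ} (hε : ε = 1 ∨ ε = -1)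
    (hsign : ∀ᶠ t : ℝ in 𝓝[>] 0, X₀ + t • ν ∈ Ω ∧
      ε * dot (e (X₀ + t • ν)) (charField u (X₀ + t • ν)) < 0)
    {η ρ : ℝ} (hcone : ∀ r, 0 < r → r < ρ → ∀ X : ℂ, ‖X - (X₀ + r • ν)‖ ≤ η * r →
      X ∈ Ω ∧ charField u X ≠ 0)
    {s : ℝ} (hs : 0 < s) (hsρ : s < ρ) (hsη : |c| * s < η) :
    (X₀ + ε * ν * arc c (ε * s) ∈ Ω ∧ charField u (X₀ + ε * ν * arc c (ε * s)) ≠ 0) ∧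
    e (X₀ + ε * ν * arc c (ε * s)) = ε * ν * rot c (ε * s) := by
  have hεn : ‖(ε : ℂ) * ν‖ = 1 := by
    rw [norm_mul, hν, Complex.norm_real]
    rcases hε with rfl | rfl <;> simp
  have hreg : X₀ + ε * ν * arc c (ε * s) ∈ Ω ∧
      charField u (X₀ + ε * ν * arc c (ε * s)) ≠ 0 := by
    refine hcone s hs hsρ _ ?_
    have := norm_mul_arc_sub_le (ν := ν) hc hε hεn hs.le
    rw [sub_self, norm_zero, add_zero] at this
    rw [add_sub_add_left_eq_sub]
    exact this.trans (by gcongr)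
  refine ⟨hreg, ?_⟩
  have hlim := h.tendsto_field_ray hX hF hν hμ hM hε hsign
  have hray : Tendsto (fun t : ℝ => X₀ + t • ν) (𝓝[>] 0) (𝓝 X₀) := by
    have : ContinuousAt (fun t : ℝ => X₀ + t • ν) 0 := by fun_prop
    have := this.tendsto.mono_left (nhdsWithin_le_nhds (s := Ioi 0))
    simpa using this
  have hL : Tendsto (fun t : ℝ => e (X₀ + t • ν + e (X₀ + t • ν) * arc c (ε * s))) (𝓝[>] 0)
      (𝓝 (e (X₀ + ε * ν * arc c (ε * s)))) :=
    (h.field_smooth _ hreg.1 hreg.2).continuousAt.tendsto.comp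
      (hray.add (hlim.mul_const _))
  have hR : Tendsto (fun t : ℝ => e (X₀ + t • ν) * rot c (ε * s)) (𝓝[>] 0)
      (𝓝 (ε * ν * rot c (ε * s))) := hlim.mul_const _
  refine tendsto_nhds_unique (hL.congr' ?_) hR
  have hclose : ∀ᶠ t : ℝ in 𝓝[>] 0, ‖e (X₀ + t • ν) - ε * ν‖ < η - |c| * s := by
    have := hlim.eventually (Metric.ball_mem_nhds _ (sub_pos.2 hsη))
    filter_upwards [this] with t ht
    simpa [dist_eq_norm] using ht
  have hsmall : ∀ᶠ t : ℝ in 𝓝[>] 0, t < ρ - s :=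
    nhdsWithin_le_nhds (eventually_lt_nhds (by linarith))
  filter_upwards [hsign, hclose, hsmall, self_mem_nhdsWithin] with t ht1 ht2 ht3 ht0
  have ht0 : 0 < t := ht0
  have hne : charField u (X₀ + t • ν) ≠ 0 := by
    intro h0
    rw [h0] at ht1
    simp [dot] at ht1
  refine h.field_eq_rot hc fun r hr => ?_
  have hsr : 0 ≤ s * r := mul_nonneg hs.le hr.1
  have hsr' : s * r ≤ s := mul_le_of_le_one_right hs.le hr.2
  refine hcone (t + s * r) (by positivity) (by linarith) _ ?_
  have h1 := norm_mul_arc_sub_le (ν := ν) hc hε (h.norm_field _ ht1.1 hne) hsr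
  have h2 : X₀ + t • ν + e (X₀ + t • ν) * arc c (ε * s * r) - (X₀ + (t + s * r) • ν) =
      e (X₀ + t • ν) * arc c (ε * (s * r)) - (s * r) • ν := by
    rw [add_smul, mul_assoc ε]; abel
  rw [h2]
  refine h1.trans ?_
  have h3 : |c| * (s * r) ≤ |c| * s := by gcongr
  have h4 : 0 ≤ η := le_trans (by positivity) hsη.le
  calc _ ≤ η * (s * r) := by gcongr; linarith
    _ ≤ _ := by gcongr; linarith

end IsCharGraph

/-! ### Variation of characteristic curves -/

namespace IsCharGraph

variable {c : ℝ} {Ω : Set ℂ} {u : ℂ → ℝ} {e : ℂ → ℂ}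

/-- The height along a characteristic circle of which at most the endpoint is singular. -/
theorem height_eq_of_regular (h : IsCharGraph c Ω u e) (hc : c ≠ 0) {X : ℂ} {σ : ℝ}
    (hreg : ∀ r ∈ Ico (0 : ℝ) 1, X + e X * arc c (σ * r) ∈ Ω ∧
      charField u (X + e X * arc c (σ * r)) ≠ 0)
    (hend : X + e X * arc c σ ∈ Ω) :
    u (X + e X * arc c σ) =
      u X - cross X (e X * arc c σ) - σ / c + Real.sin (c * σ) / c ^ 2 := by
  have hX : X ∈ Ω ∧ charField u X ≠ 0 := by
    have := hreg 0 (by simp)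
    simpa [arc_zero] using this
  have hleaf : ∀ r ∈ Icc (0 : ℝ) 1, charField u (X + e X * arc c (σ * r)) ≠ 0 →
      cross (charField u (X + e X * arc c (σ * r))) (e X * rot c (σ * r)) = 0 := by
    intro r hr hne
    have hreg' : ∀ r' ∈ Icc (0 : ℝ) 1, X + e X * arc c (σ * r * r') ∈ Ω ∧
        charField u (X + e X * arc c (σ * r * r')) ≠ 0 := by
      intro r' hr'
      rw [mul_assoc σ]
      rcases lt_or_eq_of_le (mul_le_one₀ hr.2 hr'.1 hr'.2) with hlt | heq
      · exact hreg _ ⟨mul_nonneg hr.1 hr'.1, hlt⟩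
      · have hr1 : r = 1 := by nlinarith [hr.1, hr.2, hr'.1, hr'.2]
        rw [heq, mul_one]
        rw [hr1, mul_one] at hne
        exact ⟨hend, hne⟩
    have h1 := h.field_eq_rot hc hreg'
    have h2 := h.parallel _ (by simpa using (hreg' 1 (by simp)).1) hne
    rwa [h1] at h2
  refine h.height_eq hc (h.norm_field X hX.1 hX.2) fun r hr => ?_
  rcases lt_or_eq_of_le hr.2 with hlt | heq
  · exact ⟨(hreg r ⟨hr.1, hlt⟩).1, hleaf r hr (hreg r ⟨hr.1, hlt⟩).2⟩
  · rw [heq, mul_one]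
    refine ⟨hend, ?_⟩
    by_cases h0 : charField u (X + e X * arc c σ) = 0
    · rw [h0]; simp [cross]
    · have := hleaf 1 (by simp) (by rwa [mul_one])
      rwa [mul_one] at this

theorem dot_field_fderiv (h : IsCharGraph c Ω u e) {X : ℂ} (hX : X ∈ Ω)
    (hF : charField u X ≠ 0) (n : ℂ) : dot (e X) (fderiv ℝ e X n) = 0 := by
  have hed : HasFDerivAt e (fderiv ℝ e X) X :=
    ((h.field_smooth X hX hF).differentiableAt (by norm_num)).hasFDerivAt
  have hl : HasDerivAt (fun t : ℝ => X + t • n) n 0 := by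
    simpa using ((hasDerivAt_id (0 : ℝ)).smul_const n).const_add X
  have hed' : HasFDerivAt e (fderiv ℝ e X) (X + (0 : ℝ) • n) := by simpa using hed
  have hcomp : HasDerivAt (fun t : ℝ => e (X + t • n)) (fderiv ℝ e X n) 0 :=
    hed'.comp_hasDerivAt 0 hl
  have h1 := hasDerivAt_dot hcomp hcomp
  have h2 : (fun t : ℝ => dot (e (X + t • n)) (e (X + t • n))) =ᶠ[𝓝 0] fun _ => 1 := by
    have hc : ContinuousAt (fun t : ℝ => X + t • n) 0 := hl.continuousAt
    have := hc.tendsto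
    rw [zero_smul, add_zero] at this
    filter_upwards [this.eventually (h.eventually_regular hX hF)] with t ht
    rw [dot_self, h.norm_field _ ht.1 ht.2, one_pow]
  have h3 := (h1.congr_of_eventuallyEq h2.symm).unique (hasDerivAt_const (0 : ℝ) (1 : ℝ))
  simp only [zero_smul, add_zero] at h3
  have h4 : dot (fderiv ℝ e X n) (e X) = dot (e X) (fderiv ℝ e X n) := by simp [dot]; ring
  linarith

end IsCharGraph

/-- The point at time `s` of the circle of curvature `c` which starts at `m + θ n` in the direction
`e`. -/
noncomputable def fan (c : ℝ) (e : ℂ → ℂ) (m n : ℂ) (s θ : ℝ) : ℂ :=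
  m + θ • n + e (m + θ • n) * arc c s

/-- The derivative of `fan` with respect to `θ`. -/
noncomputable def fanDeriv (c : ℝ) (e : ℂ → ℂ) (m n : ℂ) (s θ : ℝ) : ℂ :=
  n + fderiv ℝ e (m + θ • n) n * arc c s

/-- The height over `fan c e m n s θ` of the horizontal lift of the circle which starts on the
graph. -/
noncomputable def fanHeight (c : ℝ) (u : ℂ → ℝ) (e : ℂ → ℂ) (m n : ℂ) (s θ : ℝ) : ℝ :=
  u (m + θ • n) - cross (m + θ • n) (e (m + θ • n) * arc c s) - s / c + Real.sin (c * s) / c ^ 2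

/-- The contact form evaluated on the `θ`-derivative of the family of horizontal lifts. -/
noncomputable def fanContact (c : ℝ) (u : ℂ → ℝ) (e : ℂ → ℂ) (m n : ℂ) (s θ : ℝ) : ℝ :=
  -cross (charField u (m + θ • n)) n + 2 * cross (e (m + θ • n) * arc c s) n +
    cross (e (m + θ • n)) (fderiv ℝ e (m + θ • n) n) * dot (arc c s) (arc c s)

/-- The Jacobian determinant of `fan`. -/
noncomputable def fanJacobian (c : ℝ) (e : ℂ → ℂ) (m n : ℂ) (s θ : ℝ) : ℝ :=
  cross (e (m + θ • n) * rot c s) (fanDeriv c e m n s θ)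

namespace IsCharGraph

variable {c : ℝ} {Ω : Set ℂ} {u : ℂ → ℝ} {e : ℂ → ℂ} {m n : ℂ} {s θ : ℝ}

theorem hasDerivAt_line (m n : ℂ) (θ : ℝ) : HasDerivAt (fun t : ℝ => m + t • n) n θ := by
  simpa using ((hasDerivAt_id θ).smul_const n).const_add m

theorem hasDerivAt_field_line (h : IsCharGraph c Ω u e) (hX : m + θ • n ∈ Ω)
    (hF : charField u (m + θ • n) ≠ 0) :
    HasDerivAt (fun t : ℝ => e (m + t • n)) (fderiv ℝ e (m + θ • n) n) θ :=
  ((h.field_smooth _ hX hF).differentiableAt (by norm_num)).hasFDerivAt.comp_hasDerivAt θ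
    (hasDerivAt_line m n θ)

theorem hasDerivAt_fan (h : IsCharGraph c Ω u e) (hX : m + θ • n ∈ Ω)
    (hF : charField u (m + θ • n) ≠ 0) :
    HasDerivAt (fan c e m n s) (fanDeriv c e m n s θ) θ :=
  (hasDerivAt_line m n θ).add ((h.hasDerivAt_field_line hX hF).mul_const _)

theorem hasDerivAt_fan_time (hc : c ≠ 0) :
    HasDerivAt (fun s => fan c e m n s θ) (e (m + θ • n) * rot c s) s :=
  hasDerivAt_add_mul_arc hc _ _ s

/-- As long as the circles run through regular points, their lifts lie on the graph, and the contact
form of the variation is given by the slope of the graph. -/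
theorem fanContact_eq (h : IsCharGraph c Ω u e) (hc : c ≠ 0)
    (hreg : ∀ᶠ t in 𝓝 θ, ∀ r ∈ Icc (0 : ℝ) 1, fan c e m n (s * r) t ∈ Ω ∧
      charField u (fan c e m n (s * r) t) ≠ 0) :
    fanContact c u e m n s θ =
      -cross (charField u (fan c e m n s θ)) (fanDeriv c e m n s θ) := by
  have hθ := hreg.self_of_nhds
  have hstart : m + θ • n ∈ Ω ∧ charField u (m + θ • n) ≠ 0 := by
    have := hθ 0 (by simp)
    simpa [fan, arc_zero] using this
  have hend : fan c e m n s θ ∈ Ω := by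
    have := (hθ 1 (by simp)).1
    rwa [mul_one] at this
  have hu : ∀ X ∈ Ω, HasFDerivAt u (fderiv ℝ u X) X := fun X hX =>
    ((h.c2 X hX).differentiableAt (by norm_num)).hasFDerivAt
  have h1 := (hu _ hend).comp_hasDerivAt θ (h.hasDerivAt_fan (s := s) hstart.1 hstart.2)
  have h2 := (hu _ hstart.1).comp_hasDerivAt θ (hasDerivAt_line m n θ)
  have h3 := hasDerivAt_cross (hasDerivAt_line m n θ)
    ((h.hasDerivAt_field_line hstart.1 hstart.2).mul_const (arc c s))
  have h4 := ((h2.sub h3).sub_const (s / c)).add_const (Real.sin (c * s) / c ^ 2)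
  have heq : (u ∘ fan c e m n s) =ᶠ[𝓝 θ] fun t => u (m + t • n) -
      cross (m + t • n) (e (m + t • n) * arc c s) - s / c + Real.sin (c * s) / c ^ 2 := by
    filter_upwards [hreg] with t ht
    refine h.height_eq_of_regular hc (fun r hr => ht r (Ico_subset_Icc_self hr)) ?_
    have := (ht 1 (by simp)).1
    rwa [mul_one] at this
  have h5 := h1.unique (h4.congr_of_eventuallyEq heq)
  rw [fderiv_eq_cross, fderiv_eq_cross] at h5
  simp only [fan, fanDeriv, fanContact, cross, dot, Complex.mul_re, Complex.mul_im, Complex.add_re,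
    Complex.add_im] at h5 ⊢
  linear_combination -h5

/-- The contact form of the variation changes at twice the rate of the Jacobian determinant. -/
theorem hasDerivAt_fanContact (h : IsCharGraph c Ω u e) (hc : c ≠ 0) (hX : m + θ • n ∈ Ω)
    (hF : charField u (m + θ • n) ≠ 0) :
    HasDerivAt (fun s => fanContact c u e m n s θ) (2 * fanJacobian c e m n s θ) s := by
  have h0 := hasDerivAt_arc hc s
  have h1 := (hasDerivAt_cross (h0.const_mul (e (m + θ • n))) (hasDerivAt_const s n)).const_mul 2
  have h2 := (hasDerivAt_dot h0 h0).const_mul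
    (cross (e (m + θ • n)) (fderiv ℝ e (m + θ • n) n))
  refine ((h1.const_add (-cross (charField u (m + θ • n)) n)).add h2).congr_deriv ?_
  have h3 := h.dot_field_fderiv hX hF n
  have h4 := dot_self (e (m + θ • n))
  rw [h.norm_field _ hX hF] at h4
  simp only [fanJacobian, fanDeriv, cross, dot, Complex.mul_re, Complex.mul_im, Complex.add_re,
    Complex.add_im, Complex.zero_re, Complex.zero_im, rot, arc] at h3 h4 ⊢
  set a := (e (m + θ • n)).re
  set b := (e (m + θ • n)).im
  set a' := (fderiv ℝ e (m + θ • n) n).re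
  set b' := (fderiv ℝ e (m + θ • n) n).im
  linear_combination (2 * (Real.sin (c * s) * (Real.sin (c * s) / c) - Real.cos (c * s) *
    ((1 - Real.cos (c * s)) / c))) * h3

/-- The Jacobian determinant, simplified using that the derivative of the unit field `e` is normal to
`e`. -/
theorem fanJacobian_eq (h : IsCharGraph c Ω u e) (hX : m + θ • n ∈ Ω)
    (hF : charField u (m + θ • n) ≠ 0) :
    fanJacobian c e m n s θ = cross (e (m + θ • n) * rot c s) n +
      cross (e (m + θ • n)) (fderiv ℝ e (m + θ • n) n) * (Real.sin (c * s) / c) := by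
  have h3 := h.dot_field_fderiv hX hF n
  rw [← dot_rot_arc]
  simp only [fanJacobian, fanDeriv, cross, dot, Complex.mul_re, Complex.mul_im, Complex.add_re,
    Complex.add_im, rot, arc] at h3 ⊢
  linear_combination (-(Real.sin (c * s) * (Real.sin (c * s) / c) - Real.cos (c * s) *
    ((1 - Real.cos (c * s)) / c))) * h3

theorem contDiffAt_line (m n : ℂ) (p : ℝ × ℝ) :
    ContDiffAt ℝ ∞ (fun p : ℝ × ℝ => m + p.2 • n) p :=
  contDiffAt_const.add (contDiffAt_snd.smul contDiffAt_const)

theorem contDiffAt_field_line (h : IsCharGraph c Ω u e) (hX : m + θ • n ∈ Ω)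
    (hF : charField u (m + θ • n) ≠ 0) :
    ContDiffAt ℝ ∞ (fun p : ℝ × ℝ => e (m + p.2 • n)) (s, θ) :=
  ContDiffAt.comp (s, θ) (h.field_smooth _ hX hF) (contDiffAt_line m n (s, θ))

theorem contDiffAt_fderiv_field_line (h : IsCharGraph c Ω u e) (hX : m + θ • n ∈ Ω)
    (hF : charField u (m + θ • n) ≠ 0) :
    ContDiffAt ℝ ∞ (fun p : ℝ × ℝ => fderiv ℝ e (m + p.2 • n) n) (s, θ) :=
  (ContDiffAt.comp (s, θ) ((h.field_smooth _ hX hF).fderiv_right (m := ∞) (by simp))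
    (contDiffAt_line m n (s, θ))).clm_apply contDiffAt_const

theorem contDiffAt_arc_fst (c : ℝ) (p : ℝ × ℝ) :
    ContDiffAt ℝ ∞ (fun p : ℝ × ℝ => arc c p.1) p :=
  ((contDiff_arc c).comp contDiff_fst).contDiffAt

theorem contDiffAt_fan (h : IsCharGraph c Ω u e) (hX : m + θ • n ∈ Ω)
    (hF : charField u (m + θ • n) ≠ 0) :
    ContDiffAt ℝ ∞ (fun p : ℝ × ℝ => fan c e m n p.1 p.2) (s, θ) :=
  (contDiffAt_line m n (s, θ)).add
    ((h.contDiffAt_field_line hX hF).mul (contDiffAt_arc_fst c (s, θ)))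

theorem contDiffAt_fanHeight (h : IsCharGraph c Ω u e) (hX : m + θ • n ∈ Ω)
    (hF : charField u (m + θ • n) ≠ 0) :
    ContDiffAt ℝ ∞ (fun p : ℝ × ℝ => fanHeight c u e m n p.1 p.2) (s, θ) := by
  have h1 : ContDiffAt ℝ ∞ (fun p : ℝ × ℝ => u (m + p.2 • n)) (s, θ) :=
    ContDiffAt.comp (s, θ) (h.smooth _ hX hF) (contDiffAt_line m n (s, θ))
  have h2 := ContDiffAt.comp (s, θ) (contDiff_cross (n := ∞)).contDiffAt
    ((contDiffAt_line m n (s, θ)).prodMk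
      ((h.contDiffAt_field_line hX hF).mul (contDiffAt_arc_fst c (s, θ))))
  have h3 : ContDiffAt ℝ ∞ (fun p : ℝ × ℝ => p.1 / c) (s, θ) := by fun_prop
  have h4 : ContDiffAt ℝ ∞ (fun p : ℝ × ℝ => Real.sin (c * p.1) / c ^ 2) (s, θ) := by fun_prop
  exact ((h1.sub h2).sub h3).add h4

theorem contDiffAt_fanContact (h : IsCharGraph c Ω u e) (hX : m + θ • n ∈ Ω)
    (hF : charField u (m + θ • n) ≠ 0) :
    ContDiffAt ℝ ∞ (fun p : ℝ × ℝ => fanContact c u e m n p.1 p.2) (s, θ) := by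
  have h0 : ContDiffAt ℝ ∞ (charField u) (m + θ • n) :=
    contDiffAt_charField (h.smooth _ hX hF) (by simp)
  have h1 : ContDiffAt ℝ ∞ (fun p : ℝ × ℝ => charField u (m + p.2 • n)) (s, θ) :=
    ContDiffAt.comp (s, θ) (g := charField u) h0 (contDiffAt_line m n (s, θ))
  have ha := contDiffAt_arc_fst c (s, θ)
  have he := h.contDiffAt_field_line (s := s) hX hF
  have h2 := ContDiffAt.comp (s, θ) (contDiff_cross (n := ∞)).contDiffAt
    (h1.prodMk (contDiffAt_const (c := n)))
  have h3 := ContDiffAt.comp (s, θ) (contDiff_cross (n := ∞)).contDiffAt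
    ((he.mul ha).prodMk (contDiffAt_const (c := n)))
  have h4 := ContDiffAt.comp (s, θ) (contDiff_cross (n := ∞)).contDiffAt
    (he.prodMk (h.contDiffAt_fderiv_field_line hX hF))
  have h5 := ContDiffAt.comp (s, θ) (contDiff_dot (n := ∞)).contDiffAt (ha.prodMk ha)
  exact (h2.neg.add (contDiffAt_const.mul h3)).add (h4.mul h5)

theorem continuousAt_fanJacobian (h : IsCharGraph c Ω u e) (hX : m + θ • n ∈ Ω)
    (hF : charField u (m + θ • n) ≠ 0) :
    ContinuousAt (fun p : ℝ × ℝ => fanJacobian c e m n p.1 p.2) (s, θ) := by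
  have h1 : ContDiffAt ℝ ∞ (fun p : ℝ × ℝ => rot c p.1) (s, θ) :=
    ((contDiff_rot c).comp contDiff_fst).contDiffAt
  have h2 := (contDiffAt_const (c := n)).add ((h.contDiffAt_fderiv_field_line hX hF).mul
    (contDiffAt_arc_fst c (s, θ)))
  exact (ContDiffAt.comp (s, θ) (contDiff_cross (n := ∞)).contDiffAt
    (((h.contDiffAt_field_line hX hF).mul h1).prodMk h2)).continuousAt

end IsCharGraph

/-! ### Inverse functions and signs -/

/-- The inverse function theorem for endomorphisms, with smoothness of the local inverse on a
neighbourhood. (Smoothness of order `∞` at a point does not spread to a neighbourhood.) -/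
theorem exists_local_inverse {E : Type*} [NormedAddCommGroup E] [NormedSpace ℝ E]
    [FiniteDimensional ℝ E] {n : WithTop ℕ∞} (hn : n ≠ 0) {f : E → E} {a : E}
    (hf : ∀ᶠ x in 𝓝 a, ContDiffAt ℝ n f x) (hinj : ∀ x, fderiv ℝ f a x = 0 → x = 0) :
    ∃ g : E → E, g (f a) = a ∧ (∀ᶠ x in 𝓝 a, g (f x) = x) ∧
      (∀ᶠ y in 𝓝 (f a), f (g y) = y) ∧ ∀ᶠ y in 𝓝 (f a), ContDiffAt ℝ n g y := by
  have : CompleteSpace E := FiniteDimensional.complete ℝ E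
  have hfa := hf.self_of_nhds
  have hinj' : Function.Injective (fderiv ℝ f a : E →ₗ[ℝ] E) :=
    (injective_iff_map_eq_zero _).2 hinj
  obtain ⟨f', hf'⟩ : ∃ f' : E ≃L[ℝ] E, (f' : E →L[ℝ] E) = fderiv ℝ f a :=
    ⟨(LinearEquiv.ofInjectiveEndo _ hinj').toContinuousLinearEquiv, by ext x; simp⟩
  have hd : HasFDerivAt f (f' : E →L[ℝ] E) a := by
    rw [hf']; exact (hfa.differentiableAt hn).hasFDerivAt
  set φ := hfa.toOpenPartialHomeomorph f hd hn with hφ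
  have hcoe : (φ : E → E) = f := rfl
  have hsrc : a ∈ φ.source := hfa.mem_toOpenPartialHomeomorph_source hd hn
  have htgt : f a ∈ φ.target := hfa.image_mem_toOpenPartialHomeomorph_target hd hn
  have hga : φ.symm (f a) = a := φ.left_inv hsrc
  refine ⟨φ.symm, hga, ?_, ?_, ?_⟩
  · filter_upwards [φ.open_source.mem_nhds hsrc] with x hx using φ.left_inv hx
  · filter_upwards [φ.open_target.mem_nhds htgt] with y hy using φ.right_inv hy
  · have hcont : ContinuousAt φ.symm (f a) := φ.symm.continuousAt htgt
    have h1 : ContinuousAt (fderiv ℝ f) a := by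
      have h1n : (1 : WithTop ℕ∞) ≤ n := ENat.one_le_iff_ne_zero_withTop.2 hn
      exact ((hfa.of_le h1n).fderiv_right (m := 0) (by norm_num)).continuousAt
    have h2 : ∀ᶠ x in 𝓝 a, fderiv ℝ f x ∈ range ((↑) : (E ≃L[ℝ] E) → E →L[ℝ] E) := by
      refine h1.eventually ?_
      rw [← hf']
      exact ContinuousLinearEquiv.nhds f'
    have h3 := hcont.tendsto
    rw [hga] at h3
    filter_upwards [φ.open_target.mem_nhds htgt, h3.eventually h2, h3.eventually hf] with y hy h4 h5
    obtain ⟨f₁, hf₁⟩ := h4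
    refine φ.contDiffAt_symm hy (f₀' := f₁) ?_ h5
    rw [hf₁]
    exact (h5.differentiableAt hn).hasFDerivAt

theorem exists_sign {α : Type*} [TopologicalSpace α] {s : Set α} (hs : IsPreconnected s)
    {φ : α → ℝ} (hφ : ContinuousOn φ s) (h0 : ∀ x ∈ s, φ x ≠ 0) :
    ∃ ε : ℝ, (ε = 1 ∨ ε = -1) ∧ ∀ x ∈ s, ε * φ x < 0 := by
  by_cases h : ∃ x ∈ s, φ x < 0
  · obtain ⟨x, hx, hxn⟩ := h
    refine ⟨1, Or.inl rfl, fun y hy => ?_⟩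
    by_contra! hle
    rw [one_mul] at hle
    obtain ⟨z, hz, hz0⟩ := hs.intermediate_value hx hy hφ ⟨hxn.le, hle⟩
    exact h0 z hz hz0
  · push Not at h
    exact ⟨-1, Or.inr rfl, fun y hy => by
      have := lt_of_le_of_ne (h y hy) (h0 y hy).symm
      linarith⟩

namespace IsCharGraph

variable {c : ℝ} {Ω : Set ℂ} {u : ℂ → ℝ} {e : ℂ → ℂ}

theorem continuousOn_dot_field (h : IsCharGraph c Ω u e) {R : Set ℂ}
    (hR : ∀ X ∈ R, X ∈ Ω ∧ charField u X ≠ 0) :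
    ContinuousOn (fun X => dot (e X) (charField u X)) R := by
  intro X hX
  have hc : Continuous (fun p : ℂ × ℂ => dot p.1 p.2) := (contDiff_dot (n := 0)).continuous
  exact (hc.continuousAt.comp ((h.field_smooth X (hR X hX).1 (hR X hX).2).continuousAt.prodMk
    (h.continuousAt_charField (hR X hX).1))).continuousWithinAt

theorem dot_field_ne_zero (h : IsCharGraph c Ω u e) {X : ℂ} (hX : X ∈ Ω)
    (hF : charField u X ≠ 0) : dot (e X) (charField u X) ≠ 0 := by
  intro h0
  have := h.charField_eq hX hF
  rw [h0, zero_smul] at this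
  exact hF this

/-- A narrow cone about an eigenvector of the linearization at a singular point is free of singular
points. -/
theorem exists_regular_cone (h : IsCharGraph c Ω u e) {X₀ : ℂ} (hX : X₀ ∈ Ω)
    (hF : charField u X₀ = 0) {ν : ℂ} (hν : ‖ν‖ = 1) {μ : ℝ} (hμ : 0 < μ)
    (hM : fderiv ℝ (charField u) X₀ ν = (-μ) • ν) :
    ∃ η > 0, ∃ ρ > 0, ∀ r, 0 < r → r < ρ → ∀ X : ℂ, ‖X - (X₀ + r • ν)‖ ≤ η * r →
      X ∈ Ω ∧ charField u X ≠ 0 := by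
  set M := fderiv ℝ (charField u) X₀ with hMd
  have hMn := norm_nonneg M
  have hlo := (h.hasFDerivAt_charField hX).isLittleO.def (c := μ / 8) (by positivity)
  obtain ⟨ρ, hρ, hb⟩ := Metric.eventually_nhds_iff_ball.1 (hlo.and (h.isOpen.eventually_mem hX))
  set η := min 1 (μ / (4 * (1 + ‖M‖))) with hη
  have hη0 : 0 < η := by positivity
  have hη1 : η ≤ 1 := min_le_left _ _
  have hηM : ‖M‖ * η ≤ μ / 4 := by
    have h1 : η ≤ μ / (4 * (1 + ‖M‖)) := min_le_right _ _
    rw [le_div_iff₀ (by positivity)] at h1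
    nlinarith
  refine ⟨η, hη0, ρ / 2, by positivity, fun r hr hrρ X hXr => ?_⟩
  have hdec : X - X₀ = r • ν + (X - (X₀ + r • ν)) := by abel
  have hrn : ‖r • ν‖ = r := by rw [norm_smul, hν, mul_one, Real.norm_eq_abs, abs_of_pos hr]
  have hXn : ‖X - X₀‖ ≤ 2 * r := by
    rw [hdec]
    refine (norm_add_le _ _).trans ?_
    rw [hrn]; nlinarith
  have hXb : X ∈ Metric.ball X₀ ρ := by
    rw [Metric.mem_ball, dist_eq_norm]; linarith
  obtain ⟨h1, h2⟩ := hb X hXb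
  refine ⟨h2, fun h0 => ?_⟩
  rw [h0, hF] at h1
  have h3 : M (X - X₀) = (-μ * r) • ν + M (X - (X₀ + r • ν)) := by
    conv_lhs => rw [hdec]
    rw [map_add, map_smul, hM, smul_smul, mul_comm r]
  have h4 : ‖M (X - (X₀ + r • ν))‖ ≤ μ / 4 * r := by
    calc _ ≤ ‖M‖ * ‖X - (X₀ + r • ν)‖ := M.le_opNorm _
      _ ≤ ‖M‖ * (η * r) := by gcongr
      _ = ‖M‖ * η * r := by ring
      _ ≤ _ := by gcongr
  have h5 : ‖(-μ * r) • ν‖ = μ * r := by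
    rw [norm_smul, hν, mul_one, Real.norm_eq_abs, neg_mul, abs_neg, abs_of_pos (by positivity)]
  have h6 : ‖M (X - X₀)‖ ≤ μ / 8 * (2 * r) := by
    have : ‖(0 : ℂ) - 0 - M (X - X₀)‖ = ‖M (X - X₀)‖ := by
      rw [sub_zero, zero_sub, norm_neg]
    rw [← this]
    exact h1.trans (by gcongr)
  have h7 : μ * r ≤ ‖M (X - X₀)‖ + ‖M (X - (X₀ + r • ν))‖ := by
    rw [← h5]
    have : (-μ * r) • ν = M (X - X₀) - M (X - (X₀ + r • ν)) := by rw [h3]; abel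
    rw [this]
    exact norm_sub_le _ _
  nlinarith [mul_pos hμ hr]

end IsCharGraph

/-! ### Smoothness of singular curves -/

namespace IsCharGraph

variable {c : ℝ} {Ω : Set ℂ} {u : ℂ → ℝ} {e : ℂ → ℂ}
  {X₀ v : ℂ} {ρ η : ℝ} {ε : ℝ} {m n : ℂ} {s₀ t : ℝ}

/-- If a circle runs in a direction close to `v`, along which the component of `charField` in the
direction `v` decreases, then this component is strictly decreasing along the circle. -/
theorem strictAntiOn_dot_charField_fan (h : IsCharGraph c Ω u e) (hc : c ≠ 0)
    (hball : ∀ X ∈ Metric.ball X₀ ρ, X ∈ Ω ∧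
      ∀ w, ‖w - v‖ < η → dot v (fderiv ℝ (charField u) X w) ≤ -1)
    (hbox : ∀ r ∈ Icc 0 (2 * s₀), fan c e m n (-ε * r) t ∈ Metric.ball X₀ ρ ∧
      ‖(-ε) • (e (m + t • n) * rot c (-ε * r)) - v‖ < η) :
    ContinuousOn (fun r => dot v (charField u (fan c e m n (-ε * r) t))) (Icc 0 (2 * s₀)) ∧
    StrictAntiOn (fun r => dot v (charField u (fan c e m n (-ε * r) t))) (Icc 0 (2 * s₀)) := by
  have hd : ∀ r ∈ Icc 0 (2 * s₀), HasDerivAt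
      (fun r => dot v (charField u (fan c e m n (-ε * r) t)))
      (dot v (fderiv ℝ (charField u) (fan c e m n (-ε * r) t)
        ((-ε) • (e (m + t • n) * rot c (-ε * r))))) r := by
    intro r hr
    have h1 : HasDerivAt (fun r : ℝ => -ε * r) (-ε) r := by
      simpa using (hasDerivAt_id r).const_mul (-ε)
    have h2 : HasDerivAt (fun r => fan c e m n (-ε * r) t)
        ((-ε) • (e (m + t • n) * rot c (-ε * r))) r :=
      (hasDerivAt_fan_time hc).scomp r h1
    have h3 := (h.hasFDerivAt_charField (hball _ (hbox r hr).1).1).comp_hasDerivAt r h2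
    refine (hasDerivAt_dot (hasDerivAt_const r v) h3).congr_deriv ?_
    simp [dot]
  have hcont : ContinuousOn (fun r => dot v (charField u (fan c e m n (-ε * r) t)))
      (Icc 0 (2 * s₀)) := fun r hr => (hd r hr).continuousAt.continuousWithinAt
  refine ⟨hcont, strictAntiOn_of_deriv_neg (convex_Icc _ _) hcont fun r hr => ?_⟩
  have hr' := interior_subset hr
  rw [(hd r hr').deriv]
  have := (hball _ (hbox r hr').1).2 _ (hbox r hr').2
  linarith

/-- Where the component of `charField` in the direction `v` vanishes along the family of circles,
the circles reach the singular set, hence the contact form of their variation vanishes. -/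
theorem fanContact_eq_zero (h : IsCharGraph c Ω u e) (hc : c ≠ 0)
    (hball : ∀ X ∈ Metric.ball X₀ ρ, X ∈ Ω ∧
      ∀ w, ‖w - v‖ < η → dot v (fderiv ℝ (charField u) X w) ≤ -1)
    (hsing : ∀ X ∈ Metric.ball X₀ ρ, dot v (charField u X) = 0 → charField u X = 0)
    (hbox : ∀ᶠ t' in 𝓝 t, ∀ r ∈ Icc 0 (2 * s₀), fan c e m n (-ε * r) t' ∈ Metric.ball X₀ ρ ∧
      ‖(-ε) • (e (m + t' • n) * rot c (-ε * r)) - v‖ < η)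
    {r : ℝ} (hr0 : 0 < r) (hr : r ≤ 2 * s₀)
    (hzero : dot v (charField u (fan c e m n (-ε * r) t)) = 0) :
    charField u (fan c e m n (-ε * r) t) = 0 ∧ fanContact c u e m n (-ε * r) t = 0 ∧
      u (fan c e m n (-ε * r) t) = fanHeight c u e m n (-ε * r) t := by
  set b : ℝ → ℝ → ℝ := fun t' r => dot v (charField u (fan c e m n (-ε * r) t')) with hb
  have hbox_t := hbox.self_of_nhds
  have hanti := (h.strictAntiOn_dot_charField_fan hc hball hbox_t).2
  have hrI : r ∈ Icc 0 (2 * s₀) := ⟨hr0.le, hr⟩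
  have hF0 : charField u (fan c e m n (-ε * r) t) = 0 := hsing _ (hbox_t r hrI).1 hzero
  have hpos : ∀ r' ∈ Ico 0 r, 0 < b t r' := by
    intro r' hr'
    have := hanti ⟨hr'.1, hr'.2.le.trans hr⟩ hrI hr'.2
    simp only at this
    rwa [hzero] at this
  have hne : ∀ {t' r' : ℝ}, 0 < b t' r' → charField u (fan c e m n (-ε * r') t') ≠ 0 := by
    intro t' r' hp h0
    simp only [hb, h0] at hp
    simp [dot] at hp
  have hstart : m + t • n ∈ Ω ∧ charField u (m + t • n) ≠ 0 := by
    have h1 := (hball _ (hbox_t 0 ⟨le_rfl, by linarith⟩).1).1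
    have h2 := hne (hpos 0 ⟨le_rfl, hr0⟩)
    simpa [fan, arc_zero] using And.intro h1 h2
  refine ⟨hF0, ?_, ?_⟩
  · have hcontact : ∀ r' ∈ Ioo 0 r, fanContact c u e m n (-ε * r') t =
        -cross (charField u (fan c e m n (-ε * r') t)) (fanDeriv c e m n (-ε * r') t) := by
      intro r' hr'
      refine h.fanContact_eq hc ?_
      have hr'I : r' ∈ Icc 0 (2 * s₀) := ⟨hr'.1.le, hr'.2.le.trans hr⟩
      have hct : ContinuousAt (fun t' => b t' r') t := by
        have h1 : ContinuousAt (fan c e m n (-ε * r')) t :=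
          (h.hasDerivAt_fan hstart.1 hstart.2).continuousAt
        have h2 := (h.continuousAt_charField (hball _ (hbox_t r' hr'I).1).1).comp h1
        have hcd : Continuous (fun p : ℂ × ℂ => dot p.1 p.2) := (contDiff_dot (n := 0)).continuous
        exact hcd.continuousAt.comp ((continuousAt_const (y := v)).prodMk h2)
      filter_upwards [hbox, hct.eventually_const_lt (hpos r' ⟨hr'.1.le, hr'.2⟩)] with t' h1 h2
      intro q hq
      have hq0 : 0 ≤ r' * q := mul_nonneg hr'.1.le hq.1
      have hq1 : r' * q ≤ r' := mul_le_of_le_one_right hr'.1.le hq.2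
      have hqI : r' * q ∈ Icc 0 (2 * s₀) := ⟨hq0, hq1.trans hr'I.2⟩
      have h3 := (h.strictAntiOn_dot_charField_fan hc hball h1).2.antitoneOn hqI hr'I hq1
      rw [mul_assoc]
      exact ⟨(hball _ (h1 _ hqI).1).1, hne (lt_of_lt_of_le h2 h3)⟩
    have hl : HasDerivAt (fun r : ℝ => -ε * r) (-ε) r := by
      simpa using (hasDerivAt_id r).const_mul (-ε)
    have hc1 : ContinuousAt (fun r' => fanContact c u e m n (-ε * r') t) r :=
      ContinuousAt.comp (f := fun r' : ℝ => -ε * r')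
        (h.hasDerivAt_fanContact hc hstart.1 hstart.2).continuousAt hl.continuousAt
    have hc2 : ContinuousAt (fun r' => -cross (charField u (fan c e m n (-ε * r') t))
        (fanDeriv c e m n (-ε * r') t)) r := by
      have h1 : ContinuousAt (fun r' => fan c e m n (-ε * r') t) r :=
        ContinuousAt.comp (f := fun r' : ℝ => -ε * r')
          (hasDerivAt_fan_time hc).continuousAt hl.continuousAt
      have h2 := ContinuousAt.comp (f := fun r' => fan c e m n (-ε * r') t)
        (h.continuousAt_charField (hball _ (hbox_t r hrI).1).1) h1
      have h3 : ContinuousAt (fun r' => fanDeriv c e m n (-ε * r') t) r := by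
        have := ContinuousAt.comp (f := fun r' : ℝ => -ε * r')
          (hasDerivAt_arc hc (-ε * r)).continuousAt hl.continuousAt
        exact continuousAt_const.add (continuousAt_const.mul this)
      have hcd : Continuous (fun p : ℂ × ℂ => cross p.1 p.2) := (contDiff_cross (n := 0)).continuous
      exact (hcd.continuousAt.comp (h2.prodMk h3)).neg
    have hev : (fun r' => fanContact c u e m n (-ε * r') t) =ᶠ[𝓝[<] r]
        fun r' => -cross (charField u (fan c e m n (-ε * r') t)) (fanDeriv c e m n (-ε * r') t) := by
      filter_upwards [Ioo_mem_nhdsLT hr0] with r' hr' using hcontact r' hr'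
    have := tendsto_nhds_unique (hc1.tendsto.mono_left nhdsWithin_le_nhds)
      ((hc2.tendsto.mono_left nhdsWithin_le_nhds).congr' hev.symm)
    rw [this, hF0]
    simp [cross]
  · refine h.height_eq_of_regular hc (fun q hq => ?_) (hball _ (hbox_t r hrI).1).1
    rw [mul_assoc]
    have hq0 : 0 ≤ r * q := mul_nonneg hr0.le hq.1
    have hq1 : r * q < r := mul_lt_of_lt_one_right hr0 hq.2
    exact ⟨(hball _ (hbox_t (r * q) ⟨hq0, hq1.le.trans hr⟩).1).1, hne (hpos _ ⟨hq0, hq1⟩)⟩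

end IsCharGraph

namespace IsCharGraph

variable {c : ℝ} {Ω : Set ℂ} {u : ℂ → ℝ} {e : ℂ → ℂ}

theorem abs_sin_mul_div_le {c : ℝ} (hc : c ≠ 0) (s : ℝ) : |Real.sin (c * s) / c| ≤ |s| := by
  rw [abs_div, div_le_iff₀ (abs_pos.2 hc), ← abs_mul, mul_comm s c]
  exact Real.abs_sin_le_abs

theorem norm_arc_le {c : ℝ} (hc : c ≠ 0) (s : ℝ) : ‖arc c s‖ ≤ 2 * |s| := by
  have h1 : ‖arc c s‖ ^ 2 ≤ (2 * |s|) ^ 2 := by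
    rw [← dot_self, dot_arc_self]
    have h2 := Real.one_sub_sq_div_two_le_cos (x := c * s)
    have h3 : (2 * |s|) ^ 2 = 4 * s ^ 2 := by rw [mul_pow, sq_abs]; norm_num
    rw [h3, div_le_iff₀ (by positivity)]
    nlinarith [sq_nonneg (c * s)]
  exact (abs_le_of_sq_le_sq' h1 (by positivity)).2

/-- A characteristic curve which leaves a rank one singular point `X₀` against the direction `v`, run
up to a short time `s₀`: the point `m` it reaches is regular, and at `m` the Jacobian determinant of
the transversal family of circles is controlled, because the linearization has range `v`. -/
theorem exists_leaf_of_rank_one (h : IsCharGraph c Ω u e) (hc : c ≠ 0) {X₀ : ℂ} (hX : X₀ ∈ Ω)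
    (hF : charField u X₀ = 0) {v : ℂ} (hv : ‖v‖ = 1)
    (hv2 : fderiv ℝ (charField u) X₀ v = (-2 : ℝ) • v)
    (hrange : ∀ w, cross v (fderiv ℝ (charField u) X₀ w) = 0) (n : ℂ) :
    ∃ ε : ℝ, (ε = 1 ∨ ε = -1) ∧ ∀ᶠ s₀ in 𝓝[>] (0 : ℝ), ∃ m : ℂ,
      m = X₀ + ε * (-v) * arc c (ε * s₀) ∧ m ∈ Ω ∧ charField u m ≠ 0 ∧
      e m = ε * (-v) * rot c (ε * s₀) ∧
      |cross (e m) (fderiv ℝ e m n)| * s₀ ≤ 1 / 2 := by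
  have hν : ‖-v‖ = 1 := by rwa [norm_neg]
  have hM : fderiv ℝ (charField u) X₀ (-v) = (-2 : ℝ) • (-v) := by rw [map_neg, hv2, smul_neg]
  obtain ⟨η, hη, ρ, hρ, hcone⟩ := h.exists_regular_cone hX hF hν two_pos hM
  have hray : ∀ t ∈ Ioo 0 ρ, X₀ + t • (-v) ∈ Ω ∧ charField u (X₀ + t • (-v)) ≠ 0 :=
    fun t ht => hcone t ht.1 ht.2 _ (by rw [sub_self, norm_zero]; exact mul_nonneg hη.le ht.1.le)
  obtain ⟨ε, hε, hsgn⟩ := exists_sign (isPreconnected_Ioo (a := 0) (b := ρ))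
    (φ := fun t : ℝ => dot (e (X₀ + t • (-v))) (charField u (X₀ + t • (-v))))
    (ContinuousOn.comp (g := fun X => dot (e X) (charField u X))
      (t := {X | X ∈ Ω ∧ charField u X ≠ 0}) (h.continuousOn_dot_field fun X hX => hX)
      (by fun_prop) hray)
    (fun t ht => h.dot_field_ne_zero (hray t ht).1 (hray t ht).2)
  have hsign : ∀ᶠ t : ℝ in 𝓝[>] 0, X₀ + t • (-v) ∈ Ω ∧
      ε * dot (e (X₀ + t • (-v))) (charField u (X₀ + t • (-v))) < 0 := by
    filter_upwards [Ioo_mem_nhdsGT hρ] with t ht using ⟨(hray t ht).1, hsgn t ht⟩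
  refine ⟨ε, hε, ?_⟩
  have hε2 : (ε : ℂ) * ε = 1 := by rcases hε with rfl | rfl <;> simp
  have hleaf : ∀ᶠ s in 𝓝[>] (0 : ℝ),
      (X₀ + ε * (-v) * arc c (ε * s) ∈ Ω ∧ charField u (X₀ + ε * (-v) * arc c (ε * s)) ≠ 0) ∧
      e (X₀ + ε * (-v) * arc c (ε * s)) = ε * (-v) * rot c (ε * s) := by
    have h1 : Tendsto (fun s : ℝ => |c| * s) (𝓝[>] 0) (𝓝 0) := by
      have : Continuous fun s : ℝ => |c| * s := by fun_prop
      simpa using (this.tendsto 0).mono_left nhdsWithin_le_nhds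
    filter_upwards [Ioo_mem_nhdsGT hρ, h1.eventually_lt_const hη] with s hs hsη
    exact h.field_eq_rot_of_singular hc hX hF hν two_pos hM hε hsign hcone hs.1 hs.2 hsη
  -- the curve and its velocity at the singular point
  set P : ℝ → ℂ := fun s => X₀ + ε * (-v) * arc c (ε * s) with hP
  have hl : HasDerivAt (fun s : ℝ => ε * s) ε 0 := by
    simpa using (hasDerivAt_id (0 : ℝ)).const_mul ε
  have hPd : HasDerivAt P (-v) 0 := by
    have := (hasDerivAt_add_mul_arc hc X₀ (ε * (-v)) (ε * 0)).scomp 0 hl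
    refine this.congr_deriv ?_
    rw [mul_zero, rot_zero, mul_one, Complex.real_smul, ← mul_assoc, hε2, one_mul]
  have hP0 : P 0 = X₀ := by simp [hP, arc_zero]
  have hPt : Tendsto P (𝓝[>] 0) (𝓝 X₀) := by
    have := hPd.continuousAt.tendsto.mono_left (nhdsWithin_le_nhds (s := Ioi 0))
    rwa [hP0] at this
  -- `charField` grows at least linearly along the curve
  have hgrow : ∀ᶠ s in 𝓝[>] (0 : ℝ), s ≤ ‖charField u (P s)‖ := by
    have h1 : HasFDerivAt (charField u) (fderiv ℝ (charField u) X₀) (P 0) := by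
      rw [hP0]; exact h.hasFDerivAt_charField hX
    have h2 := (h1.comp_hasDerivAt 0 hPd).tendsto_slope_zero_right
    rw [hM] at h2
    simp only [zero_add, Function.comp, hP0, hF, sub_zero] at h2
    have h3 : (1 : ℝ) < ‖(-2 : ℝ) • (-v)‖ := by rw [norm_smul, hν]; norm_num
    filter_upwards [h2.norm.eventually_const_lt h3, self_mem_nhdsWithin] with s hs hs0
    have hs0 : 0 < s := hs0
    rw [norm_smul, norm_inv, Real.norm_eq_abs, abs_of_pos hs0, ← div_eq_inv_mul,
      lt_div_iff₀ hs0, one_mul] at hs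
    exact hs.le
  have hsmall : ∀ᶠ s in 𝓝[>] (0 : ℝ),
      |cross (ε * (-v) * rot c (ε * s)) (fderiv ℝ (charField u) (P s) n)| < 1 / 2 := by
    have h1 : Tendsto (fun s => fderiv ℝ (charField u) (P s) n) (𝓝[>] 0)
        (𝓝 (fderiv ℝ (charField u) X₀ n)) :=
      (isBoundedBilinearMap_apply.continuous.tendsto (fderiv ℝ (charField u) X₀, n)).comp
        (((h.continuousAt_fderiv_charField hX).tendsto.comp hPt).prodMk_nhds tendsto_const_nhds)
    have h2 : Tendsto (fun s : ℝ => ε * (-v) * rot c (ε * s)) (𝓝[>] 0) (𝓝 (ε * (-v))) := by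
      have : Continuous fun s : ℝ => ε * (-v) * rot c (ε * s) :=
        continuous_const.mul ((contDiff_rot (n := 0) c).continuous.comp (by fun_prop))
      have := (this.tendsto 0).mono_left (nhdsWithin_le_nhds (s := Ioi 0))
      simpa [rot_zero] using this
    have hcc : Continuous (fun p : ℂ × ℂ => cross p.1 p.2) := (contDiff_cross (n := 0)).continuous
    have h3 := ((hcc.tendsto _).comp (h2.prodMk_nhds h1)).abs
    have h4 : cross (ε * (-v)) (fderiv ℝ (charField u) X₀ n) = 0 := by
      have : (ε * (-v) : ℂ) = (-ε) • v := by rw [Complex.real_smul]; push_cast; ring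
      rw [this, cross_smul_left, hrange, mul_zero]
    simp only [h4, abs_zero] at h3
    exact h3.eventually_lt_const (by norm_num)
  filter_upwards [hleaf, hgrow, hsmall, self_mem_nhdsWithin] with s h1 h2 h3 hs0
  have hs0 : 0 < s := hs0
  refine ⟨P s, rfl, h1.1.1, h1.1.2, h1.2, ?_⟩
  have h4 := h.cross_fderiv_charField h1.1.1 h1.1.2 n
  have h5 : |dot (e (P s)) (charField u (P s))| = ‖charField u (P s)‖ := by
    have := h.charField_eq h1.1.1 h1.1.2
    conv_rhs => rw [this]
    rw [norm_smul, h.norm_field _ h1.1.1 h1.1.2, mul_one, Real.norm_eq_abs]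
  have h6 : |cross (e (P s)) (fderiv ℝ (charField u) (P s) n)| < 1 / 2 := by
    rw [h1.2]; exact h3
  rw [h4, abs_mul, h5] at h6
  calc _ ≤ |cross (e (P s)) (fderiv ℝ e (P s) n)| * ‖charField u (P s)‖ := by gcongr
    _ ≤ _ := by rw [mul_comm]; exact h6.le

/-- Near a rank one singular point, the singular set is a smooth curve, which is parametrized by the
component normal to `v`. It is the locus where the circles of the family issuing from a transversal
through a nearby regular point are hit by the zero set of the contact form of the variation, to which
the inverse function theorem applies. -/
theorem exists_smooth_singular_curve (h : IsCharGraph c Ω u e) (hc : c ≠ 0) {X₀ : ℂ} (hX : X₀ ∈ Ω)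
    (hF : charField u X₀ = 0) {v : ℂ} (hv : ‖v‖ = 1)
    (hv2 : fderiv ℝ (charField u) X₀ v = (-2 : ℝ) • v)
    (hrange : ∀ w, cross v (fderiv ℝ (charField u) X₀ w) = 0) :
    ∃ ρ > 0, ∃ δ > 0, ∃ γ : ℝ → ℂ, Metric.ball X₀ ρ ⊆ Ω ∧
      (∀ τ, |τ| < δ → ContDiffAt ℝ ∞ γ τ ∧ ContDiffAt ℝ ∞ (fun τ => u (γ τ)) τ ∧
        γ τ ∈ Metric.ball X₀ ρ ∧ charField u (γ τ) = 0 ∧ cross v (γ τ - X₀) = τ) ∧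
      ∀ X ∈ Metric.ball X₀ ρ, charField u X = 0 → |cross v (X - X₀)| < δ →
        γ (cross v (X - X₀)) = X := by
  -- a ball in which everything is controlled
  obtain ⟨ρ, hρ, η, hη, hball, hsing⟩ : ∃ ρ > 0, ∃ η > 0, (∀ X ∈ Metric.ball X₀ ρ, X ∈ Ω ∧
      ∀ w, ‖w - v‖ < η → dot v (fderiv ℝ (charField u) X w) ≤ -1) ∧
      ∀ X ∈ Metric.ball X₀ ρ, dot v (charField u X) = 0 → charField u X = 0 := by
    obtain ⟨ρ₁, hρ₁, hs⟩ := h.exists_ball_charField_eq_zero hX hF hv hv2 hrange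
    have hcd : Continuous (fun p : ℂ × ℂ => dot p.1 p.2) := (contDiff_dot (n := 0)).continuous
    have h1 : ContinuousAt (fun p : ℂ × ℂ => dot v (fderiv ℝ (charField u) p.1 p.2)) (X₀, v) := by
      have a1 : ContinuousAt (fun p : ℂ × ℂ => fderiv ℝ (charField u) p.1) (X₀, v) :=
        ContinuousAt.comp (f := Prod.fst) (h.continuousAt_fderiv_charField hX) continuousAt_fst
      have a2 : ContinuousAt (fun p : ℂ × ℂ => fderiv ℝ (charField u) p.1 p.2) (X₀, v) :=
        ContinuousAt.comp (f := fun p : ℂ × ℂ => (fderiv ℝ (charField u) p.1, p.2))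
          isBoundedBilinearMap_apply.continuous.continuousAt (a1.prodMk continuousAt_snd)
      exact hcd.continuousAt.comp ((continuousAt_const (y := v)).prodMk a2)
    have h2 : dot v (fderiv ℝ (charField u) X₀ v) < -1 := by
      rw [hv2, dot_smul_right, dot_self, hv]; norm_num
    have h3 := h1.eventually_lt_const h2
    have h4 : ∀ᶠ p : ℂ × ℂ in 𝓝 (X₀, v), p.1 ∈ Ω :=
      continuousAt_fst.eventually (h.isOpen.eventually_mem hX)
    obtain ⟨r, hr, hb⟩ := Metric.eventually_nhds_iff_ball.1 (h3.and h4)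
    have hmem : ∀ {X w : ℂ}, X ∈ Metric.ball X₀ r → ‖w - v‖ < r →
        (X, w) ∈ Metric.ball (X₀, v) r := by
      intro X w hX hw
      rw [← ball_prod_same]
      exact ⟨hX, by simpa [dist_eq_norm] using hw⟩
    refine ⟨min r ρ₁, by positivity, r, hr, fun X hX => ?_, fun X hX =>
      hs X (Metric.ball_subset_ball (min_le_right _ _) hX)⟩
    have hX' := Metric.ball_subset_ball (min_le_left r ρ₁) hX
    exact ⟨(hb _ (hmem hX' (by simpa using hr : ‖v - v‖ < r))).2,
      fun w hw => (hb _ (hmem hX' hw)).1.le⟩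
  set n := Complex.I * v with hn
  have hnn : ‖n‖ = 1 := by rw [hn, norm_mul, hv]; simp
  obtain ⟨ε, hε, hleaf⟩ := h.exists_leaf_of_rank_one hc hX hF hv hv2 hrange n
  have hε2 : (ε : ℂ) * ε = 1 := by rcases hε with rfl | rfl <;> simp
  have hεR : ε * ε = 1 := by rcases hε with rfl | rfl <;> norm_num
  have hεabs : |ε| = 1 := by rcases hε with rfl | rfl <;> norm_num
  have hsmall : ∀ᶠ s₀ in 𝓝[>] (0 : ℝ), 8 * s₀ < ρ ∧ 4 * |c| * s₀ < η := by
    have h1 : Tendsto (fun s : ℝ => 8 * s) (𝓝[>] 0) (𝓝 0) := by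
      have : Continuous fun s : ℝ => 8 * s := by fun_prop
      simpa using (this.tendsto 0).mono_left nhdsWithin_le_nhds
    have h2 : Tendsto (fun s : ℝ => 4 * |c| * s) (𝓝[>] 0) (𝓝 0) := by
      have : Continuous fun s : ℝ => 4 * |c| * s := by fun_prop
      simpa using (this.tendsto 0).mono_left nhdsWithin_le_nhds
    exact (h1.eventually_lt_const hρ).and (h2.eventually_lt_const hη)
  obtain ⟨s₀, ⟨m, hm, hmΩ, hmF, hem, hJsmall⟩, ⟨hs8, hs4⟩, hs0⟩ :=
    (hleaf.and (hsmall.and self_mem_nhdsWithin)).exists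
  have hs0 : 0 < s₀ := hs0
  obtain ⟨w₀, hw₀⟩ : ∃ w₀ : ℂ, w₀ = ε * (-v) := ⟨_, rfl⟩
  rw [← hw₀] at hm hem
  have hw₀n : ‖w₀‖ = 1 := by rw [hw₀, norm_mul, norm_neg, hv, Complex.norm_real]; simp [hεabs]
  have hend : e m * rot c (-ε * s₀) = w₀ := by
    rw [hem, neg_mul, mul_assoc, rot_mul_rot_neg, mul_one]
  have hm0 : m + (0 : ℝ) • n = m := by simp
  have hfan0 : fan c e m n (-ε * s₀) 0 = X₀ := by
    rw [fan, hm0, hem, hm, neg_mul]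
    linear_combination w₀ * arc_add_rot_mul_arc_neg c (ε * s₀)
  have hreg0 : m + (0 : ℝ) • n ∈ Ω ∧ charField u (m + (0 : ℝ) • n) ≠ 0 := by
    rw [hm0]; exact ⟨hmΩ, hmF⟩
  -- the Jacobian determinant at the singular point
  have hJ0 : fanJacobian c e m n (-ε * s₀) 0 ≠ 0 := by
    rw [h.fanJacobian_eq hreg0.1 hreg0.2, hm0, hend]
    have h1 : cross w₀ n = -ε := by
      have := dot_self v
      rw [hv] at this
      simp only [dot] at this
      simp [hw₀, hn, cross]
      linear_combination (-ε) * this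
    have h2 : |cross (e m) (fderiv ℝ e m n) * (Real.sin (c * (-ε * s₀)) / c)| ≤ 1 / 2 := by
      rw [abs_mul]
      refine le_trans ?_ hJsmall
      gcongr
      refine (abs_sin_mul_div_le hc _).trans ?_
      rw [abs_mul, abs_neg, hεabs, one_mul, abs_of_pos hs0]
    rw [h1]
    intro h0
    have h3 : |ε| = |cross (e m) (fderiv ℝ e m n) * (Real.sin (c * (-ε * s₀)) / c)| := by
      have : ε = cross (e m) (fderiv ℝ e m n) * (Real.sin (c * (-ε * s₀)) / c) := by linarith
      exact congrArg abs this
    rw [← h3, hεabs] at h2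
    norm_num at h2
  have hreg_ev : ∀ᶠ t in 𝓝 (0 : ℝ), m + t • n ∈ Ω ∧ charField u (m + t • n) ≠ 0 := by
    have h1 : Tendsto (fun t : ℝ => m + t • n) (𝓝 0) (𝓝 (m + (0 : ℝ) • n)) :=
      (hasDerivAt_line m n 0).continuousAt.tendsto
    exact h1.eventually (h.eventually_regular hreg0.1 hreg0.2)
  -- the nearby circles stay in the ball and run in directions close to `v`
  have hbox : ∀ᶠ t in 𝓝 (0 : ℝ), ∀ r ∈ Icc 0 (2 * s₀),
      fan c e m n (-ε * r) t ∈ Metric.ball X₀ ρ ∧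
      ‖(-ε) • (e (m + t • n) * rot c (-ε * r)) - v‖ < η := by
    have h1 : ContinuousAt (fun t : ℝ => e (m + t • n)) 0 :=
      (h.hasDerivAt_field_line hreg0.1 hreg0.2).continuousAt
    have h2 : ∀ᶠ t in 𝓝 (0 : ℝ), ‖e (m + t • n) - e m‖ < η / 4 := by
      have := h1.eventually (Metric.ball_mem_nhds _ (by positivity : 0 < η / 4))
      filter_upwards [this] with t ht
      rw [dist_eq_norm, hm0] at ht
      exact ht
    have h3 : ∀ᶠ t in 𝓝 (0 : ℝ), ‖t‖ < s₀ := by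
      have := (continuous_norm (E := ℝ)).tendsto 0
      rw [norm_zero] at this
      exact this.eventually_lt_const hs0
    filter_upwards [h2, h3, hreg_ev] with t ht2 ht3 ht4
    intro r hr
    have hrabs : |(-ε) * r| = r := by
      rw [abs_mul, abs_neg, hεabs, one_mul, abs_of_nonneg hr.1]
    have hen : ‖e (m + t • n)‖ = 1 := h.norm_field _ ht4.1 ht4.2
    constructor
    · rw [Metric.mem_ball, dist_eq_norm]
      have e1 : fan c e m n (-ε * r) t - X₀ =
          w₀ * arc c (ε * s₀) + t • n + e (m + t • n) * arc c (-ε * r) := by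
        rw [fan, hm]; ring
      rw [e1]
      refine (norm_add₃_le).trans_lt ?_
      rw [norm_mul, norm_mul, norm_smul, hw₀n, hen, hnn, one_mul, one_mul, mul_one]
      have i1 := norm_arc_le hc (ε * s₀)
      have i2 := norm_arc_le hc (-ε * r)
      rw [hrabs] at i2
      rw [abs_mul, hεabs, one_mul, abs_of_pos hs0] at i1
      linarith [hr.2]
    · have e1 : (-ε) • (e (m + t • n) * rot c (-ε * r)) - v =
          (-ε) • ((e (m + t • n) - e m) * rot c (-ε * r) +
            w₀ * (rot c (ε * s₀) - 1) * rot c (-ε * r) + w₀ * (rot c (-ε * r) - 1)) := by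
        rw [hem]
        simp only [Complex.real_smul, Complex.ofReal_neg, hw₀]
        linear_combination v * hε2
      rw [e1, norm_smul, Real.norm_eq_abs, abs_neg, hεabs, one_mul]
      refine (norm_add₃_le).trans_lt ?_
      rw [norm_mul, norm_mul, norm_mul, norm_mul, hw₀n, norm_rot, one_mul, one_mul, mul_one,
        mul_one]
      have i1 := norm_rot_sub_one_le c (ε * s₀)
      have i2 := norm_rot_sub_one_le c (-ε * r)
      rw [hrabs] at i2
      rw [abs_mul ε, hεabs, one_mul, abs_of_pos hs0] at i1
      have i3 : |c| * r ≤ |c| * (2 * s₀) := by gcongr; exact hr.2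
      linarith
  have hs₀I : s₀ ∈ Icc 0 (2 * s₀) := ⟨hs0.le, by linarith⟩
  have hfanF0 : dot v (charField u (fan c e m n (-ε * s₀) 0)) = 0 := by
    rw [hfan0, hF]; simp [dot]
  have hcontact0 : fanContact c u e m n (-ε * s₀) 0 = 0 :=
    (h.fanContact_eq_zero hc hball hsing hbox hs0 hs₀I.2 hfanF0).2.1
  -- near the singular point, the zeros of the contact form lie over the singular set
  have hkey : ∀ᶠ p : ℝ × ℝ in 𝓝 (-ε * s₀, 0), fanContact c u e m n p.1 p.2 = 0 →
      charField u (fan c e m n p.1 p.2) = 0 ∧ fan c e m n p.1 p.2 ∈ Metric.ball X₀ ρ ∧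
      u (fan c e m n p.1 p.2) = fanHeight c u e m n p.1 p.2 := by
    have hJev := (h.continuousAt_fanJacobian (s := -ε * s₀) hreg0.1 hreg0.2).eventually_ne hJ0
    obtain ⟨d, hd, hJd⟩ := Metric.eventually_nhds_iff_ball.1 hJev
    set δ := min (d / 2) (s₀ / 2) with hδ
    have hδ0 : 0 < δ := by positivity
    have hδd : δ < d := lt_of_le_of_lt (min_le_left _ _) (by linarith)
    have hδs : δ < s₀ := lt_of_le_of_lt (min_le_right _ _) (by linarith)
    have hI : Icc (s₀ - δ) (s₀ + δ) ⊆ Icc 0 (2 * s₀) := Icc_subset_Icc (by linarith) (by linarith)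
    have hanti0 := (h.strictAntiOn_dot_charField_fan hc hball hbox.self_of_nhds).2
    have hcont : ∀ r ∈ Icc 0 (2 * s₀), ContinuousAt
        (fun t => dot v (charField u (fan c e m n (-ε * r) t))) 0 := by
      intro r hr
      have h1 : ContinuousAt (fan c e m n (-ε * r)) 0 :=
        (h.hasDerivAt_fan hreg0.1 hreg0.2).continuousAt
      have h2 := (h.continuousAt_charField (hball _ (hbox.self_of_nhds r hr).1).1).comp h1
      have hcd : Continuous (fun p : ℂ × ℂ => dot p.1 p.2) := (contDiff_dot (n := 0)).continuous
      exact hcd.continuousAt.comp ((continuousAt_const (y := v)).prodMk h2)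
    have hmem1 : s₀ - δ ∈ Icc 0 (2 * s₀) := ⟨by linarith, by linarith⟩
    have hmem2 : s₀ + δ ∈ Icc 0 (2 * s₀) := ⟨by linarith, by linarith⟩
    have hpos0 : 0 < dot v (charField u (fan c e m n (-ε * (s₀ - δ)) 0)) := by
      have := hanti0 hmem1 hs₀I (by linarith)
      simp only at this
      rwa [hfanF0] at this
    have hneg0 : dot v (charField u (fan c e m n (-ε * (s₀ + δ)) 0)) < 0 := by
      have := hanti0 hs₀I hmem2 (by linarith)
      simp only at this
      rwa [hfanF0] at this
    have hev := ((hbox.eventually_nhds.and hreg_ev).and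
      (((hcont _ hmem1).eventually_const_lt hpos0).and
      ((hcont _ hmem2).eventually_lt_const hneg0)))
    have hev2 : ∀ᶠ p : ℝ × ℝ in 𝓝 (-ε * s₀, 0), _ :=
      (continuousAt_snd (p := (-ε * s₀, (0 : ℝ)))).eventually hev
    have hev3 : ∀ᶠ p : ℝ × ℝ in 𝓝 (-ε * s₀, 0), p ∈ Metric.ball (-ε * s₀, (0 : ℝ)) δ :=
      Metric.ball_mem_nhds _ hδ0
    filter_upwards [hev2, hev3] with p hp1 hp2 hp0
    obtain ⟨⟨hbt, hregt⟩, hpos, hneg⟩ := hp1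
    obtain ⟨s, t⟩ := p
    simp only at hbt hregt hpos hneg hp0 ⊢
    rw [← ball_prod_same] at hp2
    obtain ⟨hs, ht⟩ := hp2
    simp only [Metric.mem_ball, Real.dist_eq] at hs ht
    obtain ⟨r, rfl⟩ : ∃ r, s = -ε * r := ⟨-ε * s, by linear_combination (-s) * hεR⟩
    have hrI : r ∈ Icc (s₀ - δ) (s₀ + δ) := by
      rw [← mul_sub, abs_mul, abs_neg, hεabs, one_mul, abs_lt] at hs
      exact ⟨by linarith [hs.1], by linarith [hs.2]⟩
    have hanti := h.strictAntiOn_dot_charField_fan hc hball hbt.self_of_nhds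
    obtain ⟨r', hr'I, hr'0⟩ : ∃ r' ∈ Icc (s₀ - δ) (s₀ + δ),
        dot v (charField u (fan c e m n (-ε * r') t)) = 0 :=
      intermediate_value_Icc' (by linarith) (hanti.1.mono hI) ⟨hneg.le, hpos.le⟩
    have hr'pos : 0 < r' := by linarith [hr'I.1]
    obtain ⟨f1, f2, f3⟩ := h.fanContact_eq_zero hc hball hsing hbt hr'pos (hI hr'I).2 hr'0
    suffices hrr : r = r' by
      subst hrr
      exact ⟨f1, (hbt.self_of_nhds r (hI hrI)).1, f3⟩
    -- two zeros of the contact form would enclose a zero of the Jacobian determinant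
    by_contra hne
    have hJt : ∀ q ∈ Icc (s₀ - δ) (s₀ + δ), fanJacobian c e m n (-ε * q) t ≠ 0 := by
      intro q hq
      refine hJd (-ε * q, t) ?_
      rw [← ball_prod_same]
      refine ⟨?_, ?_⟩
      · rw [Metric.mem_ball, Real.dist_eq, ← mul_sub, abs_mul, abs_neg, hεabs, one_mul]
        refine lt_of_le_of_lt ?_ hδd
        rw [abs_le]
        exact ⟨by linarith [hq.1], by linarith [hq.2]⟩
      · rw [Metric.mem_ball, Real.dist_eq]
        exact ht.trans hδd
    have hderiv : ∀ q, HasDerivAt (fun q => fanContact c u e m n (-ε * q) t)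
        (-ε * (2 * fanJacobian c e m n (-ε * q) t)) q := by
      intro q
      have hl : HasDerivAt (fun r : ℝ => -ε * r) (-ε) q := by
        simpa using (hasDerivAt_id q).const_mul (-ε)
      exact (h.hasDerivAt_fanContact hc hregt.1 hregt.2).scomp q hl
    have hε0 : ε ≠ 0 := by rintro rfl; simp at hεabs
    have hrolle : ∀ a b, a ∈ Icc (s₀ - δ) (s₀ + δ) → b ∈ Icc (s₀ - δ) (s₀ + δ) → a < b →
        fanContact c u e m n (-ε * a) t = 0 → fanContact c u e m n (-ε * b) t = 0 → False := by
      intro a b ha hb hab ha0 hb0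
      obtain ⟨q, hq, hq0⟩ := exists_hasDerivAt_eq_zero hab
        (fun q _ => (hderiv q).continuousAt.continuousWithinAt) (ha0.trans hb0.symm)
        (fun q _ => hderiv q)
      have := hJt q ⟨ha.1.trans hq.1.le, hq.2.le.trans hb.2⟩
      exact mul_ne_zero (neg_ne_zero.2 hε0) (mul_ne_zero two_ne_zero this) hq0
    rcases lt_or_gt_of_ne hne with hlt | hlt
    · exact hrolle r r' hrI hr'I hlt hp0 f2
    · exact hrolle r' r hr'I hrI hlt f2 hp0
  -- the inverse function theorem
  set Ψ : ℝ × ℝ → ℝ × ℝ := fun p =>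
    (fanContact c u e m n p.1 p.2, cross v (fan c e m n p.1 p.2 - X₀)) with hΨ
  have hΨsm : ∀ᶠ p : ℝ × ℝ in 𝓝 (-ε * s₀, 0), ContDiffAt ℝ ∞ Ψ p := by
    have := (continuousAt_snd (p := (-ε * s₀, (0 : ℝ)))).eventually hreg_ev
    filter_upwards [this] with p hp
    exact (h.contDiffAt_fanContact (s := p.1) hp.1 hp.2).prodMk
      (ContDiffAt.comp p (contDiff_cross (n := ∞)).contDiffAt
        ((contDiffAt_const (c := v)).prodMk
          ((h.contDiffAt_fan (s := p.1) hp.1 hp.2).sub contDiffAt_const)))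
  have hΨ0 : Ψ (-ε * s₀, 0) = (0, 0) := by
    simp only [hΨ, hcontact0, hfan0, sub_self]
    simp [cross]
  have hΨd := (hΨsm.self_of_nhds.differentiableAt (by norm_num)).hasFDerivAt
  have hd1 : fderiv ℝ Ψ (-ε * s₀, 0) (1, 0) = (2 * fanJacobian c e m n (-ε * s₀) 0, 0) := by
    have h1 : HasDerivAt (fun s : ℝ => (s, (0 : ℝ))) (1, 0) (-ε * s₀) :=
      (hasDerivAt_id _).prodMk (hasDerivAt_const _ _)
    have h2 := hΨd.comp_hasDerivAt (-ε * s₀) h1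
    have h3 := (h.hasDerivAt_fanContact (s := -ε * s₀) hc hreg0.1 hreg0.2).prodMk
      (hasDerivAt_cross (hasDerivAt_const (-ε * s₀) v)
        ((hasDerivAt_fan_time (e := e) (m := m) (n := n) (s := -ε * s₀) (θ := 0) hc).sub_const X₀))
    have h4 := h2.unique h3
    rw [h4, hm0, hend]
    have : w₀ = (-ε) • v := by rw [hw₀, Complex.real_smul]; push_cast; ring
    rw [this, cross_smul_right, cross_self]
    simp [cross]
  have hd2 : (fderiv ℝ Ψ (-ε * s₀, 0) (0, 1)).2 = cross v (fanDeriv c e m n (-ε * s₀) 0) := by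
    have h1 : HasDerivAt (fun t : ℝ => (-ε * s₀, t)) (0, 1) 0 :=
      (hasDerivAt_const _ _).prodMk (hasDerivAt_id _)
    have h2 : HasDerivAt (fun t => (Ψ (-ε * s₀, t)).2) (fderiv ℝ Ψ (-ε * s₀, 0) (0, 1)).2 0 :=
      (ContinuousLinearMap.snd ℝ ℝ ℝ).hasFDerivAt.comp_hasDerivAt 0 (hΨd.comp_hasDerivAt 0 h1)
    have h3 := hasDerivAt_cross (hasDerivAt_const (0 : ℝ) v)
        ((h.hasDerivAt_fan (s := -ε * s₀) hreg0.1 hreg0.2).sub_const X₀)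
    have h4 := h2.unique h3
    rw [h4]
    simp [cross]
  have hJw : fanJacobian c e m n (-ε * s₀) 0 = -ε * cross v (fanDeriv c e m n (-ε * s₀) 0) := by
    rw [fanJacobian, hm0, hend, ← cross_smul_left, hw₀, Complex.real_smul]
    congr 1; push_cast; ring
  obtain ⟨g, hg0, -, hgr, hgsm⟩ := exists_local_inverse (n := ∞) (by norm_num) hΨsm (by
    rintro ⟨x, y⟩ hxy
    have hdec : ((x, y) : ℝ × ℝ) = x • (1, 0) + y • (0, 1) := by ext <;> simp
    rw [hdec, map_add, map_smul, map_smul, hd1] at hxy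
    have h2 := congrArg Prod.snd hxy
    have h1 := congrArg Prod.fst hxy
    simp only [Prod.snd_add, Prod.smul_snd, hd2, Prod.fst_add, Prod.smul_fst, smul_eq_mul, mul_zero,
      zero_add, Prod.snd_zero, Prod.fst_zero] at h1 h2
    have hy : y = 0 := by
      rcases mul_eq_zero.1 h2 with h0 | h0
      · exact h0
      · exact absurd (by rw [hJw, h0, mul_zero]) hJ0
    have hx : x = 0 := by
      rw [hy, zero_mul, add_zero] at h1
      rcases mul_eq_zero.1 h1 with h0 | h0
      · exact h0
      · exact absurd (by linarith) hJ0
    rw [hx, hy]; rfl)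
  rw [hΨ0] at hg0 hgr hgsm
  have hgc : ContinuousAt g (0, 0) := hgsm.self_of_nhds.continuousAt
  have hgt := hgc.tendsto
  rw [hg0] at hgt
  have hι : Tendsto (fun τ : ℝ => ((0 : ℝ), τ)) (𝓝 0) (𝓝 (0, 0)) :=
    (Continuous.prodMk_right (0 : ℝ)).tendsto 0
  have hreg_g := (continuousAt_snd (p := (-ε * s₀, (0 : ℝ)))).eventually hreg_ev
  obtain ⟨δ, hδ, hall⟩ := Metric.eventually_nhds_iff_ball.1 (((hι.eventually hgr).and
    (hι.eventually hgsm)).and (((hgt.comp hι).eventually hkey).and ((hgt.comp hι).eventually hreg_g)))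
  have hmemδ : ∀ {τ : ℝ}, |τ| < δ → τ ∈ Metric.ball (0 : ℝ) δ := fun hτ => by simpa using hτ
  set γ : ℝ → ℂ := fun τ => fan c e m n (g (0, τ)).1 (g (0, τ)).2 with hγ
  have hγfacts : ∀ τ, |τ| < δ → (charField u (γ τ) = 0 ∧ γ τ ∈ Metric.ball X₀ ρ ∧
      u (γ τ) = fanHeight c u e m n (g (0, τ)).1 (g (0, τ)).2) ∧ cross v (γ τ - X₀) = τ := by
    intro τ hτ
    obtain ⟨⟨h1, h2⟩, h3, h4⟩ := hall τ (hmemδ hτ)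
    exact ⟨h3 (congrArg Prod.fst h1), congrArg Prod.snd h1⟩
  refine ⟨ρ, hρ, δ, hδ, γ, fun X hX => (hball X hX).1, fun τ hτ => ?_, fun X hXb hXF hXδ => ?_⟩
  · obtain ⟨⟨h1, h2⟩, h3, h4⟩ := hall τ (hmemδ hτ)
    have hgτ : ContDiffAt ℝ ∞ (fun τ : ℝ => g (0, τ)) τ :=
      ContDiffAt.comp τ (f := fun τ : ℝ => ((0 : ℝ), τ)) h2 (contDiffAt_const.prodMk contDiffAt_id)
    refine ⟨?_, ?_, (hγfacts τ hτ).1.2.1, (hγfacts τ hτ).1.1, (hγfacts τ hτ).2⟩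
    · exact ContDiffAt.comp τ (g := fun p : ℝ × ℝ => fan c e m n p.1 p.2)
        (h.contDiffAt_fan h4.1 h4.2) hgτ
    · have h5 : ContDiffAt ℝ ∞ (fun τ => fanHeight c u e m n (g (0, τ)).1 (g (0, τ)).2) τ :=
        ContDiffAt.comp τ (g := fun p : ℝ × ℝ => fanHeight c u e m n p.1 p.2)
          (h.contDiffAt_fanHeight h4.1 h4.2) hgτ
      refine h5.congr_of_eventuallyEq ?_
      filter_upwards [Metric.isOpen_ball.mem_nhds (hmemδ hτ)] with τ' hτ'
      exact (hγfacts τ' (by simpa using hτ')).1.2.2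
  · obtain ⟨⟨hYF, hYb, -⟩, hYτ⟩ := hγfacts _ hXδ
    set Y := γ (cross v (X - X₀))
    have hXY : X - Y = dot v (X - Y) • v := by
      refine eq_dot_smul_of_cross_eq_zero hv ?_
      simp only [cross, Complex.sub_re, Complex.sub_im] at hYτ ⊢
      linarith
    set d := dot v (X - Y)
    by_contra hne
    have hd0 : d ≠ 0 := by
      intro h0
      rw [h0, zero_smul] at hXY
      exact hne (sub_eq_zero.1 hXY).symm
    have hseg : ∀ q ∈ Icc (0 : ℝ) 1, Y + q • (X - Y) ∈ Metric.ball X₀ ρ := fun q hq =>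
      (convex_ball X₀ ρ).add_smul_sub_mem hYb hXb hq
    have hder : ∀ q ∈ Icc (0 : ℝ) 1, HasDerivAt
        (fun q : ℝ => dot v (charField u (Y + q • (X - Y))))
        (d * dot v (fderiv ℝ (charField u) (Y + q • (X - Y)) v)) q := by
      intro q hq
      have h1 := (h.hasFDerivAt_charField (hball _ (hseg q hq)).1).comp_hasDerivAt q
        (hasDerivAt_line Y (X - Y) q)
      refine (hasDerivAt_dot (hasDerivAt_const q v) h1).congr_deriv ?_
      have h2 : fderiv ℝ (charField u) (Y + q • (X - Y)) (X - Y) =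
          d • fderiv ℝ (charField u) (Y + q • (X - Y)) v := by rw [← map_smul, ← hXY]
      rw [h2, dot_smul_right]
      simp [dot]
    obtain ⟨q, hq, hq0⟩ := exists_hasDerivAt_eq_zero zero_lt_one
      (fun q hq => (hder q hq).continuousAt.continuousWithinAt)
      (by simp [hYF, hXF, dot]) (fun q hq => hder q (Ioo_subset_Icc_self hq))
    have hlt := (hball _ (hseg q (Ioo_subset_Icc_self hq))).2 v (by simpa using hη)
    rcases mul_eq_zero.1 hq0 with h0 | h0
    · exact hd0 h0
    · linarith

end IsCharGraph

/-! ### Surfaces as graphs near singular points -/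

/-- The projection `(x, y, z) ↦ x + i y`. -/
noncomputable def proj : Heis →L[ℝ] ℂ :=
  (Complex.equivRealProdCLM.symm : ℝ × ℝ →L[ℝ] ℂ).comp
    ((ContinuousLinearMap.fst ℝ ℝ (ℝ × ℝ)).prod
      ((ContinuousLinearMap.fst ℝ ℝ ℝ).comp (ContinuousLinearMap.snd ℝ ℝ (ℝ × ℝ))))

@[simp] theorem proj_re (p : Heis) : (proj p).re = p.1 := rfl

@[simp] theorem proj_im (p : Heis) : (proj p).im = p.2.1 := rfl

/-- The point of the graph of `u` over `X`. -/
def graphPt (u : ℂ → ℝ) (X : ℂ) : Heis := (X.re, X.im, u X)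

@[simp] theorem proj_graphPt (u : ℂ → ℝ) (X : ℂ) : proj (graphPt u X) = X := rfl

theorem eq_of_proj_eq {p q : Heis} (h : proj p = proj q) (hz : p.2.2 = q.2.2) : p = q := by
  have h1 := congrArg Complex.re h
  have h2 := congrArg Complex.im h
  simp only [proj_re, proj_im] at h1 h2
  exact Prod.ext h1 (Prod.ext h2 hz)

theorem contactForm_eq (p v : Heis) : contactForm p v = v.2.2 + cross (proj p) (proj v) := by
  simp [contactForm, cross]; ring

theorem contDiffAt_graphPt {n : WithTop ℕ∞} {u : ℂ → ℝ} {X : ℂ} (hu : ContDiffAt ℝ n u X) :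
    ContDiffAt ℝ n (graphPt u) X :=
  Complex.reCLM.contDiff.contDiffAt.prodMk (Complex.imCLM.contDiff.contDiffAt.prodMk hu)

theorem hasDerivAt_graphPt {u : ℂ → ℝ} {γ : ℝ → ℂ} {w : ℂ} {t : ℝ}
    (hu : DifferentiableAt ℝ u (γ t)) (hγ : HasDerivAt γ w t) :
    HasDerivAt (fun s => graphPt u (γ s)) (w.re, w.im, fderiv ℝ u (γ t) w) t :=
  (hasDerivAt_re hγ).prodMk ((hasDerivAt_im hγ).prodMk (hu.hasFDerivAt.comp_hasDerivAt t hγ))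

/-- The implicit function theorem for a level set which is transversal to the `z`-direction. -/
theorem exists_graph_function {n : WithTop ℕ∞} (hn : n ≠ 0) {f : Heis → ℝ} {p : Heis}
    (hf : ∀ᶠ q in 𝓝 p, ContDiffAt ℝ n f q) (hp : f p = 0) (hT : fderiv ℝ f p T ≠ 0) :
    ∃ g : ℂ → ℝ, g (proj p) = p.2.2 ∧ (∀ᶠ X in 𝓝 (proj p), ContDiffAt ℝ n g X) ∧
      ∀ᶠ q in 𝓝 p, (f q = 0 ↔ q.2.2 = g (proj q)) := by
  set Ψ : Heis → Heis := fun q => (q.1, q.2.1, f q) with hΨ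
  have hΨsm : ∀ᶠ q in 𝓝 p, ContDiffAt ℝ n Ψ q := by
    filter_upwards [hf] with q hq
    exact contDiffAt_fst.prodMk ((contDiffAt_fst.comp q contDiffAt_snd).prodMk hq)
  have hfd := (hf.self_of_nhds.differentiableAt hn).hasFDerivAt
  have hd : HasFDerivAt Ψ ((ContinuousLinearMap.fst ℝ ℝ (ℝ × ℝ)).prod
      (((ContinuousLinearMap.fst ℝ ℝ ℝ).comp (ContinuousLinearMap.snd ℝ ℝ (ℝ × ℝ))).prod
        (fderiv ℝ f p))) p :=
    hasFDerivAt_fst.prodMk ((hasFDerivAt_fst.comp p hasFDerivAt_snd).prodMk hfd)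
  have hΨp : Ψ p = (p.1, p.2.1, 0) := by simp only [hΨ, hp]
  obtain ⟨G, hG0, hGl, hGr, hGsm⟩ := exists_local_inverse hn hΨsm (by
    rintro ⟨x, y, z⟩ hq
    rw [hd.fderiv] at hq
    have h1 : x = 0 := congrArg Prod.fst hq
    have h2 : y = 0 := congrArg (fun q : Heis => q.2.1) hq
    have h3 : fderiv ℝ f p (x, y, z) = 0 := congrArg (fun q : Heis => q.2.2) hq
    have h4 : ((x, y, z) : Heis) = z • T := by rw [h1, h2]; simp [T]
    rw [h4, map_smul, smul_eq_mul] at h3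
    rcases mul_eq_zero.1 h3 with h5 | h5
    · rw [h1, h2, h5]; rfl
    · exact absurd h5 hT)
  rw [hΨp] at hG0 hGr hGsm
  have hlift : ContDiff ℝ n (fun X : ℂ => ((X.re, X.im, 0) : Heis)) :=
    Complex.reCLM.contDiff.prodMk (Complex.imCLM.contDiff.prodMk contDiff_const)
  have hliftp : Tendsto (fun X : ℂ => ((X.re, X.im, 0) : Heis)) (𝓝 (proj p))
      (𝓝 (p.1, p.2.1, 0)) := hlift.continuous.tendsto (proj p)
  refine ⟨fun X => (G (X.re, X.im, 0)).2.2, ?_, ?_, ?_⟩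
  · simp only [proj_re, proj_im, hG0]
  · filter_upwards [hliftp.eventually hGsm] with X hX
    have := ContDiffAt.comp X (f := fun X : ℂ => ((X.re, X.im, 0) : Heis)) hX hlift.contDiffAt
    exact this.snd.snd
  · have hpr : Tendsto proj (𝓝 p) (𝓝 (proj p)) := proj.continuous.tendsto p
    filter_upwards [hGl, (hliftp.comp hpr).eventually hGr] with q h1 h2
    simp only [Function.comp, proj_re, proj_im] at h2 ⊢
    constructor
    · intro h0
      have h3 : Ψ q = (q.1, q.2.1, 0) := by simp only [hΨ, h0]
      rw [← h3, h1]
    · intro hz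
      have h3 : (G (q.1, q.2.1, 0)).1 = q.1 := (Prod.ext_iff.1 h2).1
      have h4 : (G (q.1, q.2.1, 0)).2.1 = q.2.1 :=
        (Prod.ext_iff.1 (Prod.ext_iff.1 h2).2).1
      have h5 : f (G (q.1, q.2.1, 0)) = 0 := (Prod.ext_iff.1 (Prod.ext_iff.1 h2).2).2
      have h6 : G (q.1, q.2.1, 0) = q := Prod.ext h3 (Prod.ext h4 hz.symm)
      rwa [h6] at h5

/-- In the open set `W`, the surface `S` is the graph of the `C²` function `u` over the open set
`Ω`. -/
structure IsGraphIn (S W : Set Heis) (Ω : Set ℂ) (u : ℂ → ℝ) : Prop where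
  isOpen : IsOpen W
  isOpen_base : IsOpen Ω
  c2 : ∀ X ∈ Ω, ContDiffAt ℝ 2 u X
  mem_iff : ∀ q, q ∈ S ∩ W ↔ ∃ X ∈ Ω, q = graphPt u X

theorem fderiv_eq_zero_of_mem_tangentPlane {n : WithTop ℕ∞} (hn : n ≠ 0) {S W : Set Heis}
    {f : Heis → ℝ} {p v : Heis} (hW : IsOpen W) (hp : p ∈ W) (hf : ContDiffOn ℝ n f W)
    (hS : S ∩ W = {q ∈ W | f q = 0}) (hv : v ∈ tangentPlane S p) : fderiv ℝ f p v = 0 := by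
  obtain ⟨γ, h0, hd, hev⟩ := hv
  have hfp : HasFDerivAt f (fderiv ℝ f p) (γ 0) := by
    rw [h0]
    exact ((hf.contDiffAt (hW.mem_nhds hp)).differentiableAt hn).hasFDerivAt
  have h1 := hfp.comp_hasDerivAt 0 hd
  have h2 : f ∘ γ =ᶠ[𝓝 0] fun _ => 0 := by
    have h3 : ∀ᶠ t in 𝓝 (0 : ℝ), γ t ∈ W :=
      hd.continuousAt.eventually (hW.mem_nhds (by rwa [h0]))
    filter_upwards [hev, h3] with t ht1 ht2
    have : γ t ∈ S ∩ W := ⟨ht1, ht2⟩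
    rw [hS] at this
    exact this.2
  exact (h1.congr_of_eventuallyEq h2.symm).unique (hasDerivAt_const (0 : ℝ) (0 : ℝ))

/-- Near a singular point, a surface is a graph. -/
theorem exists_isGraphIn {S : Set Heis} (hS : IsSurface S) {p : Heis} (hp : p ∈ singularSet S) :
    ∃ W Ω u, IsGraphIn S W Ω u ∧ p ∈ W ∧ proj p ∈ Ω ∧ graphPt u (proj p) = p := by
  obtain ⟨W₀, f, hW₀, hpW, hf, hdf, hSW⟩ := hS.c2 p hp.1
  have hfp : f p = 0 := by
    have : p ∈ S ∩ W₀ := ⟨hp.1, hpW⟩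
    rw [hSW] at this
    exact this.2
  have hT : fderiv ℝ f p T ≠ 0 := by
    intro h0
    apply hdf
    refine ContinuousLinearMap.ext fun v => ?_
    have h1 : v - contactForm p v • T ∈ tangentPlane S p := by
      rw [hp.2]
      simp [contactPlane, contactForm, T]
      ring
    have h2 := fderiv_eq_zero_of_mem_tangentPlane (by norm_num) hW₀ hpW hf hSW h1
    rw [map_sub, map_smul, h0, smul_zero, sub_zero] at h2
    simpa using h2
  have hfev : ∀ᶠ q in 𝓝 p, ContDiffAt ℝ 2 f q := by
    filter_upwards [hW₀.mem_nhds hpW] with q hq using hf.contDiffAt (hW₀.mem_nhds hq)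
  obtain ⟨u, hup, husm, hiff⟩ := exists_graph_function (by norm_num) hfev hfp hT
  obtain ⟨W₁, hW₁, hW₁o, hpW₁⟩ := eventually_nhds_iff.1 (hiff.and (hW₀.mem_nhds hpW))
  obtain ⟨Ω₁, hΩ₁, hΩ₁o, hpΩ₁⟩ := eventually_nhds_iff.1 husm
  have hgr : graphPt u (proj p) = p := eq_of_proj_eq rfl hup
  have hcont : ContinuousOn (graphPt u) Ω₁ := fun X hX =>
    (contDiffAt_graphPt (hΩ₁ X hX)).continuousAt.continuousWithinAt
  refine ⟨W₁ ∩ proj ⁻¹' Ω₁, Ω₁ ∩ graphPt u ⁻¹' W₁, u,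
    ⟨hW₁o.inter (hΩ₁o.preimage proj.continuous), hcont.isOpen_inter_preimage hΩ₁o hW₁o,
      fun X hX => hΩ₁ X hX.1, fun q => ?_⟩, ⟨hpW₁, hpΩ₁⟩, ⟨hpΩ₁, by rwa [mem_preimage, hgr]⟩, hgr⟩
  constructor
  · rintro ⟨hqS, hqW, hqΩ⟩
    have h1 : q ∈ S ∩ W₀ := ⟨hqS, (hW₁ q hqW).2⟩
    rw [hSW] at h1
    have h2 : q = graphPt u (proj q) := eq_of_proj_eq rfl ((hW₁ q hqW).1.1 h1.2)
    exact ⟨proj q, ⟨hqΩ, by rwa [mem_preimage, ← h2]⟩, h2⟩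
  · rintro ⟨X, ⟨hX1, hX2⟩, rfl⟩
    have h1 : graphPt u X ∈ S ∩ W₀ := by
      rw [hSW]
      exact ⟨(hW₁ _ hX2).2, (hW₁ _ hX2).1.2 rfl⟩
    exact ⟨h1.1, hX2, hX1⟩

namespace IsGraphIn

variable {S W : Set Heis} {Ω : Set ℂ} {u : ℂ → ℝ} {X : ℂ}

theorem graphPt_mem (hG : IsGraphIn S W Ω u) (hX : X ∈ Ω) : graphPt u X ∈ S ∩ W :=
  (hG.mem_iff _).2 ⟨X, hX, rfl⟩

theorem differentiableAt (hG : IsGraphIn S W Ω u) (hX : X ∈ Ω) : DifferentiableAt ℝ u X :=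
  (hG.c2 X hX).differentiableAt (by norm_num)

theorem eq_graphPt (hG : IsGraphIn S W Ω u) {q : Heis} (hq : q ∈ S ∩ W) :
    proj q ∈ Ω ∧ q = graphPt u (proj q) := by
  obtain ⟨X, hX, rfl⟩ := (hG.mem_iff q).1 hq
  exact ⟨hX, rfl⟩

theorem mem_tangentPlane_iff (hG : IsGraphIn S W Ω u) (hX : X ∈ Ω) {v : Heis} :
    v ∈ tangentPlane S (graphPt u X) ↔ v.2.2 = fderiv ℝ u X (proj v) := by
  constructor
  · rintro ⟨γ, h0, hd, hev⟩
    have h1 : ∀ᶠ t in 𝓝 (0 : ℝ), γ t ∈ W :=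
      hd.continuousAt.eventually (hG.isOpen.mem_nhds (by rw [h0]; exact (hG.graphPt_mem hX).2))
    have h2 : (fun t => (γ t).2.2) =ᶠ[𝓝 0] fun t => u (proj (γ t)) := by
      filter_upwards [hev, h1] with t ht1 ht2
      have := (hG.eq_graphPt ⟨ht1, ht2⟩).2
      conv_lhs => rw [this]
      rfl
    have h3 : HasDerivAt (fun t => (γ t).2.2) v.2.2 0 :=
      ((ContinuousLinearMap.snd ℝ ℝ ℝ).comp
        (ContinuousLinearMap.snd ℝ ℝ (ℝ × ℝ))).hasFDerivAt.comp_hasDerivAt 0 hd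
    have h4 : HasDerivAt (fun t => proj (γ t)) (proj v) 0 :=
      proj.hasFDerivAt.comp_hasDerivAt 0 hd
    have h5 : HasFDerivAt u (fderiv ℝ u X) (proj (γ 0)) := by
      rw [h0, proj_graphPt]
      exact (hG.differentiableAt hX).hasFDerivAt
    exact (h3.congr_of_eventuallyEq h2.symm).unique (h5.comp_hasDerivAt 0 h4)
  · intro hv
    have hl : HasDerivAt (fun t : ℝ => X + t • proj v) (proj v) 0 :=
      IsCharGraph.hasDerivAt_line X (proj v) 0
    have hl0 : X + (0 : ℝ) • proj v = X := by simp
    refine ⟨fun t => graphPt u (X + t • proj v), by simp, ?_, ?_⟩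
    · refine (hasDerivAt_graphPt (by rw [hl0]; exact hG.differentiableAt hX) hl).congr_deriv ?_
      rw [hl0, ← hv]; rfl
    · have : ∀ᶠ t in 𝓝 (0 : ℝ), X + t • proj v ∈ Ω :=
        hl.continuousAt.eventually (hG.isOpen_base.mem_nhds (by simpa using hX))
      filter_upwards [this] with t ht using (hG.graphPt_mem ht).1

theorem mem_contactPlane_iff {v : Heis} :
    v ∈ contactPlane (graphPt u X) ↔ v.2.2 = -cross X (proj v) := by
  rw [contactPlane, mem_ofPred_eq, contactForm_eq, proj_graphPt]
  constructor <;> intro h <;> linarith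

theorem mem_singularSet_iff (hG : IsGraphIn S W Ω u) (hX : X ∈ Ω) :
    graphPt u X ∈ singularSet S ↔ charField u X = 0 := by
  constructor
  · rintro ⟨-, heq⟩
    have key : ∀ w : ℂ, cross (charField u X) w = 0 := by
      intro w
      have h1 : ((w.re, w.im, -cross X w) : Heis) ∈ contactPlane (graphPt u X) :=
        mem_contactPlane_iff.2 rfl
      rw [← heq, hG.mem_tangentPlane_iff hX, fderiv_eq_cross] at h1
      have h2 : proj ((w.re, w.im, -cross X w) : Heis) = w := rfl
      rw [h2] at h1
      simp only at h1
      linarith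
    have h1 := key Complex.I
    have h2 := key 1
    simp [cross] at h1 h2
    exact Complex.ext h1 h2
  · intro h0
    refine ⟨(hG.graphPt_mem hX).1, ?_⟩
    ext v
    rw [hG.mem_tangentPlane_iff hX, mem_contactPlane_iff, fderiv_eq_cross, h0]
    simp [cross]

theorem mem_regularPart_iff (hG : IsGraphIn S W Ω u) (hX : X ∈ Ω) :
    graphPt u X ∈ regularPart S ↔ charField u X ≠ 0 := by
  rw [regularPart, Set.mem_sdiff, hG.mem_singularSet_iff hX]
  exact and_iff_right (hG.graphPt_mem hX).1

theorem contDiffAt_of_regular (hG : IsGraphIn S W Ω u) (hS : IsSurface S) (hX : X ∈ Ω)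
    (hF : charField u X ≠ 0) : ContDiffAt ℝ ∞ u X := by
  obtain ⟨W₀, f, hW₀, hpW, hf, hdf, hSW⟩ := hS.smooth _ ((hG.mem_regularPart_iff hX).2 hF)
  have hfp : f (graphPt u X) = 0 := by
    have : graphPt u X ∈ S ∩ W₀ := ⟨(hG.graphPt_mem hX).1, hpW⟩
    rw [hSW] at this
    exact this.2
  have hT : fderiv ℝ f (graphPt u X) T ≠ 0 := by
    intro h0
    apply hdf
    refine ContinuousLinearMap.ext fun v => ?_
    set r := v.2.2 - fderiv ℝ u X (proj v)
    have hpr : proj (v - r • T) = proj v := by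
      rw [map_sub, map_smul]
      have : proj T = 0 := by apply Complex.ext <;> simp [T]
      rw [this, smul_zero, sub_zero]
    have h1 : v - r • T ∈ tangentPlane S (graphPt u X) := by
      rw [hG.mem_tangentPlane_iff hX, hpr]
      simp [T, r]
    have h2 := fderiv_eq_zero_of_mem_tangentPlane (by norm_num) hW₀ hpW hf hSW h1
    rw [map_sub, map_smul, h0, smul_zero, sub_zero] at h2
    simpa using h2
  have hfev : ∀ᶠ q in 𝓝 (graphPt u X), ContDiffAt ℝ ∞ f q := by
    filter_upwards [hW₀.mem_nhds hpW] with q hq using hf.contDiffAt (hW₀.mem_nhds hq)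
  obtain ⟨g, -, hgsm, hiff⟩ := exists_graph_function (by norm_num) hfev hfp hT
  refine hgsm.self_of_nhds.congr_of_eventuallyEq ?_
  have hc : Tendsto (graphPt u) (𝓝 X) (𝓝 (graphPt u X)) :=
    (contDiffAt_graphPt (hG.c2 X hX)).continuousAt
  filter_upwards [hc.eventually hiff, hc.eventually (hW₀.mem_nhds hpW),
    hG.isOpen_base.mem_nhds hX] with Y h1 h2 h3
  have h4 : graphPt u Y ∈ S ∩ W₀ := ⟨(hG.graphPt_mem h3).1, h2⟩
  rw [hSW] at h4
  exact h1.1 h4.2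

theorem charField_continuousAt (hG : IsGraphIn S W Ω u) (hX : X ∈ Ω) :
    ContinuousAt (charField u) X :=
  (contDiffAt_charField (m := 1) (hG.c2 X hX) (by norm_num)).continuousAt

/-- Over the regular part, the characteristic field is determined by its projection. -/
theorem charField_eq_of_proj (hG : IsGraphIn S W Ω u) {e₁ : Heis → Heis}
    (he₁ : IsCharacteristicField S e₁) (hX : X ∈ Ω) (hF : charField u X ≠ 0) :
    e₁ (graphPt u X) = ((proj (e₁ (graphPt u X))).re, (proj (e₁ (graphPt u X))).im,
      fderiv ℝ u X (proj (e₁ (graphPt u X)))) := by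
  have := (hG.mem_tangentPlane_iff hX).1 (he₁.tangent _ ((hG.mem_regularPart_iff hX).2 hF))
  rw [← this]; rfl

/-- A surface of constant `p`-mean curvature near a singular point, in terms of its projection. -/
theorem isCharGraph (hG : IsGraphIn S W Ω u) (hS : IsSurface S) {e₁ : Heis → Heis}
    (he₁ : IsCharacteristicField S e₁) {c : ℝ} (hH : HasConstPMeanCurvature S e₁ c) :
    IsCharGraph c Ω u (fun X => proj (e₁ (graphPt u X))) := by
  have hev : ∀ X ∈ Ω, charField u X ≠ 0 → ∀ᶠ Y in 𝓝 X, Y ∈ Ω ∧ charField u Y ≠ 0 :=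
    fun X hX hF => (hG.isOpen_base.eventually_mem hX).and
      ((hG.charField_continuousAt hX).eventually_ne hF)
  have hsm : ∀ X ∈ Ω, charField u X ≠ 0 →
      ContDiffAt ℝ ∞ (fun X => proj (e₁ (graphPt u X))) X := by
    intro X hX hF
    have hopen : IsOpen {Y | Y ∈ Ω ∧ charField u Y ≠ 0} :=
      isOpen_iff_mem_nhds.2 fun Y hY => hev Y hY.1 hY.2
    have h1 : ContDiffOn ℝ ∞ (graphPt u) {Y | Y ∈ Ω ∧ charField u Y ≠ 0} := fun Y hY =>
      (contDiffAt_graphPt (hG.contDiffAt_of_regular hS hY.1 hY.2)).contDiffWithinAt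
    have h2 : ContDiffOn ℝ ∞ (fun Y => e₁ (graphPt u Y)) {Y | Y ∈ Ω ∧ charField u Y ≠ 0} :=
      he₁.smooth.comp h1 fun Y hY => (hG.mem_regularPart_iff hY.1).2 hY.2
    exact (proj.contDiff.comp_contDiffOn h2).contDiffAt (hopen.mem_nhds ⟨hX, hF⟩)
  have htan : ∀ X ∈ Ω, charField u X ≠ 0 → (e₁ (graphPt u X)).2.2 =
      fderiv ℝ u X (proj (e₁ (graphPt u X))) := fun X hX hF =>
    (hG.mem_tangentPlane_iff hX).1 (he₁.tangent _ ((hG.mem_regularPart_iff hX).2 hF))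
  refine ⟨hG.isOpen_base, hG.c2, fun X hX hF => hG.contDiffAt_of_regular hS hX hF, hsm,
    fun X hX hF => ?_, fun X hX hF => ?_, fun X hX hF => ?_⟩
  · have h1 := he₁.unit _ ((hG.mem_regularPart_iff hX).2 hF)
    have h2 : contactForm (graphPt u X) (e₁ (graphPt u X)) = 0 :=
      he₁.horizontal _ ((hG.mem_regularPart_iff hX).2 hF)
    rw [metric, h2, mul_zero, add_zero] at h1
    have h3 : ‖proj (e₁ (graphPt u X))‖ ^ 2 = 1 := by rw [← dot_self]; exact h1
    have h4 := norm_nonneg (proj (e₁ (graphPt u X)))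
    nlinarith
  · have h1 := mem_contactPlane_iff.1 (he₁.horizontal _ ((hG.mem_regularPart_iff hX).2 hF))
    have h2 := htan X hX hF
    rw [fderiv_eq_cross] at h2
    linarith
  · set e : ℂ → ℂ := fun X => proj (e₁ (graphPt u X)) with he
    have hl : HasDerivAt (fun t : ℝ => X + t • e X) (e X) 0 :=
      IsCharGraph.hasDerivAt_line X (e X) 0
    have hl0 : X + (0 : ℝ) • e X = X := by simp
    have hcov := hH _ ((hG.mem_regularPart_iff hX).2 hF) (fun t => graphPt u (X + t • e X))
      (by simp) (by
        refine (hasDerivAt_graphPt (by rw [hl0]; exact hG.differentiableAt hX) hl).congr_deriv ?_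
        rw [hl0]
        exact (hG.charField_eq_of_proj he₁ hX hF).symm)
      (by
        have h1 : ∀ᶠ t in 𝓝 (0 : ℝ), X + t • e X ∈ Ω ∧ charField u (X + t • e X) ≠ 0 :=
          hl.continuousAt.eventually (by simpa only [zero_smul, add_zero] using hev X hX hF)
        filter_upwards [h1] with t ht using (hG.mem_regularPart_iff ht.1).2 ht.2)
    have hd : HasDerivAt (fun t : ℝ => e (X + t • e X)) (fderiv ℝ e X (e X)) 0 := by
      have : HasFDerivAt e (fderiv ℝ e X) (X + (0 : ℝ) • e X) := by
        rw [hl0]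
        exact ((hsm X hX hF).differentiableAt (by norm_num)).hasFDerivAt
      exact this.comp_hasDerivAt 0 hl
    have h1 : HasDerivAt (fun t : ℝ => -(e (X + t • e X)).im) (-c * (e X).re) 0 := by
      have := (ContinuousLinearMap.fst ℝ ℝ (ℝ × ℝ)).hasFDerivAt.comp_hasDerivAt 0 hcov
      refine (this.congr_of_eventuallyEq (Eventually.of_forall fun t => ?_))
      simp [frameCoord, J, E₁, E₂, he]
    have h2 : HasDerivAt (fun t : ℝ => (e (X + t • e X)).re) (-c * (e X).im) 0 := by
      have := ((ContinuousLinearMap.fst ℝ ℝ ℝ).comp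
        (ContinuousLinearMap.snd ℝ ℝ (ℝ × ℝ))).hasFDerivAt.comp_hasDerivAt 0 hcov
      refine (this.congr_of_eventuallyEq (Eventually.of_forall fun t => ?_))
      simp [frameCoord, J, E₁, E₂, he]
    have h3 := (hasDerivAt_im hd).neg.unique h1
    have h4 := (hasDerivAt_re hd).unique h2
    apply Complex.ext
    · rw [h4]; simp [he]
    · have : (fderiv ℝ e X (e X)).im = c * (e X).re := by linarith
      rw [this]; simp [he]

end IsGraphIn

/-! ### The dichotomy for the singular set -/

/-- A diffeomorphism from `ℝ` onto a symmetric bounded interval. -/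
theorem exists_diffeo_Ioo {δ : ℝ} (hδ : 0 < δ) :
    ∃ ι : ℝ → ℝ, ContDiff ℝ ∞ ι ∧ (∀ t, deriv ι t ≠ 0) ∧ IsEmbedding ι ∧
      range ι = Ioo (-δ) δ := by
  set k := δ * (2 / Real.pi) with hk
  have hpi := Real.pi_pos
  have hk0 : 0 < k := by positivity
  have hkd : k * (Real.pi / 2) = δ := by rw [hk]; field_simp
  have hmono : StrictMono fun t => k * Real.arctan t :=
    fun a b hab => mul_lt_mul_of_pos_left (Real.arctan_strictMono hab) hk0
  have hrange : range (fun t => k * Real.arctan t) = Ioo (-δ) δ := by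
    ext τ
    constructor
    · rintro ⟨t, rfl⟩
      have h1 := mul_lt_mul_of_pos_left (Real.arctan_lt_pi_div_two t) hk0
      have h2 := mul_lt_mul_of_pos_left (Real.neg_pi_div_two_lt_arctan t) hk0
      rw [mul_neg] at h2
      exact ⟨by linarith, by linarith⟩
    · rintro ⟨h1, h2⟩
      have h3 : τ / k < Real.pi / 2 := by rw [div_lt_iff₀ hk0]; linarith
      have h4 : -(Real.pi / 2) < τ / k := by rw [lt_div_iff₀ hk0]; linarith
      refine ⟨Real.tan (τ / k), ?_⟩
      simp only [Real.arctan_tan h4 h3]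
      field_simp
  refine ⟨fun t => k * Real.arctan t, contDiff_const.mul Real.contDiff_arctan, fun t => ?_,
    hmono.isEmbedding_of_ordConnected ?_, hrange⟩
  · rw [((Real.hasDerivAt_arctan t).const_mul k).deriv]
    positivity
  · rw [hrange]
    exact ordConnected_Ioo

theorem IsSmoothCurveNear.not_isIsolatedIn {A : Set Heis} {q : Heis}
    (h : IsSmoothCurveNear A q) : ¬ IsIsolatedIn A q := by
  rintro ⟨W', hW', hA⟩
  obtain ⟨hq, W, γ, hW, hqW, hγ, -, hemb, hrange⟩ := h
  have hqr : q ∈ range γ := by rw [hrange]; exact ⟨hq, hqW⟩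
  obtain ⟨t, rfl⟩ := hqr
  have hqW' : γ t ∈ W' := by
    have : γ t ∈ A ∩ W' := by rw [hA]; rfl
    exact this.2
  have h1 : ∀ᶠ s in 𝓝[≠] t, γ s ∈ W' :=
    (hγ.continuous.continuousAt.eventually (hW'.mem_nhds hqW')).filter_mono nhdsWithin_le_nhds
  obtain ⟨s, hs, hne⟩ := (h1.and self_mem_nhdsWithin).exists
  have h2 : γ s ∈ A ∩ W := by rw [← hrange]; exact mem_range_self s
  have h3 : γ s ∈ A ∩ W' := ⟨h2.1, hs⟩
  rw [hA] at h3
  exact hne (hemb.injective h3)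

/-- An isolated point is a connected component by itself. -/
theorem IsIsolatedIn.eq_of_mem_connectedComponentIn {A : Set Heis} {p q : Heis} (hp : p ∈ A)
    (hq : q ∈ connectedComponentIn A p) (h : IsIsolatedIn A q) : p = q := by
  obtain ⟨W, hW, hA⟩ := h
  by_contra hne
  have hqW : q ∈ W := by
    have : q ∈ A ∩ W := by rw [hA]; rfl
    exact this.2
  have hsub : ∀ x ∈ A, x ∈ W → x = q := fun x hx hxW => by
    have : x ∈ A ∩ W := ⟨hx, hxW⟩
    rwa [hA] at this
  obtain ⟨x, hx, hxW, hxq⟩ := isPreconnected_connectedComponentIn W {q}ᶜ hW isOpen_compl_singleton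
    (fun x hx => by
      by_cases h : x = q
      · left; rwa [h]
      · right; exact h)
    ⟨q, hq, hqW⟩ ⟨p, mem_connectedComponentIn hp, hne⟩
  exact hxq (hsub x (connectedComponentIn_subset _ _ hx) hxW)

/-- If the linearization at a singular point is `-1`, then `charField` is close to the radial field
`X₀ - X`. -/
theorem IsCharGraph.exists_ball_norm_charField_add_le {c : ℝ} {Ω : Set ℂ} {u : ℂ → ℝ} {e : ℂ → ℂ}
    (h : IsCharGraph c Ω u e) {X₀ : ℂ} (hX : X₀ ∈ Ω) (hF : charField u X₀ = 0)
    (hM : ∀ w, fderiv ℝ (charField u) X₀ w = -w) :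
    ∃ ρ > 0, ∀ X ∈ Metric.ball X₀ ρ, X ∈ Ω ∧ ‖charField u X + (X - X₀)‖ ≤ 1 / 2 * ‖X - X₀‖ := by
  have hlo := (h.hasFDerivAt_charField hX).isLittleO.def (c := 1 / 2) (by norm_num)
  obtain ⟨ρ, hρ, hb⟩ := Metric.eventually_nhds_iff_ball.1 (hlo.and (h.isOpen.eventually_mem hX))
  refine ⟨ρ, hρ, fun X hXb => ⟨(hb X hXb).2, ?_⟩⟩
  have := (hb X hXb).1
  rwa [hF, hM, sub_zero, sub_neg_eq_add] at this

theorem charField_ne_zero_of_norm_add_le {u : ℂ → ℝ} {X₀ X : ℂ}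
    (h : ‖charField u X + (X - X₀)‖ ≤ 1 / 2 * ‖X - X₀‖) (hX : X ≠ X₀) : charField u X ≠ 0 := by
  intro h0
  rw [h0, zero_add] at h
  have := norm_pos_iff.2 (sub_ne_zero.2 hX)
  linarith

namespace IsGraphIn

variable {S W : Set Heis} {Ω : Set ℂ} {u : ℂ → ℝ} {X : ℂ}

theorem isIsolatedIn_singularSet (hG : IsGraphIn S W Ω u) {c : ℝ} {e : ℂ → ℂ}
    (h : IsCharGraph c Ω u e) (hX : X ∈ Ω) (hF : charField u X = 0)
    (hM : ∀ w, fderiv ℝ (charField u) X w = -w) : IsIsolatedIn (singularSet S) (graphPt u X) := by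
  obtain ⟨ρ, hρ, hb⟩ := h.exists_ball_norm_charField_add_le hX hF hM
  refine ⟨W ∩ proj ⁻¹' Metric.ball X ρ,
    hG.isOpen.inter (Metric.isOpen_ball.preimage proj.continuous), Subset.antisymm ?_ ?_⟩
  · rintro q ⟨hq, hqW, hqb⟩
    obtain ⟨hqΩ, hqe⟩ := hG.eq_graphPt ⟨hq.1, hqW⟩
    rw [hqe, hG.mem_singularSet_iff hqΩ] at hq
    rw [mem_singleton_iff, hqe]
    by_contra hne
    exact charField_ne_zero_of_norm_add_le (hb _ hqb).2 (fun h0 => hne (by rw [h0])) hq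
  · rintro q rfl
    exact ⟨(hG.mem_singularSet_iff hX).2 hF, (hG.graphPt_mem hX).2, by simpa using hρ⟩

theorem isSmoothCurveNear_singularSet (hG : IsGraphIn S W Ω u) {c : ℝ} (hc : c ≠ 0) {e : ℂ → ℂ}
    (h : IsCharGraph c Ω u e) (hX : X ∈ Ω) (hF : charField u X = 0) {v : ℂ} (hv : ‖v‖ = 1)
    (hv2 : fderiv ℝ (charField u) X v = (-2 : ℝ) • v)
    (hrange : ∀ w, cross v (fderiv ℝ (charField u) X w) = 0) :
    IsSmoothCurveNear (singularSet S) (graphPt u X) := by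
  obtain ⟨ρ, hρ, δ, hδ, γ, hbΩ, hγ, hγu⟩ := h.exists_smooth_singular_curve hc hX hF hv hv2 hrange
  obtain ⟨ι, hι, hι0, hιe, hιr⟩ := exists_diffeo_Ioo hδ
  have hιδ : ∀ t, |ι t| < δ := fun t => abs_lt.2 (by
    have := mem_range_self (f := ι) t
    rwa [hιr] at this)
  -- the parameter of the curve is recovered by the linear coordinate `G`
  set G : Heis → ℝ := fun q => cross v (proj q - X) with hGd
  have hGc : Continuous G := by
    have hcc : Continuous (fun p : ℂ × ℂ => cross p.1 p.2) := (contDiff_cross (n := 0)).continuous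
    exact hcc.comp (continuous_const.prodMk (proj.continuous.sub continuous_const))
  have hGΓ : ∀ t, G (graphPt u (γ (ι t))) = ι t := fun t => (hγ _ (hιδ t)).2.2.2.2
  have hΓ : ContDiff ℝ ∞ fun t => graphPt u (γ (ι t)) := by
    refine contDiff_iff_contDiffAt.2 fun t => ?_
    have h1 : ContDiffAt ℝ ∞ (fun τ => graphPt u (γ τ)) (ι t) := by
      obtain ⟨a1, a2, -⟩ := hγ _ (hιδ t)
      exact (Complex.reCLM.contDiff.contDiffAt.comp _ a1).prodMk
        ((Complex.imCLM.contDiff.contDiffAt.comp _ a1).prodMk a2)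
    exact ContDiffAt.comp t h1 hι.contDiffAt
  refine ⟨(hG.mem_singularSet_iff hX).2 hF, W ∩ (proj ⁻¹' Metric.ball X ρ ∩ G ⁻¹' Ioo (-δ) δ),
    fun t => graphPt u (γ (ι t)), hG.isOpen.inter ((Metric.isOpen_ball.preimage
      proj.continuous).inter (isOpen_Ioo.preimage hGc)),
    ⟨(hG.graphPt_mem hX).2, by simpa using hρ, by
      simp only [mem_preimage, hGd, proj_graphPt, sub_self]
      simpa [cross] using hδ⟩, hΓ, fun t h0 => ?_,
    ?_, ?_⟩
  · have hd := ((hΓ.differentiable (by norm_num)) t).hasDerivAt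
    rw [h0] at hd
    have h1 : HasDerivAt (fun t => proj (graphPt u (γ (ι t))) - X) (proj 0 - 0) t :=
      (proj.hasFDerivAt.comp_hasDerivAt t hd).sub (hasDerivAt_const t X)
    have h2 := hasDerivAt_cross (hasDerivAt_const t v) h1
    have h3 : HasDerivAt ι 0 t :=
      (h2.congr_of_eventuallyEq (Eventually.of_forall fun s => (hGΓ s).symm)).congr_deriv
        (by simp [cross])
    exact hι0 t h3.deriv
  · refine IsEmbedding.of_comp hΓ.continuous hGc ?_
    have : G ∘ (fun t => graphPt u (γ (ι t))) = ι := funext hGΓ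
    rwa [this]
  · ext q
    constructor
    · rintro ⟨t, rfl⟩
      obtain ⟨-, -, a3, a4, a5⟩ := hγ _ (hιδ t)
      refine ⟨(hG.mem_singularSet_iff (hbΩ a3)).2 a4, (hG.graphPt_mem (hbΩ a3)).2, a3, ?_⟩
      rw [mem_preimage, hGΓ]
      exact abs_lt.1 (hιδ t)
    · rintro ⟨hq, hqW, hqb, hqδ⟩
      obtain ⟨hqΩ, hqe⟩ := hG.eq_graphPt ⟨hq.1, hqW⟩
      have hq0 : charField u (proj q) = 0 := by
        rwa [hqe, hG.mem_singularSet_iff hqΩ] at hq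
      have hqr : G q ∈ range ι := by rw [hιr]; exact hqδ
      obtain ⟨t, ht⟩ := hqr
      refine ⟨t, ?_⟩
      have := hγu _ hqb hq0 (abs_lt.2 hqδ)
      simp only [ht, hGd, this]
      exact hqe.symm

end IsGraphIn

/-- Near a singular point, the surface is a graph for which the linearization of `charField` is
either `-1`, and the point is isolated, or of rank one, and the singular set is a smooth curve. -/
theorem exists_isGraphIn_dichotomy {S : Set Heis} (hS : IsSurface S) {e₁ : Heis → Heis}
    (he₁ : IsCharacteristicField S e₁) {c : ℝ} (hc : c ≠ 0) (hH : HasConstPMeanCurvature S e₁ c)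
    {p : Heis} (hp : p ∈ singularSet S) :
    IsSmoothCurveNear (singularSet S) p ∨ (IsIsolatedIn (singularSet S) p ∧
      ∃ W Ω u, IsGraphIn S W Ω u ∧ proj p ∈ Ω ∧ graphPt u (proj p) = p ∧
        IsCharGraph c Ω u (fun X => proj (e₁ (graphPt u X))) ∧ charField u (proj p) = 0 ∧
        ∀ w, fderiv ℝ (charField u) (proj p) w = -w) := by
  obtain ⟨W, Ω, u, hG, -, hpΩ, hgr⟩ := exists_isGraphIn hS hp
  have h := hG.isCharGraph hS he₁ hH
  have hF : charField u (proj p) = 0 := by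
    rw [← hG.mem_singularSet_iff hpΩ, hgr]; exact hp
  rcases h.linearization_dichotomy hpΩ hF with hM | ⟨v, hv, hv2, hr⟩
  · have := hG.isIsolatedIn_singularSet h hpΩ hF hM
    rw [hgr] at this
    exact Or.inr ⟨this, W, Ω, u, hG, hpΩ, hgr, h, hF, hM⟩
  · have := hG.isSmoothCurveNear_singularSet hc h hpΩ hF hv hv2 hr
    rw [hgr] at this
    exact Or.inl this

theorem isolated_or_smooth_component {S : Set Heis} (hS : IsSurface S) {e₁ : Heis → Heis}
    (he₁ : IsCharacteristicField S e₁) {c : ℝ} (hc : c ≠ 0) (hH : HasConstPMeanCurvature S e₁ c)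
    {p : Heis} (hp : p ∈ singularSet S) :
    IsIsolatedIn (singularSet S) p ∨
      ∀ q ∈ connectedComponentIn (singularSet S) p, IsSmoothCurveNear (singularSet S) q := by
  refine or_iff_not_imp_left.2 fun hni q hq => ?_
  rcases exists_isGraphIn_dichotomy hS he₁ hc hH (connectedComponentIn_subset _ _ hq) with h1 | h1
  · exact h1
  · exact absurd (h1.1.eq_of_mem_connectedComponentIn hp hq ▸ h1.1) hni

/-! ### Leaves through a point and the Pansu sphere -/

/-- The left translate by `p` of the horizontal lift through the origin of the circle
`σ ↦ w * arc c σ`. -/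
noncomputable def leafPt (c : ℝ) (p : Heis) (w : ℂ) (σ : ℝ) : Heis :=
  op p ((w * arc c σ).re, (w * arc c σ).im, Real.sin (c * σ) / c ^ 2 - σ / c)

theorem proj_leafPt (c : ℝ) (p : Heis) (w : ℂ) (σ : ℝ) :
    proj (leafPt c p w σ) = proj p + w * arc c σ := by
  apply Complex.ext <;> simp [leafPt, op]

theorem leafPt_height (c : ℝ) (p : Heis) (w : ℂ) (σ : ℝ) : (leafPt c p w σ).2.2 =
    p.2.2 - cross (proj p) (w * arc c σ) - σ / c + Real.sin (c * σ) / c ^ 2 := by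
  simp only [leafPt, op, cross, proj_re, proj_im]; ring

theorem leafPt_zero (c : ℝ) (p : Heis) (w : ℂ) : leafPt c p w 0 = p := by
  refine eq_of_proj_eq ?_ ?_
  · rw [proj_leafPt, arc_zero, mul_zero, add_zero]
  · rw [leafPt_height, arc_zero]; simp [cross]

theorem exists_eq_rot {w : ℂ} (hw : ‖w‖ = 1) : ∃ θ : ℝ, w = rot 1 θ := by
  obtain ⟨θ, rfl⟩ := (Complex.norm_eq_one_iff w).1 hw
  exact ⟨θ, by apply Complex.ext <;> simp [rot, Complex.exp_ofReal_mul_I_re,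
    Complex.exp_ofReal_mul_I_im]⟩

/-- A sign `κ` selects the pole; `ς` is the sign of `c`. -/
theorem op_pansuParam {c : ℝ} (hc : c ≠ 0) {κ ς : ℝ} (hκ : κ = 1 ∨ κ = -1) (hς : ς * c = |c|)
    (p : Heis) {s τ θ : ℝ} (hs : |c| * s = c * τ + (1 - κ) * Real.pi) :
    op (p.1, p.2.1, p.2.2 - κ * (Real.pi / c ^ 2)) (pansuParam (|c| / 2) s θ) =
      leafPt c p (ς * rot 1 θ) τ := by
  have hc' : |c| ≠ 0 := abs_ne_zero.2 hc
  have h2 : 2 * (|c| / 2) = |c| := by ring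
  have h4 : 4 * (|c| / 2) ^ 2 = c ^ 2 := by rw [div_pow, sq_abs]; ring
  have hinv : 1 / |c| = ς / c := by
    rw [div_eq_div_iff hc' hc, ← hς, one_mul]
    have : ς ^ 2 * c ^ 2 = c ^ 2 := by rw [← mul_pow, hς, sq_abs]
    have h1 : ς ^ 2 = 1 := by
      have : c ^ 2 ≠ 0 := pow_ne_zero 2 hc
      field_simp at *
      assumption
    linear_combination (-c) * h1
  have hsin : Real.sin (|c| * s) = Real.sin (c * τ) := by
    rw [hs]
    rcases hκ with rfl | rfl
    · congr 1; ring
    · rw [← Real.sin_add_two_pi (c * τ)]; congr 1; ring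
  have hcos : Real.cos (|c| * s) = Real.cos (c * τ) := by
    rw [hs]
    rcases hκ with rfl | rfl
    · congr 1; ring
    · rw [← Real.cos_add_two_pi (c * τ)]; congr 1; ring
  have hsc : 1 / |c| * s = τ / c + (1 - κ) * Real.pi / c ^ 2 := by
    have : 1 / |c| * s = |c| * s / c ^ 2 := by
      rw [← sq_abs c]; field_simp
    rw [this, hs]
    field_simp
  have hproj : ∀ q : Heis, proj (op (p.1, p.2.1, p.2.2 - κ * (Real.pi / c ^ 2)) q) =
      proj p + proj q := fun q => by apply Complex.ext <;> simp [op]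
  have hpp : proj (pansuParam (|c| / 2) s θ) = ς * rot 1 θ * arc c τ := by
    apply Complex.ext
    · simp only [pansuParam, h2, hsin, hcos, hinv, rot, arc, proj_re, Complex.mul_re,
        Complex.mul_im, Complex.ofReal_re, Complex.ofReal_im, one_mul]
      ring
    · simp only [pansuParam, h2, hsin, hcos, hinv, rot, arc, proj_im, Complex.mul_re,
        Complex.mul_im, Complex.ofReal_re, Complex.ofReal_im, one_mul]
      ring
  refine eq_of_proj_eq ?_ ?_
  · rw [hproj, hpp, proj_leafPt]
  · rw [leafPt_height, ← hpp]
    simp only [op, cross, proj_re, proj_im]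
    have : (pansuParam (|c| / 2) s θ).2.2 =
        Real.sin (c * τ) / c ^ 2 - (τ / c + (1 - κ) * Real.pi / c ^ 2) + Real.pi / c ^ 2 := by
      simp only [pansuParam, h2, h4, hsin, hsc]
      ring
    rw [this]
    ring

/-- The Pansu sphere, translated so that its pole selected by the sign `κ` becomes `p`, consists of
the leaves which leave `p` in all directions. -/
theorem op_image_pansuSphere {c : ℝ} (hc : c ≠ 0) {κ : ℝ} (hκ : κ = 1 ∨ κ = -1) (p : Heis) :
    op (p.1, p.2.1, p.2.2 - κ * (Real.pi / c ^ 2)) '' pansuSphere (|c| / 2) =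
      {q | ∃ (w : ℂ) (τ : ℝ), ‖w‖ = 1 ∧ κ * (c * τ) ∈ Icc 0 (2 * Real.pi) ∧
        q = leafPt c p w τ} := by
  have hc' : 0 < |c| := abs_pos.2 hc
  obtain ⟨ς, hς1, hς⟩ : ∃ ς : ℝ, (ς = 1 ∨ ς = -1) ∧ ς * c = |c| := by
    rcases le_total 0 c with h | h
    · exact ⟨1, Or.inl rfl, by rw [one_mul, abs_of_nonneg h]⟩
    · exact ⟨-1, Or.inr rfl, by rw [neg_one_mul, abs_of_nonpos h]⟩
  have hςn : ‖(ς : ℂ)‖ = 1 := by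
    rw [Complex.norm_real]; rcases hς1 with rfl | rfl <;> simp
  have hςς : (ς : ℂ) * ς = 1 := by rcases hς1 with rfl | rfl <;> simp
  have hrange : ∀ s τ : ℝ, |c| * s = c * τ + (1 - κ) * Real.pi →
      (s ∈ Icc 0 (Real.pi / (|c| / 2)) ↔ κ * (c * τ) ∈ Icc 0 (2 * Real.pi)) := by
    intro s τ h
    have h1 : s ∈ Icc 0 (Real.pi / (|c| / 2)) ↔ 0 ≤ |c| * s ∧ |c| * s ≤ 2 * Real.pi := by
      rw [mem_Icc, le_div_iff₀ (by positivity), mul_nonneg_iff_of_pos_left hc']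
      constructor <;> rintro ⟨a, b⟩ <;> exact ⟨a, by linarith⟩
    rw [h1, h, mem_Icc]
    rcases hκ with rfl | rfl
    · constructor <;> rintro ⟨a, b⟩ <;> constructor <;> linarith
    · constructor <;> rintro ⟨a, b⟩ <;> constructor <;> linarith
  ext q
  constructor
  · rintro ⟨_, ⟨s, hs, θ, rfl⟩, rfl⟩
    have h : |c| * s = c * ((|c| * s - (1 - κ) * Real.pi) / c) + (1 - κ) * Real.pi := by
      rw [mul_div_cancel₀ _ hc]; ring
    exact ⟨ς * rot 1 θ, _, by rw [norm_mul, hςn, norm_rot, one_mul], (hrange _ _ h).1 hs,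
      op_pansuParam hc hκ hς p h⟩
  · rintro ⟨w, τ, hw, hτ, rfl⟩
    obtain ⟨θ, hθ⟩ := exists_eq_rot (w := ς * w) (by rw [norm_mul, hςn, hw, one_mul])
    have h : |c| * ((c * τ + (1 - κ) * Real.pi) / |c|) = c * τ + (1 - κ) * Real.pi :=
      mul_div_cancel₀ _ hc'.ne'
    refine ⟨_, ⟨_, (hrange _ _ h).2 hτ, θ, rfl⟩, ?_⟩
    rw [op_pansuParam hc hκ hς p h, ← hθ, ← mul_assoc, hςς, one_mul]

theorem norm_mul_arc_eq_iff {c : ℝ} (hc : c ≠ 0) {w w' : ℂ} (hw : ‖w‖ = 1) (hw' : ‖w'‖ = 1)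
    {σ τ : ℝ} :
    ‖w * arc c σ‖ = ‖w' * arc c τ‖ ↔ Real.cos (c * σ) = Real.cos (c * τ) := by
  rw [norm_mul, norm_mul, hw, hw', one_mul, one_mul,
    ← pow_left_inj₀ (norm_nonneg _) (norm_nonneg _) (two_ne_zero), ← dot_self, ← dot_self,
    dot_arc_self, dot_arc_self, div_left_inj' (pow_ne_zero 2 hc)]
  constructor <;> intro h <;> linarith

theorem arc_ne_zero {c : ℝ} {σ : ℝ} (h : Real.cos (c * σ) < 1) (hc : c ≠ 0) : arc c σ ≠ 0 := by
  intro h0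
  have := congrArg Complex.im h0
  simp only [arc, Complex.zero_im, div_eq_zero_iff, hc, or_false] at this
  linarith

/-- Within half a turn, circles through the origin of the same curvature only meet there. -/
theorem eq_of_mul_arc_eq {c κ : ℝ} (hc : c ≠ 0) (hκ : κ = 1 ∨ κ = -1) {w w' : ℂ} (hw : ‖w‖ = 1)
    (hw' : ‖w'‖ = 1) {σ τ : ℝ} (hσ0 : 0 < κ * (c * σ)) (hσ : κ * (c * σ) ≤ Real.pi)
    (hτ0 : 0 ≤ κ * (c * τ)) (hτ : κ * (c * τ) ≤ Real.pi) (h : w * arc c σ = w' * arc c τ) :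
    σ = τ ∧ w = w' := by
  have hcos : ∀ x, Real.cos (κ * x) = Real.cos x := fun x => by
    rcases hκ with rfl | rfl <;> simp
  have h1 := (norm_mul_arc_eq_iff hc hw hw').1 (congrArg norm h)
  rw [← hcos, ← hcos (c * τ)] at h1
  have h2 := Real.injOn_cos ⟨hσ0.le, hσ⟩ ⟨hτ0, hτ⟩ h1
  have hκ0 : κ ≠ 0 := by rcases hκ with rfl | rfl <;> norm_num
  have h3 : σ = τ := mul_left_cancel₀ hc (mul_left_cancel₀ hκ0 h2)
  subst h3
  refine ⟨rfl, mul_right_cancel₀ (arc_ne_zero ?_ hc) h⟩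
  rw [← hcos, ← Real.cos_zero]
  exact Real.cos_lt_cos_of_nonneg_of_le_pi le_rfl hσ hσ0

/-! ### The leaves through an isolated singular point -/

theorem isPreconnected_ball_diff_center (X₀ : ℂ) (ρ : ℝ) :
    IsPreconnected {X : ℂ | X ∈ Metric.ball X₀ ρ ∧ X ≠ X₀} := by
  have himage : {X : ℂ | X ∈ Metric.ball X₀ ρ ∧ X ≠ X₀} =
      (fun q : ℝ × ℝ => X₀ + q.1 * Complex.exp (q.2 * Complex.I)) '' (Ioo 0 ρ ×ˢ univ) := by
    ext X
    constructor
    · rintro ⟨hX, hne⟩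
      refine ⟨(‖X - X₀‖, (X - X₀).arg), ⟨⟨norm_pos_iff.2 (sub_ne_zero.2 hne), ?_⟩, mem_univ _⟩, ?_⟩
      · rwa [← mem_ball_iff_norm]
      · simp only [Complex.norm_mul_exp_arg_mul_I]; ring
    · rintro ⟨⟨r, θ⟩, ⟨⟨hr0, hr⟩, -⟩, rfl⟩
      have hn : ‖(r : ℂ) * Complex.exp (θ * Complex.I)‖ = r := by
        rw [norm_mul, Complex.norm_exp_ofReal_mul_I, mul_one, Complex.norm_real,
          Real.norm_of_nonneg hr0.le]
      refine ⟨by rw [mem_ball_iff_norm, add_sub_cancel_left, hn]; exact hr, fun h => ?_⟩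
      rw [add_eq_left] at h
      rw [h, norm_zero] at hn
      exact hr0.ne hn
  rw [himage]
  refine (isPreconnected_Ioo.prod isPreconnected_univ).image _ (Continuous.continuousOn ?_)
  fun_prop

/-- At a singular point where the linearization is `-1`, the circular arcs in all directions are
leaves. They all carry the same orientation `ε` because the regular part is connected. -/
theorem IsCharGraph.exists_radial_leaves {c : ℝ} {Ω : Set ℂ} {u : ℂ → ℝ} {e : ℂ → ℂ}
    (h : IsCharGraph c Ω u e) (hc : c ≠ 0) {X₀ : ℂ} (hX : X₀ ∈ Ω) (hF : charField u X₀ = 0)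
    (hM : ∀ w, fderiv ℝ (charField u) X₀ w = -w) :
    ∃ ε : ℝ, (ε = 1 ∨ ε = -1) ∧ ∃ s₁ > 0, |c| * s₁ < Real.pi ∧ ∀ w : ℂ, ‖w‖ = 1 → ∀ s, 0 < s →
      s < s₁ → X₀ + w * arc c (ε * s) ∈ Ω ∧ charField u (X₀ + w * arc c (ε * s)) ≠ 0 ∧
        e (X₀ + w * arc c (ε * s)) = w * rot c (ε * s) ∧
        u (X₀ + w * arc c (ε * s)) =
          u X₀ - cross X₀ (w * arc c (ε * s)) - ε * s / c + Real.sin (c * (ε * s)) / c ^ 2 := by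
  have hc' : 0 < |c| := abs_pos.2 hc
  obtain ⟨ρ, hρ, hb⟩ := h.exists_ball_norm_charField_add_le hX hF hM
  have hreg : ∀ X ∈ {X : ℂ | X ∈ Metric.ball X₀ ρ ∧ X ≠ X₀}, X ∈ Ω ∧ charField u X ≠ 0 :=
    fun X hX => ⟨(hb X hX.1).1, charField_ne_zero_of_norm_add_le (hb X hX.1).2 hX.2⟩
  obtain ⟨ε, hε, hsign⟩ := exists_sign (isPreconnected_ball_diff_center X₀ ρ)
    (h.continuousOn_dot_field hreg)
    (fun X hX => h.dot_field_ne_zero (hreg X hX).1 (hreg X hX).2)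
  have hcone : ∀ ν : ℂ, ‖ν‖ = 1 → ∀ r, 0 < r → r < ρ / 2 → ∀ X : ℂ,
      ‖X - (X₀ + r • ν)‖ ≤ 1 / 2 * r → X ∈ Metric.ball X₀ ρ ∧ X ≠ X₀ := by
    intro ν hν r hr0 hr X hXr
    have hrn : ‖r • ν‖ = r := by rw [norm_smul, hν, mul_one, Real.norm_of_nonneg hr0.le]
    constructor
    · rw [mem_ball_iff_norm]
      have : X - X₀ = (X - (X₀ + r • ν)) + r • ν := by ring
      rw [this]
      refine (norm_add_le _ _).trans_lt ?_
      rw [hrn]; linarith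
    · rintro rfl
      rw [sub_add_cancel_left, norm_neg, hrn] at hXr
      linarith
  have hleaf : ∀ w : ℂ, ‖w‖ = 1 → ∀ s, 0 < s → s < min (ρ / 2) (1 / (2 * |c|)) →
      (X₀ + w * arc c (ε * s) ∈ Ω ∧ charField u (X₀ + w * arc c (ε * s)) ≠ 0) ∧
        e (X₀ + w * arc c (ε * s)) = w * rot c (ε * s) := by
    intro w hw s hs0 hs
    have hεε : (ε : ℂ) * (ε * w) = w := by rcases hε with rfl | rfl <;> simp
    have hν : ‖(ε : ℂ) * w‖ = 1 := by
      rw [norm_mul, hw, Complex.norm_real]; rcases hε with rfl | rfl <;> simp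
    have hsη : |c| * s < 1 / 2 := by
      have := (lt_div_iff₀ (by positivity)).1 (hs.trans_le (min_le_right _ _))
      linarith
    have := h.field_eq_rot_of_singular hc hX hF hν one_pos (by rw [hM, neg_one_smul]) hε
      (by
        filter_upwards [Ioo_mem_nhdsGT (half_pos hρ)] with t ht
        have hmem := hcone _ hν t ht.1 ht.2 (X₀ + t • (ε * w)) (by
          rw [sub_self, norm_zero]; linarith [ht.1])
        exact ⟨(hreg _ hmem).1, hsign _ hmem⟩)
      (fun r hr0 hr X hXr => hreg X (hcone _ hν r hr0 hr X hXr)) hs0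
      (hs.trans_le (min_le_left _ _)) hsη
    rwa [hεε] at this
  refine ⟨ε, hε, min (ρ / 2) (1 / (2 * |c|)), lt_min (by positivity) (by positivity), ?_, ?_⟩
  · have := (le_div_iff₀ (by positivity)).1 (min_le_right (ρ / 2) (1 / (2 * |c|)))
    linarith [Real.pi_gt_three]
  · intro w hw s hs0 hs
    obtain ⟨⟨h1, h2⟩, h3⟩ := hleaf w hw s hs0 hs
    refine ⟨h1, h2, h3, h.height_eq hc hw fun r hr => ?_⟩
    rcases hr.1.eq_or_lt with rfl | hr0
    · simp [arc_zero, hX, hF, cross]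
    · obtain ⟨⟨a1, a2⟩, a3⟩ := hleaf w hw (s * r) (by positivity)
        (lt_of_le_of_lt (mul_le_of_le_one_right hs0.le hr.2) hs)
      rw [← mul_assoc] at a1 a2 a3
      exact ⟨a1, by rw [← a3]; exact h.parallel _ a1 a2⟩

/-- The leaves in all directions cover a disc. -/
theorem exists_disc_subset_leaves {c : ℝ} (hc : c ≠ 0) {ε : ℝ} (hε : ε = 1 ∨ ε = -1) {s₁ : ℝ}
    (hs₁ : 0 < s₁) (hcs : |c| * s₁ < Real.pi) :
    ∃ r > 0, ∀ D : ℂ, D ≠ 0 → ‖D‖ < r → ∃ w : ℂ, ‖w‖ = 1 ∧ ∃ s, 0 < s ∧ s < s₁ ∧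
      D = w * arc c (ε * s) := by
  have hcos : Real.cos (c * (ε * s₁)) < 1 := by
    rw [← Real.cos_abs, ← Real.cos_zero]
    have : |c * (ε * s₁)| = |c| * s₁ := by
      rw [abs_mul, abs_mul, abs_of_pos hs₁]; rcases hε with rfl | rfl <;> simp
    rw [this]
    exact Real.cos_lt_cos_of_nonneg_of_le_pi le_rfl hcs.le (mul_pos (abs_pos.2 hc) hs₁)
  have hcont : Continuous fun s => ‖arc c (ε * s)‖ :=
    ((contDiff_arc (n := 0) c).continuous.comp (continuous_const_mul ε)).norm
  refine ⟨‖arc c (ε * s₁)‖, norm_pos_iff.2 (arc_ne_zero hcos hc), fun D hD hDr => ?_⟩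
  obtain ⟨s, hs, hsD⟩ := intermediate_value_Ioo hs₁.le hcont.continuousOn
    (show ‖D‖ ∈ Ioo ‖arc c (ε * 0)‖ ‖arc c (ε * s₁)‖ from
      ⟨by rw [mul_zero, arc_zero, norm_zero]; exact norm_pos_iff.2 hD, hDr⟩)
  simp only at hsD
  have h0 : ‖D‖ ≠ 0 := norm_ne_zero_iff.2 hD
  have ha : arc c (ε * s) ≠ 0 := by rw [← norm_ne_zero_iff, hsD]; exact h0
  refine ⟨D / arc c (ε * s), by rw [norm_div, hsD, div_self h0], s, hs.1, hs.2, ?_⟩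
  rw [div_mul_cancel₀ _ ha]

/-! ### Polar coordinates at an isolated singular point -/

/-- The horizontal vector at `q` which projects to `w`. -/
noncomputable def horizontalLift (q : Heis) (w : ℂ) : Heis := (w.re, w.im, -cross (proj q) w)

@[simp] theorem proj_horizontalLift (q : Heis) (w : ℂ) : proj (horizontalLift q w) = w := rfl

theorem contactForm_horizontalLift (q : Heis) (w : ℂ) : contactForm q (horizontalLift q w) = 0 := by
  rw [contactForm_eq, proj_horizontalLift]; simp [horizontalLift]

theorem eq_of_proj_eq_of_contactForm_eq {q v w : Heis} (h : proj v = proj w)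
    (hc : contactForm q v = contactForm q w) : v = w := by
  refine eq_of_proj_eq h ?_
  rw [contactForm_eq, contactForm_eq, h] at hc
  linarith

theorem contactForm_add_smul (q v w : Heis) (a b : ℝ) :
    contactForm q (a • v + b • w) = a * contactForm q v + b * contactForm q w := by
  simp [contactForm]; ring

theorem J_horizontalLift (q : Heis) (w : ℂ) :
    J q (horizontalLift q w) = horizontalLift q (Complex.I * w) := by
  ext <;> simp [J, horizontalLift, E₁, E₂, cross]
  ring

theorem hasDerivAt_op {p : Heis} {D : ℝ → ℂ} {D' : ℂ} {z : ℝ → ℝ} {z' t : ℝ}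
    (hD : HasDerivAt D D' t) (hz : HasDerivAt z z' t) :
    HasDerivAt (fun t => op p ((D t).re, (D t).im, z t))
      (D'.re, D'.im, z' - cross (proj p) D') t := by
  have hx := hasDerivAt_re hD
  have hy := hasDerivAt_im hD
  refine ((hx.const_add p.1).prodMk ((hy.const_add p.2.1).prodMk
    (((hz.const_add p.2.2).add (hx.const_mul p.2.1)).sub (hy.const_mul p.1)))).congr_deriv ?_
  ext <;> simp [cross]
  ring

/-- The curves `leafPt c p w` are horizontal. -/
theorem hasDerivAt_leafPt {c : ℝ} (hc : c ≠ 0) (p : Heis) {w : ℂ} (hw : ‖w‖ = 1) (σ : ℝ) :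
    HasDerivAt (leafPt c p w) (horizontalLift (leafPt c p w σ) (w * rot c σ)) σ := by
  have h1 : HasDerivAt (fun s : ℝ => c * s) c σ := by
    simpa using (hasDerivAt_id σ).const_mul c
  have hz := (h1.sin.div_const (c ^ 2)).sub ((hasDerivAt_id σ).div_const c)
  refine (hasDerivAt_op (p := p) ((hasDerivAt_arc hc σ).const_mul w) hz).congr_deriv ?_
  refine eq_of_proj_eq rfl ?_
  simp only [horizontalLift, proj_leafPt, cross_add_left, cross_mul_right_unit hw, cross_arc_rot]
  field_simp
  ring

theorem hasDerivAt_leafPt_rot (c : ℝ) (p : Heis) (σ θ : ℝ) :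
    HasDerivAt (fun θ => leafPt c p (rot 1 θ) σ)
      ((Complex.I * (rot 1 θ * arc c σ)).re, (Complex.I * (rot 1 θ * arc c σ)).im,
        -cross (proj p) (Complex.I * (rot 1 θ * arc c σ))) θ := by
  refine (hasDerivAt_op (p := p) ((hasDerivAt_rot 1 θ).mul_const (arc c σ))
    (hasDerivAt_const θ (Real.sin (c * σ) / c ^ 2 - σ / c))).congr_deriv ?_
  simp [mul_assoc]

theorem contDiff_leafPt_rot (c : ℝ) (p : Heis) :
    ContDiff ℝ ∞ fun y : ℝ × ℝ => leafPt c p (rot 1 y.2) y.1 := by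
  have hD : ContDiff ℝ ∞ fun y : ℝ × ℝ => rot 1 y.2 * arc c y.1 :=
    ((contDiff_rot 1).comp contDiff_snd).mul ((contDiff_arc c).comp contDiff_fst)
  have hre := Complex.reCLM.contDiff.comp hD
  have him := Complex.imCLM.contDiff.comp hD
  refine (contDiff_const.add hre).prodMk ((contDiff_const.add him).prodMk
    (((contDiff_const.add ?_).add (contDiff_const.mul hre)).sub (contDiff_const.mul him)))
  fun_prop

/-- The `θ`-derivative of the polar coordinates, given by its projection and its contact form. The
latter does not vanish within a full turn, so that the coordinates are regular there. -/
theorem fderiv_leafPt_rot_right (c : ℝ) (p : Heis) (y : ℝ × ℝ) :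
    proj (fderiv ℝ (fun y : ℝ × ℝ => leafPt c p (rot 1 y.2) y.1) y (0, 1)) =
        Complex.I * (rot 1 y.2 * arc c y.1) ∧
      contactForm (leafPt c p (rot 1 y.2) y.1)
        (fderiv ℝ (fun y : ℝ × ℝ => leafPt c p (rot 1 y.2) y.1) y (0, 1)) =
        2 * (1 - Real.cos (c * y.1)) / c ^ 2 := by
  have hl : HasDerivAt (fun t : ℝ => (y.1, t)) (0, 1) y.2 :=
    (hasDerivAt_const y.2 y.1).prodMk (hasDerivAt_id y.2)
  have h1 := (((contDiff_leafPt_rot c p).differentiable (by norm_num)) y).hasFDerivAt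
  have h2 := h1.comp_hasDerivAt y.2 hl
  have h3 : HasDerivAt (fun θ => leafPt c p (rot 1 θ) y.1) _ y.2 := h2
  rw [h3.unique (hasDerivAt_leafPt_rot c p y.1 y.2)]
  refine ⟨rfl, ?_⟩
  rw [contactForm_eq, proj_leafPt, cross_add_left, ← dot_arc_self]
  have h3 : dot (rot 1 y.2 * arc c y.1) (rot 1 y.2 * arc c y.1) = dot (arc c y.1) (arc c y.1) := by
    rw [dot_self, dot_self, norm_mul, norm_rot, one_mul]
  have h4 : ∀ z : ℂ, cross z (Complex.I * z) = dot z z := fun z => by simp [cross, dot]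
  have h5 : ∀ z : ℂ, proj (z.re, z.im, -cross (proj p) z) = z := fun z => rfl
  rw [h5, h4, h3]
  ring

theorem fderiv_leafPt_rot_left {c : ℝ} (hc : c ≠ 0) (p : Heis) (y : ℝ × ℝ) :
    fderiv ℝ (fun y : ℝ × ℝ => leafPt c p (rot 1 y.2) y.1) y (1, 0) =
      horizontalLift (leafPt c p (rot 1 y.2) y.1) (rot 1 y.2 * rot c y.1) := by
  have hl : HasDerivAt (fun t : ℝ => (t, y.2)) (1, 0) y.1 :=
    (hasDerivAt_id y.1).prodMk (hasDerivAt_const y.1 y.2)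
  have h1 := (((contDiff_leafPt_rot c p).differentiable (by norm_num)) y).hasFDerivAt
  have h2 := h1.comp_hasDerivAt y.1 hl
  have h3 : HasDerivAt (leafPt c p (rot 1 y.2)) _ y.1 := h2
  exact h3.unique (hasDerivAt_leafPt hc p (norm_rot 1 y.2) y.1)

/-- The tangent plane at a regular point contains only one vector of the form `a e₂ + T`: otherwise it
would contain `e₁`, `e₂` and `T`. -/
theorem alpha_unique {S : Set Heis} (hS : IsSurface S) {e₁ : Heis → Heis}
    (he₁ : IsCharacteristicField S e₁) {q : Heis} (hq : q ∈ regularPart S) {a b : ℝ}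
    (ha : a • J q (e₁ q) + T ∈ tangentPlane S q) (hb : b • J q (e₁ q) + T ∈ tangentPlane S q) :
    a = b := by
  obtain ⟨W, f, hW, hqW, hf, hdf, hSW⟩ := hS.smooth q hq
  have hker : ∀ v ∈ tangentPlane S q, fderiv ℝ f q v = 0 := fun v hv =>
    fderiv_eq_zero_of_mem_tangentPlane (by norm_num) hW hqW hf hSW hv
  by_contra hab
  apply hdf
  set L := fderiv ℝ f q
  have h1 := hker _ ha
  have h2 := hker _ hb
  rw [map_add, map_smul, smul_eq_mul] at h1 h2
  have hJ : L (J q (e₁ q)) = 0 := by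
    have : (a - b) * L (J q (e₁ q)) = 0 := by linarith
    exact (mul_eq_zero.1 this).resolve_left (sub_ne_zero.2 hab)
  have hT : L T = 0 := by rw [hJ, mul_zero, zero_add] at h1; exact h1
  have he := hker _ (he₁.tangent q hq)
  have hh : contactForm q (e₁ q) = 0 := he₁.horizontal q hq
  have hu := he₁.unit q hq
  rw [metric, hh, mul_zero, add_zero] at hu
  have he' : (e₁ q).1 * L (E₁ q) + (e₁ q).2.1 * L (E₂ q) = 0 := by
    rw [eq_frameCoord q (e₁ q)] at he
    simpa [frameCoord, hh] using he
  have hJ' : (e₁ q).1 * L (E₂ q) - (e₁ q).2.1 * L (E₁ q) = 0 := by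
    simpa [J] using hJ
  have hE₁ : L (E₁ q) = 0 := by
    linear_combination (e₁ q).1 * he' - (e₁ q).2.1 * hJ' - L (E₁ q) * hu
  have hE₂ : L (E₂ q) = 0 := by
    linear_combination (e₁ q).2.1 * he' + (e₁ q).1 * hJ' - L (E₂ q) * hu
  refine ContinuousLinearMap.ext fun v => ?_
  rw [eq_frameCoord q v]
  simp [hE₁, hE₂, hT]

/-- The polar coordinates on the union of the leaves through `p` are normal coordinates. -/
theorem isNormalChart_leafPt {c : ℝ} (hc : c ≠ 0) {S : Set Heis} (hS : IsSurface S)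
    {e₁ : Heis → Heis} (he₁ : IsCharacteristicField S e₁) {α : Heis → ℝ}
    (hα : IsAlphaFunction S e₁ α) {p : Heis} {ε : ℝ} (hε : ε = 1 ∨ ε = -1) {s₁ : ℝ}
    (hcs : |c| * s₁ < Real.pi)
    (hleaf : ∀ w : ℂ, ‖w‖ = 1 → ∀ σ, 0 < ε * σ → ε * σ < s₁ →
      leafPt c p w σ ∈ regularPart S ∧ proj (e₁ (leafPt c p w σ)) = w * rot c σ) (θ₀ : ℝ) :
    IsNormalChart S e₁ α c {y | 0 < ε * y.1 ∧ ε * y.1 < s₁ ∧ |y.2 - θ₀| < Real.pi}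
      (fun y => leafPt c p (rot 1 y.2) y.1) (fun _ => 0) (fun _ => 1) := by
  set U : Set (ℝ × ℝ) := {y | 0 < ε * y.1 ∧ ε * y.1 < s₁ ∧ |y.2 - θ₀| < Real.pi} with hU
  set Y : ℝ × ℝ → Heis := fun y => leafPt c p (rot 1 y.2) y.1 with hY
  have hYsm : ContDiff ℝ ∞ Y := contDiff_leafPt_rot c p
  have hUo : IsOpen U := by
    have h1 : Continuous fun y : ℝ × ℝ => ε * y.1 := by fun_prop
    have h2 : Continuous fun y : ℝ × ℝ => |y.2 - θ₀| := by fun_prop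
    exact (isOpen_lt continuous_const h1).inter
      ((isOpen_lt h1 continuous_const).inter (isOpen_lt h2 continuous_const))
  have hmaps : MapsTo Y U (regularPart S) := fun y hy =>
    (hleaf _ (norm_rot 1 y.2) y.1 hy.1 hy.2.1).1
  have he : ∀ y ∈ U, e₁ (Y y) = horizontalLift (Y y) (rot 1 y.2 * rot c y.1) := by
    intro y hy
    refine eq_of_proj_eq_of_contactForm_eq (q := Y y) ?_ ?_
    · exact (hleaf _ (norm_rot 1 y.2) y.1 hy.1 hy.2.1).2
    · rw [contactForm_horizontalLift]
      exact he₁.horizontal _ (hmaps hy)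
  -- the angle `c * s` stays within a half turn
  obtain ⟨κ, hκ, hκε⟩ : ∃ κ : ℝ, (κ = 1 ∨ κ = -1) ∧ ∀ σ, κ * (c * σ) = |c| * (ε * σ) := by
    rcases le_total 0 c with h | h
    · refine ⟨ε, hε, fun σ => ?_⟩
      rw [abs_of_nonneg h]; ring
    · refine ⟨-ε, by rcases hε with rfl | rfl <;> norm_num, fun σ => ?_⟩
      rw [abs_of_nonpos h]; ring
  have hangle : ∀ y ∈ U, 0 < κ * (c * y.1) ∧ κ * (c * y.1) < Real.pi := by
    intro y hy
    rw [hκε]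
    have := abs_pos.2 hc
    exact ⟨mul_pos this hy.1, (mul_lt_mul_of_pos_left hy.2.1 this).trans hcs⟩
  have hcos : ∀ y ∈ U, 0 < 1 - Real.cos (c * y.1) := by
    intro y hy
    have h1 : Real.cos (κ * (c * y.1)) = Real.cos (c * y.1) := by
      rcases hκ with rfl | rfl <;> simp
    rw [← h1, sub_pos, ← Real.cos_zero]
    exact Real.cos_lt_cos_of_nonneg_of_le_pi le_rfl (hangle y hy).2.le (hangle y hy).1
  have hs : ∀ y, fderiv ℝ Y y (1, 0) = horizontalLift (Y y) (rot 1 y.2 * rot c y.1) :=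
    fderiv_leafPt_rot_left hc p
  -- the vector `a e₂ + T` in polar coordinates
  have hframe : ∀ y ∈ U, (c / 2 * (Real.sin (c * y.1) / (1 - Real.cos (c * y.1)))) •
      J (Y y) (e₁ (Y y)) + T = (-(c / 2)) • fderiv ℝ Y y (1, 0) +
        (c ^ 2 / 2 / (1 - Real.cos (c * y.1))) • fderiv ℝ Y y (0, 1) := by
    intro y hy
    have hne := (hcos y hy).ne'
    have htrig := Real.sin_sq_add_cos_sq (c * y.1)
    obtain ⟨h1, h2⟩ := fderiv_leafPt_rot_right c p y
    rw [he y hy, J_horizontalLift, hs]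
    have hT : proj T = 0 := by apply Complex.ext <;> simp [T]
    refine eq_of_proj_eq_of_contactForm_eq (q := Y y) ?_ ?_
    · rw [map_add, map_smul, map_add, map_smul, map_smul, h1, hT, proj_horizontalLift,
        proj_horizontalLift]
      have h3 : (c / 2 * (Real.sin (c * y.1) / (1 - Real.cos (c * y.1)))) •
          (Complex.I * rot c y.1) = (-(c / 2)) • rot c y.1 +
          (c ^ 2 / 2 / (1 - Real.cos (c * y.1))) • (Complex.I * arc c y.1) := by
        apply Complex.ext
        · simp only [rot, arc, Complex.add_re, Complex.smul_re, smul_eq_mul, Complex.mul_re,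
            Complex.I_re, Complex.I_im]
          field_simp
          linear_combination (-1 : ℝ) * htrig
        · simp only [rot, arc, Complex.add_im, Complex.smul_im, smul_eq_mul, Complex.mul_im,
            Complex.I_re, Complex.I_im]
          field_simp
          ring
      have h4 := congrArg (fun z : ℂ => rot 1 y.2 * z) h3
      simp only [mul_add, mul_smul_comm] at h4
      convert h4 using 2
      · rw [add_zero, mul_left_comm]
      · rw [mul_left_comm]
    · have h3 : contactForm (Y y) T = 1 := by simp [contactForm, T]
      have h4 := contactForm_add_smul (Y y) (horizontalLift (Y y) (Complex.I *
        (rot 1 y.2 * rot c y.1))) T (c / 2 * (Real.sin (c * y.1) / (1 - Real.cos (c * y.1)))) 1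
      rw [one_smul] at h4
      rw [h4, contactForm_add_smul, h2, h3, contactForm_horizontalLift, contactForm_horizontalLift]
      field_simp
      ring
  have hαY : ∀ y ∈ U, α (Y y) = c / 2 * (Real.sin (c * y.1) / (1 - Real.cos (c * y.1))) := by
    intro y hy
    refine alpha_unique hS he₁ (hmaps hy) (hα _ (hmaps hy)) ?_
    rw [hframe y hy]
    set a := c ^ 2 / 2 / (1 - Real.cos (c * y.1))
    have hl : HasDerivAt (fun t : ℝ => y + t • ((-(c / 2), a) : ℝ × ℝ)) (-(c / 2), a) 0 := by
      simpa using ((hasDerivAt_id (0 : ℝ)).smul_const ((-(c / 2), a) : ℝ × ℝ)).const_add y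
    have hl0 : y + (0 : ℝ) • ((-(c / 2), a) : ℝ × ℝ) = y := by simp
    refine ⟨fun t => Y (y + t • ((-(c / 2), a) : ℝ × ℝ)), by simp only [hl0], ?_, ?_⟩
    · have h1 : HasFDerivAt Y (fderiv ℝ Y y) (y + (0 : ℝ) • ((-(c / 2), a) : ℝ × ℝ)) := by
        rw [hl0]; exact ((hYsm.differentiable (by norm_num)) y).hasFDerivAt
      refine (h1.comp_hasDerivAt 0 hl).congr_deriv ?_
      rw [← map_smul, ← map_smul, ← map_add]
      simp
    · have h2 : ∀ᶠ t : ℝ in 𝓝 0, y + t • ((-(c / 2), a) : ℝ × ℝ) ∈ U :=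
        hl.continuousAt.eventually (hUo.mem_nhds (by simpa only [hl0] using hy))
      filter_upwards [h2] with t ht using (hmaps ht).1
  refine ⟨⟨hUo, hYsm.contDiffOn, ?_, ?_, hmaps, fun y hy => (hs y).trans (he y hy).symm⟩,
    fun y hy => ?_, fun y hy => ?_, fun y hy => ?_⟩
  · intro y hy y' hy' heq
    have h1 : rot 1 y.2 * arc c y.1 = rot 1 y'.2 * arc c y'.1 := by
      have := congrArg proj heq
      simpa only [hY, proj_leafPt, add_right_inj] using this
    obtain ⟨h2, h3⟩ := eq_of_mul_arc_eq hc hκ (norm_rot 1 _) (norm_rot 1 _) (hangle y hy).1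
      (hangle y hy).2.le (hangle y' hy').1.le (hangle y' hy').2.le h1
    have h4 : Real.cos y.2 = Real.cos y'.2 := by simpa [rot] using congrArg Complex.re h3
    have h5 : Real.sin y.2 = Real.sin y'.2 := by simpa [rot] using congrArg Complex.im h3
    have h6 : Real.cos (y.2 - y'.2) = 1 := by
      rw [Real.cos_sub, h4, h5]
      linear_combination Real.sin_sq_add_cos_sq y'.2
    have h7 := abs_lt.1 hy.2.2
    have h8 := abs_lt.1 hy'.2.2
    have h9 := (Real.cos_eq_one_iff_of_lt_of_lt (by linarith) (by linarith)).1 h6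
    exact Prod.ext h2 (by linarith)
  · intro y hy
    refine (injective_iff_map_eq_zero _).2 ?_
    rintro ⟨a, b⟩ hab
    have h1 : ((a, b) : ℝ × ℝ) = a • (1, 0) + b • (0, 1) := by simp
    rw [h1, map_add, map_smul, map_smul] at hab
    obtain ⟨-, h2⟩ := fderiv_leafPt_rot_right c p y
    have h3 := congrArg (contactForm (Y y)) hab
    rw [contactForm_add_smul, h2, hs, contactForm_horizontalLift] at h3
    have h4 : contactForm (Y y) 0 = 0 := by simp [contactForm]
    have h5 : 2 * (1 - Real.cos (c * y.1)) / c ^ 2 ≠ 0 := by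
      have := hcos y hy
      positivity
    rw [h4, mul_zero, zero_add] at h3
    have hb : b = 0 := (mul_eq_zero.1 h3).resolve_right h5
    have h6 := congrArg proj hab
    rw [hb, zero_smul, add_zero, hs, map_smul, proj_horizontalLift, map_zero] at h6
    have h7 := congrArg norm h6
    rw [norm_smul, norm_mul, norm_rot, norm_rot, norm_zero, mul_one, mul_one, norm_eq_zero] at h7
    rw [h7, hb]; rfl
  · simpa only [add_zero] using (hcos y hy).ne'
  · simpa only [add_zero] using hαY y hy
  · have h1 := hframe y hy
    rw [← hαY y hy] at h1
    rw [h1, add_zero, abs_of_pos (hcos y hy), smul_add, smul_smul, smul_smul]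
    congr 2
    · ring
    · rw [div_mul_div_comm, one_mul, mul_comm (Real.sqrt _)]

/-! ### Isolated singular points and Pansu spheres -/

/-- Near an isolated singular point `p`, the surface is the union of the leaves of length `s₁` which
leave `p` in all directions with a common orientation `ε`. -/
theorem exists_leafPt_neighborhood {S : Set Heis} (hS : IsSurface S) {e₁ : Heis → Heis}
    (he₁ : IsCharacteristicField S e₁) {c : ℝ} (hc : c ≠ 0) (hH : HasConstPMeanCurvature S e₁ c)
    {p : Heis} (hp : p ∈ singularSet S) (hiso : IsIsolatedIn (singularSet S) p) :
    ∃ ε : ℝ, (ε = 1 ∨ ε = -1) ∧ ∃ s₁ > 0, |c| * s₁ < Real.pi ∧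
      (∀ w : ℂ, ‖w‖ = 1 → ∀ σ, 0 < ε * σ → ε * σ < s₁ →
        leafPt c p w σ ∈ regularPart S ∧ proj (e₁ (leafPt c p w σ)) = w * rot c σ) ∧
      ∃ V : Set Heis, IsOpen V ∧ p ∈ V ∧
        (∀ q ∈ V, proj q ≠ proj p → ∃ w : ℂ, ‖w‖ = 1 ∧ ∃ s, 0 < s ∧ s < s₁ ∧
          proj q = proj p + w * arc c (ε * s)) ∧
        ∀ q ∈ S ∩ V, q ≠ p → ∃ w : ℂ, ‖w‖ = 1 ∧ ∃ s, 0 < s ∧ s < s₁ ∧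
          q = leafPt c p w (ε * s) := by
  rcases exists_isGraphIn_dichotomy hS he₁ hc hH hp with h1 | ⟨-, W, Ω, u, hG, hpΩ, hgr, h, hF, hM⟩
  · exact absurd hiso h1.not_isIsolatedIn
  obtain ⟨ε, hε, s₁, hs₁, hcs, hrad⟩ := h.exists_radial_leaves hc hpΩ hF hM
  obtain ⟨r, hr, hdisc⟩ := exists_disc_subset_leaves hc hε hs₁ hcs
  have hεε : ∀ σ : ℝ, ε * (ε * σ) = σ := fun σ => by rcases hε with rfl | rfl <;> ring
  have hup : u (proj p) = p.2.2 := congrArg (fun q : Heis => q.2.2) hgr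
  have hgraph : ∀ w : ℂ, ‖w‖ = 1 → ∀ s, 0 < s → s < s₁ →
      leafPt c p w (ε * s) = graphPt u (proj p + w * arc c (ε * s)) := by
    intro w hw s hs0 hs
    refine eq_of_proj_eq (proj_leafPt _ _ _ _) ?_
    rw [leafPt_height, ← hup]
    exact (hrad w hw s hs0 hs).2.2.2.symm
  have hpW : p ∈ W := by rw [← hgr]; exact (hG.graphPt_mem hpΩ).2
  have hcover : ∀ q : Heis, ‖proj q - proj p‖ < r → proj q ≠ proj p → ∃ w : ℂ, ‖w‖ = 1 ∧
      ∃ s, 0 < s ∧ s < s₁ ∧ proj q = proj p + w * arc c (ε * s) := by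
    intro q hq hne
    obtain ⟨w, hw, s, hs0, hs, hD⟩ := hdisc _ (sub_ne_zero.2 hne) hq
    exact ⟨w, hw, s, hs0, hs, by rw [← hD, add_sub_cancel]⟩
  refine ⟨ε, hε, s₁, hs₁, hcs, fun w hw σ h0 h1 => ?_, W ∩ {q | ‖proj q - proj p‖ < r},
    hG.isOpen.inter (isOpen_lt (proj.continuous.sub continuous_const).norm continuous_const),
    ⟨hpW, by rw [mem_ofPred_eq, sub_self, norm_zero]; exact hr⟩, fun q hq hne =>
      hcover q hq.2 hne, ?_⟩
  · have h2 := hrad w hw _ h0 h1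
    have h3 := hgraph w hw _ h0 h1
    rw [hεε] at h2 h3
    rw [h3]
    exact ⟨(hG.mem_regularPart_iff h2.1).2 h2.2.1, h2.2.2.1⟩
  · rintro q ⟨hqS, hqW, hqr⟩ hne
    obtain ⟨-, hqe⟩ := hG.eq_graphPt ⟨hqS, hqW⟩
    obtain ⟨w, hw, s, hs0, hs, hD⟩ := hcover q hqr (fun h0 => hne (by rw [hqe, h0, hgr]))
    exact ⟨w, hw, s, hs0, hs, by rw [hgraph w hw s hs0 hs, ← hD]; exact hqe⟩

/-- Over the range of angles `[π, 2π]`, the height of a leaf over the contact plane at its starting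
point has modulus at least `π / c ^ 2`. This separates the part of a Pansu sphere near one pole from
the part near the other pole. -/
theorem mul_lt_pi_of_abs_height_lt {c κ τ : ℝ} (hc : c ≠ 0) (hκ : κ = 1 ∨ κ = -1)
    (hτ : κ * (c * τ) ∈ Icc 0 (2 * Real.pi))
    (h : |Real.sin (c * τ) / c ^ 2 - τ / c| < Real.pi / c ^ 2) : κ * (c * τ) < Real.pi := by
  have hc2 : 0 < c ^ 2 := by positivity
  have h1 : Real.sin (c * τ) / c ^ 2 - τ / c = (Real.sin (c * τ) - c * τ) / c ^ 2 := by
    field_simp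
  rw [h1, abs_div, abs_of_pos hc2, div_lt_div_iff_of_pos_right hc2] at h
  have h2 : κ * (Real.sin (c * τ) - c * τ) = Real.sin (κ * (c * τ)) - κ * (c * τ) := by
    rcases hκ with rfl | rfl <;> simp; ring
  have h3 : |Real.sin (κ * (c * τ)) - κ * (c * τ)| < Real.pi := by
    rw [← h2, abs_mul]; rcases hκ with rfl | rfl <;> simpa using h
  by_contra! hle
  have h4 : Real.sin (κ * (c * τ)) ≤ 0 := by
    have := Real.sin_nonneg_of_nonneg_of_le_pi (x := 2 * Real.pi - κ * (c * τ))
      (by linarith [hτ.2]) (by linarith)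
    rw [Real.sin_two_pi_sub] at this
    linarith
  have := (abs_lt.1 h3).1
  linarith

/-- Near an isolated singular point, the surface is of special type I and a piece of a Pansu sphere,
because both the surface and the sphere consist of the leaves which leave the point. -/
theorem isolated_special_type_pansu {S : Set Heis} (hS : IsSurface S) {e₁ : Heis → Heis}
    (he₁ : IsCharacteristicField S e₁) {c : ℝ} (hc : c ≠ 0) (hH : HasConstPMeanCurvature S e₁ c)
    {α : Heis → ℝ} (hα : IsAlphaFunction S e₁ α) {p : Heis}
    (hiso : IsIsolatedIn (singularSet S) p) :
    ∃ W : Set Heis, IsOpen W ∧ p ∈ W ∧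
      (∃ k : ℝ, IsSpecialTypeIConst S e₁ α c ((S ∩ W) \ {p}) k) ∧
      ∃ g : Heis, ∃ P ∈ pansuPoles (|c| / 2), op g P = p ∧
        S ∩ W = (op g '' pansuSphere (|c| / 2)) ∩ W := by
  have hp : p ∈ singularSet S := by
    obtain ⟨W, -, hW⟩ := hiso
    have : p ∈ singularSet S ∩ W := by rw [hW]; rfl
    exact this.1
  obtain ⟨ε, hε, s₁, hs₁, hcs, hleaf, V, hV, hpV, hcover, hVS⟩ :=
    exists_leafPt_neighborhood hS he₁ hc hH hp hiso
  have hεε : ∀ σ : ℝ, ε * (ε * σ) = σ := fun σ => by rcases hε with rfl | rfl <;> ring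
  have hpi := Real.pi_pos
  -- the sign `κ` of `c * ε` is that of the angle `c * σ` along the leaves; it selects the pole
  obtain ⟨κ, hκ, hκε⟩ : ∃ κ : ℝ, (κ = 1 ∨ κ = -1) ∧ ∀ s, κ * (c * (ε * s)) = |c| * s := by
    rcases le_total 0 c with h | h
    · exact ⟨ε, hε, fun s => by rw [abs_of_nonneg h]; linear_combination c * hεε s⟩
    · exact ⟨-ε, by rcases hε with rfl | rfl <;> norm_num, fun s => by
        rw [abs_of_nonpos h]; linear_combination -c * hεε s⟩
  have hangle : ∀ s, 0 < s → s < s₁ → 0 < κ * (c * (ε * s)) ∧ κ * (c * (ε * s)) < Real.pi := by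
    intro s hs0 hs
    rw [hκε]
    have := abs_pos.2 hc
    exact ⟨by positivity, (mul_lt_mul_of_pos_left hs this).trans hcs⟩
  -- the height over the contact plane at `p`
  set G : Heis → ℝ := fun q => q.2.2 - p.2.2 + cross (proj p) (proj q - proj p) with hGd
  have hGc : Continuous G := by
    have hcc : Continuous (fun p : ℂ × ℂ => cross p.1 p.2) := (contDiff_cross (n := 0)).continuous
    exact ((continuous_snd.comp continuous_snd).sub continuous_const).add
      (hcc.comp (continuous_const.prodMk (proj.continuous.sub continuous_const)))
  have hGl : ∀ w τ, G (leafPt c p w τ) = Real.sin (c * τ) / c ^ 2 - τ / c := by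
    intro w τ
    simp only [hGd, leafPt_height, proj_leafPt, add_sub_cancel_left]
    ring
  refine ⟨V ∩ {q | |G q| < Real.pi / c ^ 2},
    hV.inter (isOpen_lt hGc.abs continuous_const), ⟨hpV, ?_⟩, ⟨0, ?_⟩,
    (p.1, p.2.1, p.2.2 - κ * (Real.pi / c ^ 2)), (0, 0, κ * (Real.pi / c ^ 2)), ?_, ?_, ?_⟩
  · have h1 := hGl 1 0
    rw [leafPt_zero] at h1
    rw [mem_ofPred_eq, h1]
    simp only [mul_zero, Real.sin_zero, zero_div, sub_zero, abs_zero]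
    positivity
  · rintro q ⟨⟨hqS, hqV, -⟩, hqp⟩
    obtain ⟨w, hw, s, hs0, hs, rfl⟩ := hVS q ⟨hqS, hqV⟩ hqp
    obtain ⟨θ, rfl⟩ := exists_eq_rot hw
    refine ⟨_, _, ?_, isNormalChart_leafPt hc hS he₁ hα hε hcs hleaf θ⟩
    refine ⟨(ε * s, θ), ⟨?_, ?_, ?_⟩, rfl⟩
    · rw [hεε]; exact hs0
    · rw [hεε]; exact hs
    · rw [sub_self, abs_zero]; exact hpi
  · have h4 : 4 * (|c| / 2) ^ 2 = c ^ 2 := by rw [div_pow, sq_abs]; ring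
    rw [pansuPoles, h4]
    rcases hκ with rfl | rfl <;> simp
  · ext <;> simp [op]
  · rw [op_image_pansuSphere hc hκ p]
    ext q
    constructor
    · rintro ⟨hqS, hqV, hqG⟩
      refine ⟨?_, hqV, hqG⟩
      by_cases hqp : q = p
      · exact ⟨1, 0, norm_one, by simp [hpi.le], by rw [leafPt_zero, hqp]⟩
      · obtain ⟨w, hw, s, hs0, hs, rfl⟩ := hVS q ⟨hqS, hqV⟩ hqp
        obtain ⟨h1, h2⟩ := hangle s hs0 hs
        exact ⟨w, ε * s, hw, ⟨h1.le, by linarith⟩, rfl⟩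
    · rintro ⟨⟨w, τ, hw, hτ, rfl⟩, hqV, hqG⟩
      refine ⟨?_, hqV, hqG⟩
      have hτπ : κ * (c * τ) < Real.pi := by
        refine mul_lt_pi_of_abs_height_lt hc hκ hτ ?_
        rw [← hGl w τ]; exact hqG
      by_cases hτ0 : τ = 0
      · rw [hτ0, leafPt_zero]; exact hp.1
      have hpos : 0 < κ * (c * τ) := by
        refine lt_of_le_of_ne hτ.1 (Ne.symm (mul_ne_zero ?_ (mul_ne_zero hc hτ0)))
        rcases hκ with rfl | rfl <;> norm_num
      have hne : proj (leafPt c p w τ) ≠ proj p := by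
        rw [proj_leafPt, Ne, add_eq_left, mul_eq_zero, not_or]
        refine ⟨norm_ne_zero_iff.1 (by rw [hw]; norm_num), arc_ne_zero ?_ hc⟩
        have h1 : Real.cos (κ * (c * τ)) = Real.cos (c * τ) := by
          rcases hκ with rfl | rfl <;> simp
        rw [← h1, ← Real.cos_zero]
        exact Real.cos_lt_cos_of_nonneg_of_le_pi le_rfl hτπ.le hpos
      obtain ⟨w', hw', s, hs0, hs, hD⟩ := hcover _ hqV hne
      rw [proj_leafPt, add_right_inj] at hD
      obtain ⟨h1, h2⟩ := hangle s hs0 hs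
      obtain ⟨rfl, rfl⟩ := eq_of_mul_arc_eq hc hκ hw hw' hpos hτπ.le h1.le h2.le hD
      exact (hleaf w hw _ (by rw [hεε]; exact hs0) (by rw [hεε]; exact hs)).1.1

end Heis

theorem mainTheorem4 (c : ℝ) (hc : c ≠ 0) (S : Set Heis) (hS : Heis.IsSurface S)
    (e₁ : Heis → Heis) (he₁ : Heis.IsCharacteristicField S e₁)
    (hH : Heis.HasConstPMeanCurvature S e₁ c)
    (α : Heis → ℝ) (hα : Heis.IsAlphaFunction S e₁ α) :
    (∀ p ∈ Heis.singularSet S,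
      Heis.IsIsolatedIn (Heis.singularSet S) p ∨
      ∀ q ∈ connectedComponentIn (Heis.singularSet S) p,
        Heis.IsSmoothCurveNear (Heis.singularSet S) q) ∧
    (∀ p : Heis, Heis.IsIsolatedIn (Heis.singularSet S) p →
      ∃ W : Set Heis, IsOpen W ∧ p ∈ W ∧
        (∃ k : ℝ, Heis.IsSpecialTypeIConst S e₁ α c ((S ∩ W) \ {p}) k) ∧
        ∃ g : Heis, ∃ P ∈ Heis.pansuPoles (|c| / 2), Heis.op g P = p ∧
          S ∩ W = (Heis.op g '' Heis.pansuSphere (|c| / 2)) ∩ W) := by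
  refine ⟨fun p hp => Heis.isolated_or_smooth_component hS he₁ hc hH hp, fun p hp => ?_⟩
  exact Heis.isolated_special_type_pansu hS he₁ hc hH hα hp
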